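/- Let $\mathbb F_q$ be a finite field and fix a nontrivial character $t\mapsto\varepsilon^t$ of its additive group with values in $\mathbb C^*$. Let $[1,n]=I_1\cup\dots\cup I_\ell$ be a decomposition into consecutive nonempty segments, $n_k=|I_k|$, and let $G=L\ltimes U\subseteq \mathrm{GL}(n,\mathbb F_q)$ be the corresponding parabolic subgroup of block-upper-triangular matrices, where $L=\mathrm{GL}(n_1)\times\dots\times\mathrm{GL}(n_\ell)$ consists of the block-diagonal matrices and $U=1+J$ with $J$ the algebra of strictly block-upper-triangular matrices. *Supercharacter theory.* A supercharacter theory of a finite group $G$ consists of a finite system of nonzero, pairwise orthogonal complex characters of $G$ (supercharacters) and a partition of $G$ into equally many nonempty subsets (superclasses), one of which is $\{1\}$, such that every supercharacter is constant on every superclass. *$GG$-supercharacters.* $G$ acts on $J$ by left and right multiplication and on $J^*$ by $(a\lambda b)(x)=\lambda(bxa)$. For $\lambda\in J^*$ let $H_{G\lambda G}\subseteq L$ be the subgroup of all $h\in L$ with $\mu(hxh^{-1})=\mu(x)$ for all $\mu\in G\lambda G$, $x\in J$; let $U_{\lambda,\mathrm{rt}}=\{u\in U:\lambda(ux)=\lambda(x)\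 \forall x\in J\}$. For $H_0=H_{G\lambda G}$ and a character $\theta$ of $H_0$ let $\chi_{\theta,\lambda}$ be the character of $G$ induced from the character $h(1+x)\mapsto\theta(h)\sum_{p\in L}\varepsilon^{\lambda(xp)}$ of $H_0\ltimes U_{\lambda,\mathrm{rt}}$. The $GG$-supercharacters are the $\chi_{\theta,\lambda}$ with $\lambda\in J^*$ and $\theta$ an $L$-irreducible character of $H_{G\lambda G}$ (a nonzero $L$-invariant character that is not a sum of two nonzero $L$-invariant characters). *$GG$-superclasses.* For $h\in L$ let $J_h\subseteq J$ be the orthogonal complement of the sum of all subspaces $\langle G\lambda G\rangle\subseteq J^*$ with $h\in H_{G\lambda G}$, and $\pi_h:J\to J/J_h$ the projection. The $GG$-superclasses are the sets $\mathrm{Cl}_L(h)\,(1+\pi_h^{-1}(\omega))$, where $h\in L$, $\mathrm{Cl}_L(h)$ is its conjugacy class in $L$, and $\omega$ is a $G\times G$ orbit in $J/J_h$. *Rook placements.* A $J$-root is a pair $\gamma=(i,j)$ with $E_\gamma=E_{ij}\in J$; let $\Delta_J$ be the set of $J$-roots and $\Delta_h=\{\gamma\in\Delta_J: E_\gamma\notin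 J_h\}$ for $h\in L$. A rook placement $D$ in a set $\Delta\subseteq\Delta_J$ is a subset with at most one root in each row and each column; two rook placements $D,D'$ are equivalent if $|D\cap(I_k\times I_m)|=|D'\cap(I_k\times I_m)|$ for all $1\le k<m\le\ell$. Put $x_D=\sum_{\gamma\in D}E_\gamma\in J$ and $\lambda_D=\sum_{\gamma\in D}E_\gamma^*\in J^*$. For $\gamma=(i,j)\in\Delta_J$ with $i\in I_k$, $j\in I_m$, let $H(\gamma)$ be the subgroup of all $h=(h_1,\dots,h_\ell)\in L$ such that $\mathrm{diag}(h_k,\dots,h_m)$ is a scalar matrix, and put $H(D)=\bigcap_{\gamma\in D}H(\gamma)\subseteq L$ (with $H(\emptyset)=L$). **Theorem.** Let $\mathcal A$ be the set of pairs $(\theta,D)$, where $D$ runs through a system of representatives of the classes of rook placements in $\Delta_J$ and $\theta$ runs through all irreducible characters of $H(D)$. Let $\mathcal B$ be the set of pairs $(h,D)$, where $h$ runs through a system of representatives of the conjugacy classes of $L$ and $D$ runs through a system of representatives of the classes of rook placements in $\Delta_h$. For $\alpha=(\theta,D)\in\mathcal A$ let $\chi_\alpha=\chi_{\theta,\lambda_D}$,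 formed with $H_0=H(D)$, and for $\beta=(h,D)\in\mathcal B$ let $K_\beta=\mathrm{Cl}_L(h)(1+\pi_h^{-1}(\omega))$ with $\omega$ the $G\times G$ orbit of $\pi_h(x_D)$. Then: 1. the systems $\{\chi_\alpha\}_{\alpha\in\mathcal A}$ and $\{K_\beta\}_{\beta\in\mathcal B}$ form a supercharacter theory of $G$; in particular $|\mathcal A|=|\mathcal B|$, and different parameters give different supercharacters, respectively superclasses; 2. $\{\chi_\alpha:\alpha\in\mathcal A\}$ is the set of all $GG$-supercharacters of $G$, and $\{K_\beta:\beta\in\mathcal B\}$ is the set of all $GG$-superclasses of $G$; 3. $H(D)=H_{G\lambda_DG}$ for every rook placement $D$ in $\Delta_J$; 4. for every $h=(h_1,\dots,h_\ell)\in L$ there is a coarsest decomposition of $[1,\ell]$ into consecutive segments such that for each segment $[k,m]$ either $k=m$ or $\mathrm{diag}(h_k,\dots,h_m)$ is scalar; and $J_h$ is the set of all $x\in J$ with $x_{ij}=0$ whenever $i\in I_k$, $j\in I_m$ with $k,m$ in the same segment of this decomposition. -/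

import Mathlib

noncomputable section

namespace GGParabolic

open Matrix

/-! ### Characters and supercharacter theories of finite groups -/

/-- `f` is the character of a finite-dimensional complex representation of `G`
(in coordinates; the zero representation is allowed here). -/
def IsCharacter {G : Type*} [Group G] (f : G → ℂ) : Prop :=
  ∃ (d : ℕ) (ρ : Representation ℂ G (Fin d → ℂ)), ρ.character = f

/-- `f` is the character of an irreducible finite-dimensional complex representation of `G`. -/
def IsIrreducibleCharacter {G : Type*} [Group G] (f : G → ℂ) : Prop :=
  ∃ (d : ℕ) (ρ : Representation ℂ G (Fin d → ℂ)), ρ.IsIrreducible ∧ ρ.character = f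

/-- The set of irreducible complex characters of `G`, as a type. -/
abbrev Irr (G : Type*) [Group G] : Type _ := {f : G → ℂ // IsIrreducibleCharacter f}

/-- The Hermitian scalar product of complex functions on a finite group. -/
def scalarProduct {G : Type*} [Group G] (f f' : G → ℂ) : ℂ :=
  (Nat.card G : ℂ)⁻¹ * ∑ᶠ g : G, f g * starRingEnd ℂ (f' g)

/-- The systems of characters `χ a`, `a ∈ A`, and of subsets `K b`, `b ∈ B`, form a supercharacter
theory of the finite group `G`. Different indices give different supercharacters (they are nonzero
and orthogonal) and different superclasses (they are nonempty and disjoint). -/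
structure IsSupercharacterTheory {G A B : Type*} [Group G]
    (χ : A → G → ℂ) (K : B → Set G) : Prop where
  isCharacter : ∀ a, IsCharacter (χ a)
  ne_zero : ∀ a, χ a ≠ 0
  orthogonal : ∀ a a', a ≠ a' → scalarProduct (χ a) (χ a') = 0
  nonempty : ∀ b, (K b).Nonempty
  disjoint : ∀ b b', b ≠ b' → Disjoint (K b) (K b')
  cover : ⋃ b, K b = Set.univ
  one : ∃ b, K b = {1}
  constant : ∀ a b, ∀ g ∈ K b, ∀ g' ∈ K b, χ a g = χ a g'
  finite_left : Finite A
  finite_right : Finite B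
  card_eq : Nat.card A = Nat.card B

open Classical in
/-- Extension by zero of a function on a subgroup. -/
def extendByZero {G : Type*} [Group G] (H : Subgroup G) (f : H → ℂ) (g : G) : ℂ :=
  if hg : g ∈ H then f ⟨g, hg⟩ else 0

/-- The class function of `G` induced from a class function of a subgroup `H`. -/
def induced {G : Type*} [Group G] (H : Subgroup G) (f : H → ℂ) (g : G) : ℂ :=
  (Nat.card H : ℂ)⁻¹ * ∑ᶠ s : G, extendByZero H f (s * g * s⁻¹)

/-- `f` is invariant under conjugation by elements of `L`. -/
def ConjInvariant {G : Type*} [Group G] (L : Subgroup G) {H : Subgroup G} (f : H → ℂ) : Prop :=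
  ∀ p ∈ L, ∀ x y : H, (y : G) = p * x * p⁻¹ → f y = f x

/-- `L`-irreducible characters of a subgroup `H` normalized by `L`: nonzero `L`-invariant characters
that are not a sum of two nonzero `L`-invariant characters. -/
structure IsRelIrreducible {G : Type*} [Group G] (L : Subgroup G) {H : Subgroup G}
    (θ : H → ℂ) : Prop where
  isCharacter : IsCharacter θ
  invariant : ConjInvariant L θ
  ne_zero : θ ≠ 0
  indecomposable : ∀ θ₁ θ₂ : H → ℂ, IsCharacter θ₁ → IsCharacter θ₂ →
    ConjInvariant L θ₁ → ConjInvariant L θ₂ → θ = θ₁ + θ₂ → θ₁ = 0 ∨ θ₂ = 0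

/-! ### Parabolic subgroups -/

variable {n : ℕ} (c : Composition n) (F : Type*) [Field F]

/-- The block-upper-triangular invertible matrices; `c.index i` is the number of the segment of the
decomposition `c` of the index set that contains `i`. -/
def parabolic : Subgroup (GL (Fin n) F) where
  carrier := {g | BlockTriangular (g : Matrix (Fin n) (Fin n) F) c.index}
  one_mem' := by
    simpa using (blockTriangular_one : BlockTriangular (1 : Matrix (Fin n) (Fin n) F) c.index)
  mul_mem' := by
    intro a b ha hb
    simpa using BlockTriangular.mul ha hb
  inv_mem' := by
    intro a ha
    have : Invertible (a : Matrix (Fin n) (Fin n) F) := a.invertible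
    have h := blockTriangular_inv_of_blockTriangular (M := (a : Matrix (Fin n) (Fin n) F)) ha
    simpa [Matrix.coe_units_inv] using h

/-- The parabolic subgroup, as a type. -/
abbrev Par : Type _ := parabolic c F

variable {c F}

/-- The underlying matrix of an element of the parabolic subgroup. -/
def mat (g : Par c F) : Matrix (Fin n) (Fin n) F := ((g : GL (Fin n) F) : Matrix (Fin n) (Fin n) F)

theorem mat_block (g : Par c F) (i j : Fin n) (h : c.index j < c.index i) : mat g i j = 0 :=
  g.2 h

@[simp] theorem mat_one : mat (1 : Par c F) = 1 := rfl

@[simp] theorem mat_mul (g h : Par c F) : mat (g * h) = mat g * mat h := rfl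

theorem mat_mul_inv (g : Par c F) : mat g * mat g⁻¹ = 1 := by
  rw [← mat_mul, mul_inv_cancel, mat_one]

theorem mat_inv_mul (g : Par c F) : mat g⁻¹ * mat g = 1 := by
  rw [← mat_mul, inv_mul_cancel, mat_one]

theorem mat_injective : Function.Injective (mat : Par c F → _) :=
  fun _ _ h => Subtype.ext (Units.ext h)

/-- The block-diagonal part of a matrix. -/
def diagPart (c : Composition n) (M : Matrix (Fin n) (Fin n) F) : Matrix (Fin n) (Fin n) F :=
  Matrix.of fun i j => if c.index i = c.index j then M i j else 0

theorem diagPart_mul (g h : Par c F) :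
    diagPart c (mat g) * diagPart c (mat h) = diagPart c (mat (g * h)) := by
  ext i j
  simp only [diagPart, mat_mul, Matrix.mul_apply, Matrix.of_apply]
  split_ifs with hij
  · refine Finset.sum_congr rfl fun k _ => ?_
    rcases lt_trichotomy (c.index i) (c.index k) with hk | hk | hk
    · rw [mat_block h k j (hij ▸ hk)]; simp
    · simp [hk, ← hij]
    · rw [mat_block g i k hk]; simp
  · refine Finset.sum_eq_zero fun k _ => ?_
    by_cases hk : c.index i = c.index k
    · rw [if_neg (fun h' => hij (hk.trans h')), mul_zero]
    · rw [if_neg hk, zero_mul]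

theorem diagPart_one : diagPart c (mat (1 : Par c F)) = 1 := by
  ext i j
  by_cases hij : i = j
  · subst hij
    simp [diagPart]
  · simp [diagPart, Matrix.one_apply_ne hij]

/-- The Levi component `h` of `g = h (1 + x)`, that is, the block-diagonal part of `g`. -/
def leviPart (g : Par c F) : Par c F :=
  ⟨⟨diagPart c (mat g), diagPart c (mat g⁻¹),
      by rw [diagPart_mul, mul_inv_cancel, diagPart_one],
      by rw [diagPart_mul, inv_mul_cancel, diagPart_one]⟩,
    fun i j hij => by simp [diagPart, hij.ne']⟩

theorem mat_leviPart (g : Par c F) : mat (leviPart g) = diagPart c (mat g) := rfl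

theorem mat_inv_leviPart (g : Par c F) : mat (leviPart g)⁻¹ = diagPart c (mat g⁻¹) := rfl

variable (c F)

/-- The Levi subgroup `L = GL(n₁) × ⋯ × GL(n_ℓ)` of block-diagonal matrices. -/
def levi : Subgroup (Par c F) where
  carrier := {g | ∀ i j, c.index i ≠ c.index j → mat g i j = 0}
  one_mem' := by
    intro i j hij
    rw [mat_one, Matrix.one_apply_ne (fun h : i = j => hij (congrArg c.index h))]
  mul_mem' := by
    intro a b ha hb i j hij
    rw [mat_mul, Matrix.mul_apply]
    refine Finset.sum_eq_zero fun k _ => ?_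
    by_cases hk : c.index i = c.index k
    · rw [hb k j (fun h => hij (hk.trans h)), mul_zero]
    · rw [ha i k hk, zero_mul]
  inv_mem' := by
    intro a ha i j hij
    have h : leviPart a = a := by
      apply mat_injective
      ext i j
      by_cases h : c.index i = c.index j
      · simp [mat_leviPart, diagPart, h]
      · simp [mat_leviPart, diagPart, h, ha i j h]
    rw [← h, mat_inv_leviPart]
    simp [diagPart, hij]

/-- The nilpotent algebra `J` of strictly block-upper-triangular matrices. -/
def radical : Submodule F (Matrix (Fin n) (Fin n) F) where
  carrier := {x | ∀ i j, c.index j ≤ c.index i → x i j = 0}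
  zero_mem' := by intro i j _; rfl
  add_mem' := by
    intro a b ha hb i j h
    rw [Matrix.add_apply, ha i j h, hb i j h, add_zero]
  smul_mem' := by
    intro t a ha i j h
    rw [Matrix.smul_apply, ha i j h, smul_zero]

variable {c F}

theorem mul_mem_radical (g : Par c F) {x : Matrix (Fin n) (Fin n) F} (hx : x ∈ radical c F) :
    mat g * x ∈ radical c F := by
  intro i j hij
  rw [Matrix.mul_apply]
  refine Finset.sum_eq_zero fun k _ => ?_
  rcases lt_or_ge (c.index k) (c.index i) with hk | hk
  · rw [mat_block g i k hk, zero_mul]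
  · rw [hx k j (hij.trans hk), mul_zero]

theorem mem_radical_mul (g : Par c F) {x : Matrix (Fin n) (Fin n) F} (hx : x ∈ radical c F) :
    x * mat g ∈ radical c F := by
  intro i j hij
  rw [Matrix.mul_apply]
  refine Finset.sum_eq_zero fun k _ => ?_
  rcases lt_or_ge (c.index j) (c.index k) with hk | hk
  · rw [mat_block g k j hk, mul_zero]
  · rw [hx i k (hk.trans hij), zero_mul]

/-- Left multiplication `x ↦ g x` on `J`. -/
def lmul (g : Par c F) : radical c F →ₗ[F] radical c F where
  toFun x := ⟨mat g * x, mul_mem_radical g x.2⟩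
  map_add' x y := Subtype.ext (by simp [Matrix.mul_add])
  map_smul' t x := Subtype.ext (by simp)

/-- Right multiplication `x ↦ x g` on `J`. -/
def rmul (g : Par c F) : radical c F →ₗ[F] radical c F where
  toFun x := ⟨(x : Matrix (Fin n) (Fin n) F) * mat g, mem_radical_mul g x.2⟩
  map_add' x y := Subtype.ext (by simp [Matrix.add_mul])
  map_smul' t x := Subtype.ext (by simp)

theorem lmul_mul (g h : Par c F) (x : radical c F) : lmul (g * h) x = lmul g (lmul h x) :=
  Subtype.ext (by simp [lmul, Matrix.mul_assoc])

theorem rmul_mul (g h : Par c F) (x : radical c F) : rmul (g * h) x = rmul h (rmul g x) :=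
  Subtype.ext (by simp [rmul, Matrix.mul_assoc])

theorem lmul_one (x : radical c F) : lmul (1 : Par c F) x = x := Subtype.ext (by simp [lmul])

theorem rmul_one (x : radical c F) : rmul (1 : Par c F) x = x := Subtype.ext (by simp [rmul])

theorem lmul_rmul (g h : Par c F) (x : radical c F) : lmul g (rmul h x) = rmul h (lmul g x) :=
  Subtype.ext (by simp [lmul, rmul, Matrix.mul_assoc])

theorem sub_one_mem_radical (g : Par c F) : mat ((leviPart g)⁻¹ * g) - 1 ∈ radical c F := by
  intro i j hij
  have key : mat ((leviPart g)⁻¹ * g) i j = (1 : Matrix (Fin n) (Fin n) F) i j := by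
    rcases hij.lt_or_eq with h | h
    · rw [mat_block _ i j h, Matrix.one_apply_ne]
      rintro rfl
      exact lt_irrefl _ h
    · have h1 : diagPart c (mat ((leviPart g)⁻¹ * g)) = 1 := by
        rw [← diagPart_mul, mat_inv_leviPart]
        have : diagPart c (diagPart c (mat g⁻¹)) = diagPart c (mat g⁻¹) := by
          ext i j
          simp only [diagPart, Matrix.of_apply]
          split_ifs <;> rfl
        rw [this, diagPart_mul, inv_mul_cancel, diagPart_one]
      rw [← h1]
      simp [diagPart, h]
  rw [Matrix.sub_apply, key, sub_self]

/-- The component `x ∈ J` of `g = h (1 + x)`, with `h` the Levi component of `g`. -/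
def radPart (g : Par c F) : radical c F := ⟨mat ((leviPart g)⁻¹ * g) - 1, sub_one_mem_radical g⟩

/-! ### Linear forms, orbits and stabilizers -/

variable (c F) in
/-- The dual space `J*`. -/
abbrev Forms : Type _ := Module.Dual F (radical c F)

/-- The `G × G` orbit `G x G` of `x ∈ J`. -/
def orbit (x : radical c F) : Set (radical c F) := {y | ∃ a b : Par c F, y = lmul a (rmul b x)}

/-- The linear form `a lam b : x ↦ lam (b x a)`. -/
def formAct (a : Par c F) (lam : Forms c F) (b : Par c F) : Forms c F :=
  lam ∘ₗ lmul b ∘ₗ rmul a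

/-- The `G × G` orbit `G lam G` of a linear form. -/
def formOrbit (lam : Forms c F) : Set (Forms c F) := {μ | ∃ a b : Par c F, μ = formAct a lam b}

/-- The subgroup `H_{G lam G}` of the elements of `L` whose coadjoint action fixes every linear form
in `G lam G`. -/
def orbitStabilizer (lam : Forms c F) : Subgroup (Par c F) where
  carrier := {h | h ∈ levi c F ∧ ∀ μ ∈ formOrbit lam, ∀ x, μ (lmul h (rmul h⁻¹ x)) = μ x}
  one_mem' := ⟨one_mem _, fun μ _ x => by rw [inv_one, rmul_one, lmul_one]⟩
  mul_mem' := by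
    rintro a b ⟨ha, ha'⟩ ⟨hb, hb'⟩
    refine ⟨mul_mem ha hb, fun μ hμ x => ?_⟩
    rw [_root_.mul_inv_rev, rmul_mul, lmul_mul, lmul_rmul b, ha' μ hμ, hb' μ hμ]
  inv_mem' := by
    rintro a ⟨ha, ha'⟩
    refine ⟨inv_mem ha, fun μ hμ x => ?_⟩
    rw [← ha' μ hμ (lmul a⁻¹ (rmul a⁻¹⁻¹ x)), inv_inv, ← lmul_rmul, ← lmul_mul, ← rmul_mul,
      mul_inv_cancel, lmul_one, rmul_one]

/-- The right stabilizer `U_{lam,rt}` of `lam` in `U = 1 + J`: the elements `u ∈ U` such that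
`lam (u x) = lam x` for all `x ∈ J`. -/
def rightStabilizer (lam : Forms c F) : Subgroup (Par c F) where
  carrier := {u | mat u - 1 ∈ radical c F ∧ ∀ x, lam (lmul u x) = lam x}
  one_mem' := ⟨by simp, fun x => by rw [lmul_one]⟩
  mul_mem' := by
    rintro a b ⟨ha, ha'⟩ ⟨hb, hb'⟩
    refine ⟨?_, fun x => by rw [lmul_mul, ha', hb']⟩
    have : mat (a * b) - 1 = (mat a - 1) * mat b + (mat b - 1) := by
      rw [mat_mul, sub_mul, one_mul]; abel
    rw [this]
    exact add_mem (mem_radical_mul b ha) hb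
  inv_mem' := by
    rintro a ⟨ha, ha'⟩
    refine ⟨?_, fun x => by rw [← ha' (lmul a⁻¹ x), ← lmul_mul, mul_inv_cancel, lmul_one]⟩
    have : mat a⁻¹ - 1 = -(mat a⁻¹ * (mat a - 1)) := by
      rw [mul_sub, mat_inv_mul, mul_one]; abel
    rw [this]
    exact neg_mem (mul_mem_radical a⁻¹ ha)

/-- The subgroup `G_{0,lam} = H₀ ⋉ U_{lam,rt}`, for a subgroup `H₀` of the stabilizer of `lam`
in `L`. -/
def semidirect (H₀ : Subgroup (Par c F)) (lam : Forms c F) : Subgroup (Par c F) :=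
  H₀ ⊔ rightStabilizer lam

/-- The function `h (1 + x) ↦ θ(h) ε^{lam(x)}`, where `θ` is extended by zero. -/
def xi (ε : AddChar F ℂ) (H₀ : Subgroup (Par c F)) (θ : H₀ → ℂ) (lam : Forms c F)
    (g : Par c F) : ℂ :=
  extendByZero H₀ θ (leviPart g) * ε (lam (radPart g))

/-- The character of `G` induced from the character `∑_{p ∈ L} ξ_{θ, p lam}` of the subgroup
`H₀ ⋉ U_{lam,rt}`. -/
def chi (ε : AddChar F ℂ) (H₀ : Subgroup (Par c F)) (θ : H₀ → ℂ) (lam : Forms c F) :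
    Par c F → ℂ :=
  induced (semidirect H₀ lam) fun g => ∑ᶠ p : levi c F, xi ε H₀ θ (formAct p lam 1) g

variable (c) in
/-- The set of all `GG`-supercharacters `χ_{θ,lam}`, where `lam ∈ J*` and `θ` is an
`L`-irreducible character of `H_{G lam G}`. -/
def ggSupercharacters (ε : AddChar F ℂ) : Set (Par c F → ℂ) :=
  {f | ∃ (lam : Forms c F) (θ : orbitStabilizer lam → ℂ),
    IsRelIrreducible (levi c F) θ ∧ f = chi ε (orbitStabilizer lam) θ lam}

/-! ### Superclasses -/

/-- The sum of all subspaces of `J*` spanned by the orbits `G lam G` with `h ∈ H_{G lam G}`. -/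
def fixedForms (h : levi c F) : Submodule F (Forms c F) :=
  ⨆ (lam : Forms c F) (_ : (h : Par c F) ∈ orbitStabilizer lam), Submodule.span F (formOrbit lam)

/-- The ideal `J_h`, the orthogonal complement of `fixedForms h` in `J`. -/
def idealOf (h : levi c F) : Submodule F (radical c F) := (fixedForms h).dualCoannihilator

/-- The superclass `Cl_L(h) (1 + π_h⁻¹(ω))`, where `π_h : J → J / J_h` is the projection and
`ω = π_h(G x G)` is the `G × G` orbit of `π_h x` in `J / J_h`. -/
def superclass (h : levi c F) (x : radical c F) : Set (Par c F) :=
  {g | ∃ (h' : levi c F) (y : radical c F), IsConj h h' ∧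
    (idealOf h).mkQ y ∈ (idealOf h).mkQ '' orbit x ∧
    mat g = mat (h' : Par c F) * (1 + (y : Matrix (Fin n) (Fin n) F))}

variable (c F) in
/-- The set of all `GG`-superclasses. -/
def ggSuperclasses : Set (Set (Par c F)) :=
  {K | ∃ (h : levi c F) (x : radical c F), K = superclass h x}

/-! ### Roots and rook placements -/

/-- The set `Δ_J` of the `J`-roots: the pairs `(i, j)`, with `i` in an earlier segment than `j`. -/
def jRoots (c : Composition n) : Set (Fin n × Fin n) := {γ | c.index γ.1 < c.index γ.2}

/-- The `J`-roots are exactly the pairs whose matrix unit belongs to `J`. -/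
theorem mem_jRoots_iff (γ : Fin n × Fin n) :
    γ ∈ jRoots c ↔ Matrix.single γ.1 γ.2 (1 : F) ∈ radical c F := by
  constructor
  · intro h i j hij
    rw [Matrix.single_apply, if_neg]
    rintro ⟨rfl, rfl⟩
    exact absurd h (not_lt.mpr hij)
  · intro h
    by_contra hlt
    have := h γ.1 γ.2 (not_lt.mp hlt)
    simp at this

open Classical in
/-- The matrix unit `E_γ` as an element of `J`, for a `J`-root `γ` (and zero for other pairs). -/
def rootUnit (γ : Fin n × Fin n) : radical c F :=
  if h : γ ∈ jRoots c then ⟨Matrix.single γ.1 γ.2 1, (mem_jRoots_iff γ).mp h⟩ else 0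

/-- The element `E_γ*` of the dual basis of `J*`: the matrix entry at `γ`. -/
def rootForm (γ : Fin n × Fin n) : Forms c F :=
  Matrix.entryLinearMap F F γ.1 γ.2 ∘ₗ (radical c F).subtype

/-- `x_D`, the sum of the `E_γ` over `γ ∈ D`. -/
def rookElement (D : Finset (Fin n × Fin n)) : radical c F := ∑ γ ∈ D, rootUnit γ

/-- `lam_D`, the sum of the `E_γ*` over `γ ∈ D`. -/
def rookForm (D : Finset (Fin n × Fin n)) : Forms c F := ∑ γ ∈ D, rootForm γ

/-- `D` is a rook placement in `Δ`: it has at most one root in any row and any column. -/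
structure IsRookPlacement (Δ : Set (Fin n × Fin n)) (D : Finset (Fin n × Fin n)) : Prop where
  subset : ∀ γ ∈ D, γ ∈ Δ
  row : ∀ γ ∈ D, ∀ γ' ∈ D, γ.1 = γ'.1 → γ = γ'
  col : ∀ γ ∈ D, ∀ γ' ∈ D, γ.2 = γ'.2 → γ = γ'

/-- The number `d_{km}` of the roots of `D` in `I_k × I_m`. -/
def blockCount (c : Composition n) (D : Finset (Fin n × Fin n)) (k m : Fin c.length) : ℕ :=
  (D.filter fun γ => c.index γ.1 = k ∧ c.index γ.2 = m).card

/-- Equivalence of rook placements. -/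
def RookEquiv (c : Composition n) (D D' : Finset (Fin n × Fin n)) : Prop :=
  ∀ k m : Fin c.length, k < m → blockCount c D k m = blockCount c D' k m

/-- `R` is a system of representatives of the classes of rook placements in `Δ`. -/
def IsRookTransversal (c : Composition n) (Δ : Set (Fin n × Fin n))
    (R : Set (Finset (Fin n × Fin n))) : Prop :=
  (∀ D ∈ R, IsRookPlacement Δ D) ∧
    ∀ D, IsRookPlacement Δ D → ∃! D', D' ∈ R ∧ RookEquiv c D D'

/-- `T` is a system of representatives of the conjugacy classes of a group. -/
def IsConjTransversal {G : Type*} [Group G] (T : Set G) : Prop :=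
  ∀ g : G, ∃! t, t ∈ T ∧ IsConj g t

/-- The submatrix `diag(h_k, …, h_m)` of a block-diagonal matrix is scalar. -/
def IsScalarOn (h : Par c F) (k m : Fin c.length) : Prop :=
  ∃ a : F, ∀ s t : Fin n, c.index s ∈ Set.Icc k m → c.index t ∈ Set.Icc k m →
    mat h s t = if s = t then a else 0

theorem IsScalarOn.row {h : Par c F} (hh : h ∈ levi c F) {k m : Fin c.length} {a : F}
    (ha : ∀ s t : Fin n, c.index s ∈ Set.Icc k m → c.index t ∈ Set.Icc k m →
      mat h s t = if s = t then a else 0) (s t : Fin n) (hs : c.index s ∈ Set.Icc k m) :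
    mat h s t = if s = t then a else 0 := by
  by_cases hst : c.index s = c.index t
  · exact ha s t hs (hst ▸ hs)
  · rw [hh s t hst, if_neg (fun h' : s = t => hst (congrArg c.index h'))]

variable (F) in
/-- The subgroup `H(γ)` for `γ = (i, j)` with `i ∈ I_k`, `j ∈ I_m`: the elements
`(h_1, …, h_ℓ)` of `L` such that `(h_k, …, h_m)` is scalar. -/
def rootSubgroup (c : Composition n) (γ : Fin n × Fin n) : Subgroup (Par c F) where
  carrier := {h | h ∈ levi c F ∧ IsScalarOn h (c.index γ.1) (c.index γ.2)}
  one_mem' := ⟨one_mem _, 1, fun s t _ _ => by rw [mat_one, Matrix.one_apply]⟩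
  mul_mem' := by
    rintro g h ⟨hg, a, ha⟩ ⟨hh, b, hb⟩
    refine ⟨mul_mem hg hh, a * b, fun s t hs ht => ?_⟩
    rw [mat_mul, Matrix.mul_apply]
    simp [IsScalarOn.row hg ha s _ hs, hb s t hs ht]
  inv_mem' := by
    rintro g ⟨hg, a, ha⟩
    refine ⟨inv_mem hg, a⁻¹, fun s t hs ht => ?_⟩
    have key : ∀ u, a * mat g⁻¹ s u = if s = u then 1 else 0 := by
      intro u
      have := congrFun (congrFun (mat_mul_inv g) s) u
      rw [Matrix.mul_apply, Matrix.one_apply] at this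
      simpa [IsScalarOn.row hg ha s _ hs] using this
    have ha0 : a ≠ 0 := by
      rintro rfl
      simpa using key s
    have := key t
    split_ifs at this ⊢ with hst
    · exact eq_inv_of_mul_eq_one_right this
    · exact (mul_eq_zero.mp this).resolve_left ha0

variable (F) in
/-- The subgroup `H(D)` of `L`, the intersection of the `H(γ)` over `γ ∈ D`. -/
def rookSubgroup (c : Composition n) (D : Finset (Fin n × Fin n)) : Subgroup (Par c F) :=
  levi c F ⊓ ⨅ γ ∈ D, rootSubgroup F c γ

/-- The set `Δ_h` of the `J`-roots `γ` with `E_γ ∉ J_h`. -/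
def rootsOf (h : levi c F) : Set (Fin n × Fin n) :=
  {γ | γ ∈ jRoots c ∧ (rootUnit γ : radical c F) ∉ idealOf h}

/-- A decomposition of `[1, ℓ]` into consecutive segments (an equivalence relation with
order-connected classes) such that, for each segment `[k, m]`, either `k = m` or `(h_k, …, h_m)`
is scalar. -/
def IsScalarDecomposition (h : levi c F) (r : Setoid (Fin c.length)) : Prop :=
  ∀ k m : Fin c.length, k ≤ m → r k m →
    (∀ t ∈ Set.Icc k m, r k t) ∧ (k = m ∨ IsScalarOn (h : Par c F) k m)

/-- The radical of the coarser parabolic subgroup whose segments are the unions of the `I_k` over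
the classes of `r`, where the classes of `r` are segments. -/
def coarseRadical (r : Setoid (Fin c.length)) : Set (radical c F) :=
  {x | ∀ i j, r (c.index i) (c.index j) → (x : Matrix (Fin n) (Fin n) F) i j = 0}

end GGParabolic

end

open GGParabolic

noncomputable section

namespace GGParabolic

open Matrix

/-! ### Complex characters of finite groups: orthogonality, completeness, Frobenius reciprocity. -/

section Characters

variable {G : Type*} [Group G]

/-! Orbits. The trace form presents a linear form on `J` as `x ↦ tr (M x)`, where only the strictly
block-lower entries of `M` matter, and the two-sided action on forms becomes multiplication of `M`
by block-triangular matrices. Gaussian elimination from the bottom row upwards turns every matrix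
into a partial permutation matrix (`exists_rookMatrix`). Permutations inside the segments are
available too, so only the numbers of rooks in the blocks matter. Conversely, the ranks of the
lower-left corners recover these numbers (`rank_corner_le`, `rank_corner_rookMatrix`). The same
argument, restricted to the corners that are visible modulo `J_h`, classifies the orbits in `J /
J_h`.

Stabilizers. Testing the fixing condition for `lam_D` on matrix units and elementary matrices shows
that `h` fixes the whole orbit exactly when it is scalar across the segments spanned by each root of
`D` (`rookSubgroup_eq_orbitStabilizer`). This yields `J_h` (`coe_idealOf`) and the duality `h ∈ H(D)
↔ D ⊆ Δ_h` (`mem_rookSubgroup_iff_subset`).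

Values. For `g = h (1 + x)` the supercharacter is `θ(h)`, extended by zero, times a positive
constant times the sum of `ε^{lam(a x b)}` over `a, b ∈ G` (`chi_apply`). Hence it depends only on
the orbit of `lam`. It is constant on superclasses, because the orbit of `lam` kills `J_h` whenever
`h` is in the stabilizer. The scalar product of two supercharacters splits into a sum over `L` and a
sum over `J`: different orbits are separated by the additive characters of `J`, different `θ` on the
same orbit by the orthogonality relations in `H(D)`.

Counting. An element of `L` acts on `H(D)` like an element of `H(D)` (`exists_conj_eq`), so
`L`-irreducible means irreducible, and `H(D)` has as many irreducible characters as there are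
classes of `L` meeting it. Both families are therefore counted by the pairs of a class of `h` and a
class of `D` with `h ∈ H(D)`. -/

theorem isCharacter_character {V : Type*} [AddCommGroup V] [Module ℂ V] [FiniteDimensional ℂ V]
    (ρ : Representation ℂ G V) : IsCharacter ρ.character := by
  let e := (Module.finBasis ℂ V).equivFun
  let σ : Representation ℂ G (Fin (Module.finrank ℂ V) → ℂ) :=
    (e.conjAlgEquiv ℂ : Module.End ℂ V →* _).comp ρ
  refine ⟨_, σ, (Representation.char_iso (Representation.Equiv.mk e fun g => ?_)).symm⟩
  ext v i
  simp [σ]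

theorem isIrreducible_of_equiv {V W : Type*} [AddCommGroup V] [Module ℂ V] [AddCommGroup W]
    [Module ℂ W] {ρ : Representation ℂ G V} {σ : Representation ℂ G W} (φ : ρ.Equiv σ)
    (h : ρ.IsIrreducible) : σ.IsIrreducible := by
  let f : Subrepresentation ρ ≃o Subrepresentation σ :=
    { toFun := fun W => ⟨W.toSubmodule.map φ.toLinearEquiv.toLinearMap, by
        rintro g _ ⟨v, hv, rfl⟩
        exact ⟨ρ g v, W.apply_mem_toSubmodule g hv, LinearMap.congr_fun (φ.isIntertwining' g) v⟩⟩
      invFun := fun W => ⟨W.toSubmodule.comap φ.toLinearEquiv.toLinearMap, by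
        intro g v hv
        have h1 : φ.toLinearEquiv (ρ g v) = σ g (φ.toLinearEquiv v) :=
          LinearMap.congr_fun (φ.isIntertwining' g) v
        rw [Submodule.mem_comap]
        exact h1 ▸ W.apply_mem_toSubmodule g hv⟩
      left_inv := fun W => Subrepresentation.toSubmodule_injective
        (Submodule.comap_map_eq_of_injective φ.toLinearEquiv.injective _)
      right_inv := fun W => Subrepresentation.toSubmodule_injective
        (Submodule.map_comap_eq_of_surjective φ.toLinearEquiv.surjective _)
      map_rel_iff' := fun {W W'} =>
        Submodule.map_le_map_iff_of_injective φ.toLinearEquiv.injective W.toSubmodule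
          W'.toSubmodule }
  exact f.isSimpleOrder_iff.mp h

theorem isIrreducibleCharacter_character {V : Type*} [AddCommGroup V] [Module ℂ V]
    [FiniteDimensional ℂ V] (ρ : Representation ℂ G V) (h : ρ.IsIrreducible) :
    IsIrreducibleCharacter ρ.character := by
  let e := (Module.finBasis ℂ V).equivFun
  let σ : Representation ℂ G (Fin (Module.finrank ℂ V) → ℂ) :=
    (e.conjAlgEquiv ℂ : Module.End ℂ V →* _).comp ρ
  have φ : ρ.Equiv σ := Representation.Equiv.mk e fun g => by ext v i; simp [σ]
  exact ⟨_, σ, isIrreducible_of_equiv φ h, (Representation.char_iso φ).symm⟩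

theorem IsIrreducibleCharacter.isCharacter {f : G → ℂ} (h : IsIrreducibleCharacter f) :
    IsCharacter f := by
  obtain ⟨d, ρ, -, h⟩ := h
  exact ⟨d, ρ, h⟩

theorem isCharacter_zero : IsCharacter (0 : G → ℂ) := by
  refine ⟨0, 1, ?_⟩
  ext g
  simp [Representation.character]

theorem IsCharacter.add {f f' : G → ℂ} (h : IsCharacter f) (h' : IsCharacter f') :
    IsCharacter (f + f') := by
  obtain ⟨d, ρ, rfl⟩ := h
  obtain ⟨d', ρ', rfl⟩ := h'
  convert isCharacter_character (ρ.prod ρ') using 1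
  ext g
  simp [Representation.character, Representation.prod, LinearMap.trace_prodMap']

theorem IsCharacter.sum {ι : Type*} (s : Finset ι) {f : ι → G → ℂ}
    (h : ∀ i ∈ s, IsCharacter (f i)) : IsCharacter (∑ i ∈ s, f i) :=
  Finset.sum_induction f IsCharacter (fun _ _ => IsCharacter.add) isCharacter_zero h

theorem IsCharacter.nsmul {f : G → ℂ} (h : IsCharacter f) (m : ℕ) : IsCharacter (m • f) := by
  induction m with
  | zero => simpa using isCharacter_zero
  | succ m ih => rw [succ_nsmul]; exact ih.add h

theorem IsCharacter.comp {H : Type*} [Group H] {f : G → ℂ} (h : IsCharacter f) (φ : H →* G) :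
    IsCharacter (f ∘ φ) := by
  obtain ⟨d, ρ, rfl⟩ := h
  exact ⟨d, MonoidHom.comp ρ φ, rfl⟩

theorem IsCharacter.twist {f : G → ℂ} (h : IsCharacter f) (ψ : G →* ℂ) :
    IsCharacter (fun g => f g * ψ g) := by
  obtain ⟨d, ρ, rfl⟩ := h
  refine ⟨d, { toFun := fun g => ψ g • ρ g, map_one' := by simp, map_mul' := fun a b => ?_ }, ?_⟩
  · rw [map_mul, map_mul, smul_mul_smul_comm]
  · ext g
    simp [Representation.character, mul_comm]

theorem IsCharacter.conj {f : G → ℂ} (h : IsCharacter f) (s g : G) : f (s * g * s⁻¹) = f g := by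
  obtain ⟨d, ρ, rfl⟩ := h
  exact ρ.char_conj g s

open scoped ComplexOrder in
/-- The unitary trick: the character values at inverse elements are complex conjugate. -/
theorem IsCharacter.star [Finite G] {f : G → ℂ} (h : IsCharacter f) (g : G) :
    starRingEnd ℂ (f g) = f g⁻¹ := by
  classical
  have := Fintype.ofFinite G
  obtain ⟨d, ρ, rfl⟩ := h
  let A : G → Matrix (Fin d) (Fin d) ℂ := fun g => LinearMap.toMatrix' (ρ g)
  have hA : ∀ a b, A (a * b) = A a * A b := fun a b => by
    simp [A, LinearMap.toMatrix'_mul]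
  have hA1 : A 1 = 1 := by simp [A]
  have htr : ∀ g, ρ.character g = (A g).trace := fun g => by
    simp [A, Representation.character, LinearMap.trace_eq_matrix_trace ℂ (Pi.basisFun ℂ (Fin d)),
      LinearMap.toMatrix_eq_toMatrix']
  -- The averaged Hermitian form is invariant, and its summand at the identity element is the unit
  -- matrix, which makes it definite.
  let P := ∑ s, (A s)ᴴ * A s
  have hP : P.PosDef := by
    have : P = 1 + ∑ s ∈ Finset.univ.erase (1 : G), (A s)ᴴ * A s := by
      simp only [P]
      rw [← Finset.add_sum_erase _ _ (Finset.mem_univ (1 : G))]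
      simp [hA1]
    rw [this]
    exact Matrix.PosDef.add_posSemidef Matrix.PosDef.one
      (Matrix.posSemidef_sum _ fun s _ => Matrix.posSemidef_conjTranspose_mul_self _)
  have hinv : (A g)ᴴ * P * A g = P := by
    simp only [P, Finset.mul_sum, Finset.sum_mul]
    refine Fintype.sum_equiv (Equiv.mulRight g) _ _ fun s => ?_
    simp [hA, Matrix.conjTranspose_mul, Matrix.mul_assoc]
  have h1 : (A g)ᴴ * P = P * A g⁻¹ := by
    rw [← hinv, Matrix.mul_assoc _ (A g), ← hA, mul_inv_cancel, hA1, Matrix.mul_one, hinv]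
  have hu : IsUnit P.det := (Matrix.isUnit_iff_isUnit_det _).mp hP.isUnit
  rw [htr, htr]
  calc starRingEnd ℂ (A g).trace = ((A g)ᴴ).trace := by rw [Matrix.trace_conjTranspose]; rfl
    _ = ((A g)ᴴ * P * P⁻¹).trace := by rw [Matrix.mul_assoc, Matrix.mul_nonsing_inv _ hu, mul_one]
    _ = (P * A g⁻¹ * P⁻¹).trace := by rw [h1]
    _ = (A g⁻¹).trace := by
      rw [Matrix.trace_mul_comm, ← Matrix.mul_assoc, Matrix.nonsing_inv_mul _ hu, one_mul]

open Representation in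
/-- Induction on representations of a finite group by complete reducibility. -/
theorem representation_induction [Finite G]
    {P : ∀ {V : Type} [AddCommGroup V] [Module ℂ V] [FiniteDimensional ℂ V],
      Representation ℂ G V → Prop}
    (zero : ∀ {V : Type} [AddCommGroup V] [Module ℂ V] [FiniteDimensional ℂ V]
      (ρ : Representation ℂ G V), Subsingleton V → P ρ)
    (irreducible : ∀ {V : Type} [AddCommGroup V] [Module ℂ V] [FiniteDimensional ℂ V]
      (ρ : Representation ℂ G V), ρ.IsIrreducible → P ρ)
    (compl : ∀ {V : Type} [AddCommGroup V] [Module ℂ V] [FiniteDimensional ℂ V]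
      (ρ : Representation ℂ G V) (W W' : Subrepresentation ρ),
      IsCompl W.toSubmodule W'.toSubmodule → W.toSubmodule ≠ ⊥ → W'.toSubmodule ≠ ⊥ →
      P W.toRepresentation → P W'.toRepresentation → P ρ)
    {V : Type} [AddCommGroup V] [Module ℂ V] [FiniteDimensional ℂ V]
    (ρ : Representation ℂ G V) : P ρ := by
  induction hd : Module.finrank ℂ V using Nat.strong_induction_on generalizing V with
  | _ d ih =>
  by_cases hs : Subsingleton V
  · exact zero ρ hs
  by_cases hi : ρ.IsIrreducible
  · exact irreducible ρ hi
  have hV : Nontrivial V := not_subsingleton_iff_nontrivial.mp hs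
  have hex : ∃ W : Subrepresentation ρ, W ≠ ⊥ ∧ W ≠ ⊤ := by
    by_contra! hcon
    apply hi
    have : Nontrivial (Subrepresentation ρ) := by
      refine ⟨⊥, ⊤, fun h => ?_⟩
      have := congrArg Subrepresentation.toSubmodule h
      exact bot_ne_top (α := Submodule ℂ V) this
    exact ⟨fun W => or_iff_not_imp_left.mpr (hcon W)⟩
  obtain ⟨W, hW0, hW1⟩ := hex
  obtain ⟨W', hWW'⟩ := exists_isCompl W
  have hc : IsCompl W.toSubmodule W'.toSubmodule := by
    refine ⟨disjoint_iff.mpr ?_, codisjoint_iff.mpr ?_⟩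
    · exact congrArg Subrepresentation.toSubmodule hWW'.inf_eq_bot
    · exact congrArg Subrepresentation.toSubmodule hWW'.sup_eq_top
  have hW0' : W.toSubmodule ≠ ⊥ := fun h =>
    hW0 (Subrepresentation.toSubmodule_injective h)
  have hW1' : W.toSubmodule ≠ ⊤ := fun h =>
    hW1 (Subrepresentation.toSubmodule_injective h)
  have hW2' : W'.toSubmodule ≠ ⊥ := fun h => hW1' (by simpa [h] using hc.sup_eq_top)
  have hW3' : W'.toSubmodule ≠ ⊤ := fun h => hW0' (by simpa [h] using hc.inf_eq_bot)
  refine compl ρ W W' hc hW0' hW2' (ih _ ?_ _ rfl) (ih _ ?_ _ rfl)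
  · rw [← hd]; exact Submodule.finrank_lt hW1'
  · rw [← hd]; exact Submodule.finrank_lt hW3'

open Representation in
theorem character_eq_add_of_isCompl {V : Type*} [AddCommGroup V] [Module ℂ V]
    [FiniteDimensional ℂ V] (ρ : Representation ℂ G V) (W W' : Subrepresentation ρ)
    (h : IsCompl W.toSubmodule W'.toSubmodule) :
    ρ.character = W.toRepresentation.character + W'.toRepresentation.character := by
  have : W.toRepresentation.character + W'.toRepresentation.character =
      (W.toRepresentation.prod W'.toRepresentation).character := by
    ext g
    simp [Representation.character, Representation.prod, LinearMap.trace_prodMap']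
  rw [this]
  refine (Representation.char_iso
    (Representation.Equiv.mk (Submodule.prodEquivOfIsCompl _ _ h) fun g => ?_)).symm
  ext v <;> simp [Representation.prod, Subrepresentation.toRepresentation]


/-- A function on a group is a class function if it is constant on conjugacy classes. -/
def IsClassFunction (f : G → ℂ) : Prop := ∀ s g : G, f (s * g * s⁻¹) = f g

theorem IsCharacter.isClassFunction {f : G → ℂ} (h : IsCharacter f) : IsClassFunction f :=
  fun s g => h.conj s g

open Representation in
-- Schur's lemma: the operator commutes with `G`, so it is scalar on an irreducible representation,
-- and its trace there is the given vanishing sum. Complete reducibility extends this to all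
-- representations.
theorem sum_smul_eq_zero [Fintype G] {f : G → ℂ} (hf : IsClassFunction f)
    (h : ∀ ψ : G → ℂ, IsIrreducibleCharacter ψ → ∑ g, f g * ψ g = 0)
    {V : Type} [AddCommGroup V] [Module ℂ V] [FiniteDimensional ℂ V]
    (ρ : Representation ℂ G V) : ∑ g, f g • ρ g = 0 := by
  refine representation_induction (G := G) (P := fun ρ => ∑ g, f g • ρ g = 0) ?_ ?_ ?_ ρ
  · intro V _ _ _ ρ hV
    ext v
    exact Subsingleton.elim _ _
  · intro V _ _ _ ρ hρ
    let T : IntertwiningMap ρ ρ := ⟨∑ g, f g • ρ g, fun s => by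
      rw [← Module.End.mul_eq_comp, ← Module.End.mul_eq_comp, Finset.sum_mul, Finset.mul_sum]
      refine Fintype.sum_equiv (MulAut.conj s⁻¹).toEquiv _ _ fun g => ?_
      have h1 : s * (s⁻¹ * g * s⁻¹⁻¹) = g * s := by group
      simp only [MulEquiv.toEquiv_eq_coe, EquivLike.coe_coe, MulAut.conj_apply, hf s⁻¹ g,
        smul_mul_assoc, mul_smul_comm, ← map_mul, h1]⟩
    obtain ⟨z, hz⟩ :=
      (IsIrreducible.algebraMap_intertwiningMap_bijective_of_isAlgClosed (ρ := ρ)).2 T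
    have hT : ∑ g, f g • ρ g = z • (1 : Module.End ℂ V) := by
      have := congrArg IntertwiningMap.toLinearMap hz
      exact this.symm
    have htr := congrArg (LinearMap.trace ℂ V) hT
    have h0 := h _ (isIrreducibleCharacter_character ρ hρ)
    rw [map_sum, map_smul, LinearMap.trace_one] at htr
    simp only [map_smul, smul_eq_mul] at htr
    simp only [Representation.character] at h0
    rw [h0] at htr
    have hV : Nontrivial V := by
      by_contra hs
      have := not_nontrivial_iff_subsingleton.mp hs
      exact bot_ne_top (α := Subrepresentation ρ)
        (Subrepresentation.toSubmodule_injective (Subsingleton.elim _ _))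
    have hz0 : z = 0 := by
      rcases mul_eq_zero.mp htr.symm with h | h
      · exact h
      · exact absurd (Nat.cast_eq_zero.mp h) (Module.finrank_pos (R := ℂ) (M := V)).ne'
    rw [hT, hz0, zero_smul]
  · intro V _ _ _ ρ W W' hW _ _ h1 h2
    ext v
    obtain ⟨w, hw, w', hw', rfl⟩ := Submodule.mem_sup.mp
      (hW.sup_eq_top ▸ Submodule.mem_top : v ∈ W.toSubmodule ⊔ W'.toSubmodule)
    have e1 := congrArg Subtype.val (LinearMap.congr_fun h1 ⟨w, hw⟩)
    have e2 := congrArg Subtype.val (LinearMap.congr_fun h2 ⟨w', hw'⟩)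
    simp only [LinearMap.sum_apply, LinearMap.smul_apply, LinearMap.zero_apply,
      ZeroMemClass.coe_zero, AddSubmonoidClass.coe_finsetSum, SetLike.val_smul,
      Subrepresentation.toRepresentation, MonoidHom.coe_mk, OneHom.coe_mk,
      LinearMap.coe_restrict_apply] at e1 e2
    simp only [LinearMap.sum_apply, LinearMap.smul_apply, LinearMap.zero_apply, map_add]
    rw [e1, e2, add_zero]

/-- A class function orthogonal to all irreducible characters vanishes. -/
theorem IsClassFunction.eq_zero [Fintype G] {f : G → ℂ} (hf : IsClassFunction f)
    (h : ∀ ψ : G → ℂ, IsIrreducibleCharacter ψ → ∑ g, f g * ψ g = 0) : f = 0 := by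
  classical
  let e := Fintype.equivFin G
  let ρ : Representation ℂ G (Fin (Fintype.card G) → ℂ) :=
    { toFun := fun g => LinearMap.funLeft ℂ ℂ fun i => e (g⁻¹ * e.symm i)
      map_one' := by ext; simp
      map_mul' := fun a b => by ext; simp [LinearMap.funLeft, mul_assoc] }
  -- In the regular representation the operator maps the delta function at the identity to `f`
  -- itself.
  have h0 := sum_smul_eq_zero hf h ρ
  ext a
  have h1 := congrFun (LinearMap.congr_fun h0 (Pi.single (e 1) 1)) (e a)
  simp only [LinearMap.sum_apply, LinearMap.smul_apply, Finset.sum_apply, Pi.smul_apply,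
    LinearMap.zero_apply, Pi.zero_apply, ρ, MonoidHom.coe_mk, OneHom.coe_mk,
    LinearMap.funLeft_apply, Equiv.symm_apply_apply, Pi.single_apply, e.apply_eq_iff_eq,
    inv_mul_eq_one, smul_eq_mul, mul_ite, mul_one, mul_zero, Finset.sum_ite_eq',
    Finset.mem_univ, if_true] at h1
  exact h1

open Representation in
theorem IsIrreducibleCharacter.sum_mul_inv [Fintype G] {ψ φ : G → ℂ}
    (hψ : IsIrreducibleCharacter ψ) (hφ : IsIrreducibleCharacter φ) [Decidable (ψ = φ)] :
    (Nat.card G : ℂ)⁻¹ * ∑ g, ψ g * φ g⁻¹ = if ψ = φ then 1 else 0 := by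
  obtain ⟨d, ρ, hρ, rfl⟩ := hψ
  obtain ⟨d', σ, hσ, rfl⟩ := hφ
  have : Invertible (Nat.card G : ℂ) :=
    invertibleOfNonzero (Nat.cast_ne_zero.mpr Nat.card_pos.ne')
  classical
  by_cases hne : Nonempty (σ.Equiv ρ)
  · have := char_orthonormal ρ σ
    rw [if_pos hne] at this
    rw [this, if_pos (char_iso hne.some).symm]
  · have h0 := char_orthonormal ρ σ
    have h1 := char_orthonormal σ σ
    rw [if_neg hne] at h0
    rw [if_pos ⟨Representation.Equiv.refl σ⟩] at h1
    rw [h0, if_neg]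
    -- Equal characters of inequivalent representations would have norm 0 and norm 1 at once.
    intro heq
    rw [heq, h1] at h0
    simp at h0

theorem linearIndependent_irr [Finite G] : LinearIndependent ℂ (fun ψ : Irr G => ψ.1) := by
  classical
  have := Fintype.ofFinite G
  rw [linearIndependent_iff']
  intro s a h φ hφ
  have h1 : ∑ ψ ∈ s, a ψ * ((Nat.card G : ℂ)⁻¹ * ∑ g, ψ.1 g * φ.1 g⁻¹) = 0 := by
    have h2 : ∀ g, (∑ ψ ∈ s, a ψ * ψ.1 g) * φ.1 g⁻¹ = 0 := fun g => by
      have := congrFun h g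
      simp only [Finset.sum_apply, Pi.smul_apply, smul_eq_mul, Pi.zero_apply] at this
      rw [this, zero_mul]
    have h3 := Finset.sum_congr rfl (fun g (_ : g ∈ (Finset.univ : Finset G)) => h2 g)
    simp only [Finset.sum_mul, Finset.sum_const_zero] at h3
    rw [Finset.sum_comm] at h3
    calc _ = (Nat.card G : ℂ)⁻¹ * ∑ ψ ∈ s, ∑ g, a ψ * ψ.1 g * φ.1 g⁻¹ := by
          simp only [Finset.mul_sum]
          refine Finset.sum_congr rfl fun ψ _ => Finset.sum_congr rfl fun g _ => ?_
          ring
      _ = 0 := by rw [h3, mul_zero]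
  have h4 : ∀ ψ ∈ s, a ψ * ((Nat.card G : ℂ)⁻¹ * ∑ g, ψ.1 g * φ.1 g⁻¹) =
      if ψ = φ then a ψ else 0 := fun ψ _ => by
    rw [ψ.2.sum_mul_inv φ.2]
    simp [Subtype.ext_iff]
  rw [Finset.sum_congr rfl h4, Finset.sum_ite_eq' s φ, if_pos hφ] at h1
  exact h1

instance finite_irr [Finite G] : Finite (Irr G) := linearIndependent_irr.finite

/-- The number of irreducible characters is the number of conjugacy classes. -/
theorem card_irr [Finite G] : Nat.card (Irr G) = Nat.card (ConjClasses G) := by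
  classical
  have := Fintype.ofFinite G
  have := Fintype.ofFinite (ConjClasses G)
  let v : Irr G → ConjClasses G → ℂ := fun ψ C => ψ.1 (Quotient.out C)
  have hv : ∀ ψ g, v ψ (ConjClasses.mk g) = ψ.1 g := fun ψ g => by
    have h1 : IsConj (Quotient.out (ConjClasses.mk g)) g := by
      rw [← ConjClasses.mk_eq_mk_iff_isConj]
      exact Quotient.out_eq _
    obtain ⟨s, hs⟩ := isConj_iff.mp h1
    simp only [v]
    conv_rhs => rw [← hs]
    exact (ψ.2.isCharacter.conj s _).symm
  have hli : LinearIndependent ℂ v := by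
    refine LinearIndependent.of_comp (LinearMap.funLeft ℂ ℂ (ConjClasses.mk : G → _)) ?_
    convert linearIndependent_irr (G := G) using 1
    ext ψ g
    exact hv ψ g
  have hsp : ⊤ ≤ Submodule.span ℂ (Set.range v) := by
    by_contra hcon
    obtain ⟨φ, hφ0, hφ⟩ := Submodule.exists_le_ker_of_lt_top _
      (lt_top_iff_ne_top.mpr fun h => hcon h.ge)
    let a : ConjClasses G → ℂ := fun C => φ (Pi.single C 1)
    have hφa : ∀ u, φ u = ∑ C, u C * a C := fun u => by
      conv_lhs => rw [pi_eq_sum_univ' u]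
      simp [a, Pi.single]
    let N : ConjClasses G → ℂ := fun C => (Finset.univ.filter fun g => ConjClasses.mk g = C).card
    have hN : ∀ C, N C ≠ 0 := fun C => by
      obtain ⟨g, rfl⟩ := ConjClasses.exists_rep C
      simp only [N, ne_eq, Nat.cast_eq_zero, Finset.card_eq_zero]
      exact Finset.ne_empty_of_mem (a := g) (by simp)
    -- Division by the class sizes turns the pairing `φ` on functions of classes into a sum over
    -- `G`; as `φ` kills all irreducible characters, so does pairing with `f`.
    let f : G → ℂ := fun g => a (ConjClasses.mk g) / N (ConjClasses.mk g)
    have hf : f = 0 := by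
      refine IsClassFunction.eq_zero (fun s g => ?_) fun ψ hψ => ?_
      · have : ConjClasses.mk (s * g * s⁻¹) = ConjClasses.mk g := by
          rw [ConjClasses.mk_eq_mk_iff_isConj]
          exact (isConj_iff.mpr ⟨s, rfl⟩).symm
        simp only [f, this]
      · have h0 : φ (v ⟨ψ, hψ⟩) = 0 := hφ (Submodule.subset_span ⟨_, rfl⟩)
        rw [hφa] at h0
        rw [← h0, ← Finset.sum_fiberwise Finset.univ (ConjClasses.mk : G → ConjClasses G)]
        refine Finset.sum_congr rfl fun C _ => ?_
        have : ∀ g ∈ Finset.univ.filter (fun g : G => ConjClasses.mk g = C),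
            f g * ψ g = v ⟨ψ, hψ⟩ C * a C / N C := fun g hg => by
          have hg' := (Finset.mem_filter.mp hg).2
          rw [← hg', hv]
          simp only [f]
          ring
        rw [Finset.sum_congr rfl this, Finset.sum_const, nsmul_eq_mul]
        exact mul_div_cancel₀ _ (hN C)
    apply hφ0
    ext u
    simp only [LinearMap.zero_apply, hφa, LinearMap.comp_apply]
    refine Finset.sum_eq_zero fun C _ => ?_
    obtain ⟨g, rfl⟩ := ConjClasses.exists_rep C
    have := congrFun hf g
    simp only [f, Pi.zero_apply, div_eq_zero_iff, hN, or_false] at this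
    rw [this, mul_zero]
  have := Module.finrank_eq_nat_card_basis (Module.Basis.mk hli hsp)
  rw [← this, Module.finrank_fintype_fun_eq_card, Nat.card_eq_fintype_card]

theorem IsClassFunction.eq_sum [Finite G] [Fintype (Irr G)] {f : G → ℂ} (hf : IsClassFunction f) :
    f = ∑ ψ : Irr G, scalarProduct f ψ.1 • ψ.1 := by
  classical
  have := Fintype.ofFinite G
  let d : G → ℂ := f - ∑ ψ : Irr G, scalarProduct f ψ.1 • ψ.1
  have hd : ∀ s g, d (s * g * s⁻¹) = d g := fun s g => by
    simp only [d, Pi.sub_apply, Finset.sum_apply, Pi.smul_apply, hf s g]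
    congr 1
    exact Finset.sum_congr rfl fun ψ _ => by rw [ψ.2.isCharacter.conj]
  -- The completeness statement pairs without complex conjugation, so the remainder `d` is composed
  -- with inversion.
  have h0 : (fun g => d g⁻¹) = 0 := by
    refine IsClassFunction.eq_zero (fun s g => ?_) fun ψ hψ => ?_
    · rw [← hd s g⁻¹]
      congr 1
      group
    · have h1 : ∑ g, d g⁻¹ * ψ g = ∑ g, d g * ψ g⁻¹ :=
        Fintype.sum_equiv (Equiv.inv G) _ _ fun g => by simp
      have hc : (Nat.card G : ℂ) ≠ 0 := Nat.cast_ne_zero.mpr Nat.card_pos.ne'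
      have h2 : (Nat.card G : ℂ)⁻¹ * ∑ g, d g * ψ g⁻¹ = 0 := by
        have e1 : (Nat.card G : ℂ)⁻¹ * ∑ g, f g * ψ g⁻¹ = scalarProduct f ψ := by
          rw [scalarProduct, finsum_eq_sum_of_fintype]
          simp only [hψ.isCharacter.star]
        have e2 : (Nat.card G : ℂ)⁻¹ * ∑ g, (∑ φ : Irr G, scalarProduct f φ.1 • φ.1) g * ψ g⁻¹ =
            ∑ φ : Irr G, scalarProduct f φ.1 * if φ.1 = ψ then 1 else 0 := by
          simp only [Finset.sum_apply, Pi.smul_apply, smul_eq_mul, Finset.sum_mul]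
          rw [Finset.sum_comm, Finset.mul_sum]
          refine Finset.sum_congr rfl fun φ _ => ?_
          rw [← φ.2.sum_mul_inv hψ, Finset.mul_sum, Finset.mul_sum, Finset.mul_sum]
          exact Finset.sum_congr rfl fun g _ => by ring
        have e3 : ∑ φ : Irr G, (scalarProduct f φ.1 * if φ.1 = ψ then 1 else 0) =
            scalarProduct f ψ := by
          rw [Finset.sum_eq_single ⟨ψ, hψ⟩]
          · simp
          · intro φ _ hφ
            rw [if_neg (fun h => hφ (Subtype.ext h)), mul_zero]
          · simp
        simp only [d, Pi.sub_apply, sub_mul, Finset.sum_sub_distrib, mul_sub]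
        rw [e1, e2, e3, sub_self]
      rw [h1]
      exact (mul_eq_zero.mp h2).resolve_left (inv_ne_zero hc)
  ext g
  have := congrFun h0 g⁻¹
  simp only [inv_inv, Pi.zero_apply, d, Pi.sub_apply] at this
  exact sub_eq_zero.mp this

/-- The expansion in irreducible characters has natural coefficients. This recognizes induced
functions as characters without an induced module. -/
theorem isCharacter_of_scalarProduct [Finite G] {f : G → ℂ} (hf : IsClassFunction f)
    (h : ∀ ψ : G → ℂ, IsIrreducibleCharacter ψ → ∃ m : ℕ, scalarProduct f ψ = m) :
    IsCharacter f := by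
  have := Fintype.ofFinite (Irr G)
  rw [hf.eq_sum]
  refine IsCharacter.sum _ fun ψ _ => ?_
  obtain ⟨m, hm⟩ := h ψ.1 ψ.2
  rw [hm, Nat.cast_smul_eq_nsmul]
  exact ψ.2.isCharacter.nsmul m

/-- The number is the dimension of a space of intertwining maps. -/
theorem IsCharacter.exists_scalarProduct_eq [Finite G] {f f' : G → ℂ} (h : IsCharacter f)
    (h' : IsCharacter f') : ∃ m : ℕ, scalarProduct f f' = m := by
  have := Fintype.ofFinite G
  have : Invertible (Nat.card G : ℂ) :=
    invertibleOfNonzero (Nat.cast_ne_zero.mpr Nat.card_pos.ne')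
  rw [scalarProduct, finsum_eq_sum_of_fintype]
  simp only [h'.star]
  obtain ⟨d, ρ, rfl⟩ := h
  obtain ⟨d', ρ', rfl⟩ := h'
  exact ⟨_, Representation.card_inv_mul_sum_char_mul_char_eq_finrank ρ' ρ⟩

theorem sum_extendByZero_mul [Fintype G] (H : Subgroup G) [Fintype H] (f : H → ℂ) (k : G → ℂ) :
    ∑ g, extendByZero H f g * k g = ∑ h : H, f h * k h := by
  refine (Fintype.sum_of_injective (Subtype.val : H → G) Subtype.val_injective _ _
    (fun g hg => ?_) fun h => ?_).symm
  · have : g ∉ H := fun h => hg ⟨⟨g, h⟩, rfl⟩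
    simp [extendByZero, this]
  · simp [extendByZero]

/-- Frobenius reciprocity: conjugation by `s` can be shifted to `ψ`, which ignores it, so all the
summands over `s ∈ G` agree. -/
theorem scalarProduct_induced [Finite G] (H : Subgroup G) (f : H → ℂ) {ψ : G → ℂ}
    (hψ : IsClassFunction ψ) :
    scalarProduct (induced H f) ψ = scalarProduct f (fun h => ψ h) := by
  classical
  have := Fintype.ofFinite G
  have := Fintype.ofFinite H
  have hc : (Nat.card G : ℂ) ≠ 0 := Nat.cast_ne_zero.mpr Nat.card_pos.ne'
  simp only [scalarProduct, induced, finsum_eq_sum_of_fintype]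
  have h1 : ∀ s : G, ∑ g, extendByZero H f (s * g * s⁻¹) * starRingEnd ℂ (ψ g) =
      ∑ h : H, f h * starRingEnd ℂ (ψ h) := fun s => by
    have h2 : ∑ g, extendByZero H f (s * g * s⁻¹) * starRingEnd ℂ (ψ g) =
        ∑ g, extendByZero H f g * starRingEnd ℂ (ψ g) :=
      Fintype.sum_equiv (MulAut.conj s).toEquiv _ _ fun g => by
        simp [MulAut.conj_apply, hψ s g]
    rw [h2]
    exact sum_extendByZero_mul H f _
  calc _ = (Nat.card G : ℂ)⁻¹ * ((Nat.card H : ℂ)⁻¹ * ∑ s : G,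
        ∑ g, extendByZero H f (s * g * s⁻¹) * starRingEnd ℂ (ψ g)) := by
        rw [Finset.sum_comm]
        simp only [Finset.mul_sum, Finset.sum_mul]
        exact Finset.sum_congr rfl fun g _ => Finset.sum_congr rfl fun s _ => by ring
    _ = _ := by
        simp only [h1, Finset.sum_const, Finset.card_univ, nsmul_eq_mul,
          ← Nat.card_eq_fintype_card (α := G)]
        field_simp

/-- Induced characters are characters, by Frobenius reciprocity. -/
theorem IsCharacter.induced [Finite G] (H : Subgroup G) {f : H → ℂ} (hf : IsCharacter f) :
    IsCharacter (induced H f) := by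
  refine isCharacter_of_scalarProduct (fun t g => ?_) fun ψ hψ => ?_
  · have := Fintype.ofFinite G
    simp only [GGParabolic.induced, finsum_eq_sum_of_fintype]
    congr 1
    refine Fintype.sum_equiv (Equiv.mulRight t) _ _ fun s => ?_
    simp [mul_assoc]
  · rw [scalarProduct_induced H f hψ.isCharacter.isClassFunction]
    exact hf.exists_scalarProduct_eq (hψ.isCharacter.comp H.subtype)

theorem IsIrreducibleCharacter.scalarProduct_eq_zero [Finite G] {ψ φ : G → ℂ}
    (hψ : IsIrreducibleCharacter ψ) (hφ : IsIrreducibleCharacter φ) (h : ψ ≠ φ) :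
    scalarProduct ψ φ = 0 := by
  classical
  have := Fintype.ofFinite G
  rw [scalarProduct, finsum_eq_sum_of_fintype]
  simp only [hφ.isCharacter.star]
  rw [hψ.sum_mul_inv hφ, if_neg h]

theorem IsIrreducibleCharacter.scalarProduct_self [Finite G] {ψ : G → ℂ}
    (hψ : IsIrreducibleCharacter ψ) : scalarProduct ψ ψ = 1 := by
  classical
  have := Fintype.ofFinite G
  rw [scalarProduct, finsum_eq_sum_of_fintype]
  simp only [hψ.isCharacter.star]
  rw [hψ.sum_mul_inv hψ, if_pos rfl]

theorem scalarProduct_self_ne_zero [Finite G] {f : G → ℂ} (h : f ≠ 0) :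
    scalarProduct f f ≠ 0 := by
  have := Fintype.ofFinite G
  intro h0
  apply h
  rw [scalarProduct, finsum_eq_sum_of_fintype] at h0
  have h1 := (mul_eq_zero.mp h0).resolve_left
    (inv_ne_zero (Nat.cast_ne_zero.mpr Nat.card_pos.ne'))
  simp only [Complex.mul_conj] at h1
  have h2 : ∑ g, Complex.normSq (f g) = 0 := by exact_mod_cast h1
  ext g
  have h3 := (Finset.sum_eq_zero_iff_of_nonneg fun g _ => Complex.normSq_nonneg (f g)).mp h2 g
    (Finset.mem_univ g)
  exact Complex.normSq_eq_zero.mp h3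

theorem IsIrreducibleCharacter.ne_zero [Finite G] {ψ : G → ℂ} (h : IsIrreducibleCharacter ψ) :
    ψ ≠ 0 := by
  rintro rfl
  have := h.scalarProduct_self
  simp [scalarProduct] at this

/-- The norm 1 would be a sum of four natural numbers, two of which, the norms of the summands, are
positive. -/
theorem IsIrreducibleCharacter.eq_zero_or_eq_zero [Finite G] {ψ f f' : G → ℂ}
    (h : IsIrreducibleCharacter ψ) (hf : IsCharacter f) (hf' : IsCharacter f')
    (hψ : ψ = f + f') : f = 0 ∨ f' = 0 := by
  have := Fintype.ofFinite G
  by_contra! hcon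
  obtain ⟨a, ha⟩ := hf.exists_scalarProduct_eq hf
  obtain ⟨b, hb⟩ := hf.exists_scalarProduct_eq hf'
  obtain ⟨c, hc⟩ := hf'.exists_scalarProduct_eq hf
  obtain ⟨d, hd⟩ := hf'.exists_scalarProduct_eq hf'
  have ha0 : a ≠ 0 := fun h0 => scalarProduct_self_ne_zero hcon.1 (by rw [ha, h0, Nat.cast_zero])
  have hd0 : d ≠ 0 := fun h0 => scalarProduct_self_ne_zero hcon.2 (by rw [hd, h0, Nat.cast_zero])
  have h1 := h.scalarProduct_self
  have h2 : scalarProduct ψ ψ = scalarProduct f f + scalarProduct f f' + scalarProduct f' f +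
      scalarProduct f' f' := by
    simp only [scalarProduct, finsum_eq_sum_of_fintype, hψ, Pi.add_apply, map_add, mul_add,
      add_mul, Finset.sum_add_distrib]
    ring
  rw [h2, ha, hb, hc, hd] at h1
  have h3 : a + b + c + d = 1 := by exact_mod_cast h1
  omega

/-- Complete reducibility phrased with characters alone, to match the definition of
`IsRelIrreducible`. -/
theorem IsCharacter.trichotomy [Finite G] {f : G → ℂ} (h : IsCharacter f) :
    f = 0 ∨ IsIrreducibleCharacter f ∨
      ∃ f₁ f₂, IsCharacter f₁ ∧ IsCharacter f₂ ∧ f₁ ≠ 0 ∧ f₂ ≠ 0 ∧ f = f₁ + f₂ := by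
  obtain ⟨d, ρ, rfl⟩ := h
  refine representation_induction (G := G) (P := fun ρ => ρ.character = 0 ∨
    IsIrreducibleCharacter ρ.character ∨ ∃ f₁ f₂, IsCharacter f₁ ∧ IsCharacter f₂ ∧ f₁ ≠ 0 ∧
    f₂ ≠ 0 ∧ ρ.character = f₁ + f₂) ?_ ?_ ?_ ρ
  · intro V _ _ _ ρ hV
    left
    ext g
    rw [Representation.character, Subsingleton.elim (ρ g) 0, map_zero, Pi.zero_apply]
  · intro V _ _ _ ρ hρ
    exact Or.inr (Or.inl (isIrreducibleCharacter_character ρ hρ))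
  · intro V _ _ _ ρ W W' hW h1 h2 _ _
    have key : ∀ X : Subrepresentation ρ, X.toSubmodule ≠ ⊥ →
        X.toRepresentation.character ≠ 0 := fun X hX h0 => by
      have := congrFun h0 1
      rw [Representation.char_one, Pi.zero_apply, Nat.cast_eq_zero,
        Submodule.finrank_eq_zero] at this
      exact hX this
    exact Or.inr (Or.inr ⟨_, _, isCharacter_character _, isCharacter_character _, key W h1,
      key W' h2, character_eq_add_of_isCompl ρ W W' hW⟩)

end Characters

/-! ### Two-sided Gaussian elimination and rook matrices. -/

section Orbits

variable {n : ℕ} {c : Composition n} {F : Type*} [Field F]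

theorem index_mono : Monotone c.index := by
  intro i j hij
  by_contra! h
  have h1 := c.lt_sizeUpTo_index_succ j
  have h2 := c.sizeUpTo_index_le i
  have h3 : c.sizeUpTo (c.index j).succ ≤ c.sizeUpTo (c.index i) :=
    c.monotone_sizeUpTo (by simpa using h)
  have : (i : ℕ) ≤ j := hij
  omega

theorem index_surjective : Function.Surjective c.index := fun k =>
  ⟨c.embedding k ⟨0, c.blocks_pos' _ k.2⟩, c.index_embedding _ _⟩

theorem exists_mat_eq_of_upper (A : Matrix (Fin n) (Fin n) F) (h : ∀ i j, j < i → A i j = 0)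
    (hd : ∀ i, A i i ≠ 0) : ∃ g : Par c F, mat g = A := by
  have hdet : A.det ≠ 0 := by
    rw [Matrix.det_of_isUpperTriangular (fun i j hij => h i j hij)]
    exact Finset.prod_ne_zero_iff.mpr fun i _ => hd i
  refine ⟨⟨Matrix.GeneralLinearGroup.mkOfDetNeZero A hdet, fun i j hij => ?_⟩, rfl⟩
  exact h i j (lt_of_not_ge fun hle => absurd (index_mono hle) (not_le.mpr hij))

variable (F) in
/-- The partial permutation matrix of a rook placement. -/
def rookMatrix (D : Finset (Fin n × Fin n)) : Matrix (Fin n) (Fin n) F :=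
  Matrix.of fun i j => if (i, j) ∈ D then 1 else 0

/-- The rows of `M` with numbers at least `k` are those of a partial permutation matrix, whose
nonzero columns are cleared in all of `M`. -/
def IsReduced (k : ℕ) (M : Matrix (Fin n) (Fin n) F) : Prop :=
  ∀ s t, k ≤ s.val → M s t ≠ 0 →
    M s t = 1 ∧ (∀ t', t' ≠ t → M s t' = 0) ∧ ∀ s', s' ≠ s → M s' t = 0

/-- Upper triangular factors can add rows only to higher rows and columns only to columns further
right. So elimination runs upwards from the bottom row and takes the leftmost nonzero entry of the
current row as pivot. -/
theorem IsReduced.step {k : ℕ} (hk : k < n) {M : Matrix (Fin n) (Fin n) F}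
    (h : IsReduced (k + 1) M) : ∃ a b : Par c F, IsReduced k (mat a * M * mat b) := by
  classical
  let i : Fin n := ⟨k, hk⟩
  have hlt : ∀ s : Fin n, k ≤ s.val → s ≠ i → k + 1 ≤ s.val := fun s hs hne => by
    have : s.val ≠ k := fun h => hne (Fin.ext h)
    omega
  by_cases hrow : ∀ t, M i t = 0
  · refine ⟨1, 1, fun s t hs hst => ?_⟩
    simp only [mat_one, Matrix.one_mul, Matrix.mul_one] at hst ⊢
    have hsi : s ≠ i := by rintro rfl; exact hst (hrow t)
    exact h s t (hlt s hs hsi) hst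
  push Not at hrow
  obtain ⟨j, hj, hmin⟩ := (Finset.univ.filter fun t => M i t ≠ 0).exists_min_image id
    (hrow.imp fun t ht => by simpa using ht)
  simp only [Finset.mem_filter, Finset.mem_univ, true_and, id] at hj hmin
  have hleft : ∀ t, t < j → M i t = 0 := fun t ht => by
    by_contra h0
    exact absurd (hmin t h0) (not_le.mpr ht)
  -- The right factor, with `β` added to row `j` of the identity, clears row `i` to the right of the
  -- pivot. The left factor, with `α` added to column `i` of the identity, scales the pivot to 1 and
  -- clears the column above it.
  let β : Fin n → F := fun t => if j < t then -(M i t / M i j) else 0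
  let α : Fin n → F := fun s =>
    if s = i then (M i j)⁻¹ - 1 else if s < i then -(M s j / M i j) else 0
  obtain ⟨b, hb⟩ := exists_mat_eq_of_upper (c := c)
    (1 + Matrix.of fun u t => if u = j then β t else 0) (fun u t htu => by
      by_cases hu : u = j
      · subst hu
        simp [Matrix.one_apply_ne htu.ne', β, not_lt.mpr htu.le]
      · simp [Matrix.one_apply_ne htu.ne', hu]) (fun u => by
      by_cases hu : u = j
      · simp [hu, β]
      · simp [hu])
  obtain ⟨a, ha⟩ := exists_mat_eq_of_upper (c := c)
    (1 + Matrix.of fun s u => if u = i then α s else 0) (fun s u hus => by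
      by_cases hu : u = i
      · subst hu
        simp [Matrix.one_apply_ne hus.ne', α, hus.ne', not_lt.mpr hus.le]
      · simp [Matrix.one_apply_ne hus.ne', hu]) (fun u => by
      by_cases hu : u = i
      · simp [hu, α, hj]
      · simp [hu])
  refine ⟨a, b, ?_⟩
  have h1 : ∀ s t, (M * mat b) s t = M s t + M s j * β t := fun s t => by
    rw [hb, Matrix.mul_add, Matrix.mul_one, Matrix.add_apply]
    simp [Matrix.mul_apply]
  have h2 : ∀ s t, (mat a * M * mat b) s t = (M * mat b) s t + α s * (M * mat b) i t :=
    fun s t => by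
      rw [Matrix.mul_assoc, ha, Matrix.add_mul, Matrix.one_mul, Matrix.add_apply,
        Matrix.mul_apply (M := Matrix.of _)]
      simp
  have hi : ∀ t, (M * mat b) i t = if t = j then M i j else 0 := fun t => by
    rw [h1]
    rcases lt_trichotomy t j with ht | rfl | ht
    · simp [hleft t ht, β, ht.ne, not_lt.mpr ht.le]
    · simp [β]
    · simp only [β, if_pos ht, if_neg ht.ne']
      field_simp
      ring
  have hMi : ∀ t, (mat a * M * mat b) i t = if t = j then 1 else 0 := fun t => by
    rw [h2, hi]
    by_cases ht : t = j
    · simp [ht, α, sub_mul, hj]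
    · simp [ht]
  -- A nonzero entry below the pivot would belong to an already reduced row, whose column is cleared
  -- everywhere, in contradiction to `M i j ≠ 0`. Hence the reduced rows stay unchanged.
  have hcol : ∀ s, k + 1 ≤ s.val → M s j = 0 := fun s hs => by
    by_contra h0
    have hne : i ≠ s := fun h' => by
      have : s.val = k := by rw [← h']
      omega
    exact hj ((h s j hs h0).2.2 i hne)
  have hMgt : ∀ s t, k + 1 ≤ s.val → (mat a * M * mat b) s t = M s t := fun s t hs => by
    have hsi : s ≠ i := fun h' => by
      have : s.val = k := by rw [h']
      omega
    have hsi' : ¬ s < i := fun h' => by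
      have : s.val < k := h'
      omega
    rw [h2, h1, hcol s hs]
    simp [α, hsi, hsi']
  have hMlt : ∀ s t, s < i → (mat a * M * mat b) s t =
      M s t + M s j * β t - if t = j then M s j else 0 := fun s t hs => by
    rw [h2, h1, hi]
    by_cases ht : t = j
    · simp [α, hs.ne, hs, ht, hj]
    · simp [α, hs.ne, hs, ht]
  intro s t hs hst
  by_cases hsi : s = i
  · subst hsi
    rw [hMi] at hst
    have ht : t = j := by
      by_contra h0
      simp [h0] at hst
    subst ht
    refine ⟨by rw [hMi, if_pos rfl], fun t' ht' => by rw [hMi, if_neg ht'], fun s' hs' => ?_⟩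
    rcases lt_or_gt_of_ne hs' with h' | h'
    · rw [hMlt s' t h', if_pos rfl]
      simp [β]
    · rw [hMgt s' t h', hcol s' h']
  · have hs1 := hlt s hs hsi
    rw [hMgt s t hs1] at hst
    obtain ⟨e1, e2, e3⟩ := h s t hs1 hst
    have hit : M i t = 0 := e3 i (Ne.symm hsi)
    have htj : t ≠ j := by rintro rfl; exact hj hit
    refine ⟨by rw [hMgt s t hs1, e1], fun t' ht' => by rw [hMgt s t' hs1, e2 t' ht'],
      fun s' hs' => ?_⟩
    rcases lt_trichotomy s' i with h' | rfl | h'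
    · rw [hMlt s' t h', if_neg htj, e3 s' hs']
      simp [β, hit]
    · rw [hMi, if_neg htj]
    · rw [hMgt s' t h', e3 s' hs']

theorem exists_isReduced (M : Matrix (Fin n) (Fin n) F) (m : ℕ) (hm : m ≤ n) :
    ∃ a b : Par c F, IsReduced (n - m) (mat a * M * mat b) := by
  induction m with
  | zero =>
    refine ⟨1, 1, fun s t hs => ?_⟩
    have := s.2
    omega
  | succ m ih =>
    obtain ⟨a, b, hab⟩ := ih (by omega)
    have hk : n - m = n - (m + 1) + 1 := by omega
    rw [hk] at hab
    obtain ⟨a', b', h⟩ := hab.step (c := c) (by omega)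
    refine ⟨a' * a, b * b', ?_⟩
    simpa only [mat_mul, Matrix.mul_assoc] using h

/-- Gaussian elimination: any matrix is reduced to a partial permutation matrix by multiplication
with elements of the parabolic subgroup on both sides. -/
theorem exists_rookMatrix (c : Composition n) (M : Matrix (Fin n) (Fin n) F) :
    ∃ (a b : Par c F) (D : Finset (Fin n × Fin n)),
      IsRookPlacement Set.univ D ∧ mat a * M * mat b = rookMatrix F D := by
  classical
  obtain ⟨a, b, h⟩ := exists_isReduced (c := c) M n le_rfl
  refine ⟨a, b, Finset.univ.filter fun γ => (mat a * M * mat b) γ.1 γ.2 ≠ 0, ⟨by simp, ?_, ?_⟩, ?_⟩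
  · rintro ⟨i, j⟩ hγ ⟨i', j'⟩ hγ' (rfl : i = i')
    simp only [Finset.mem_filter, Finset.mem_univ, true_and] at hγ hγ'
    by_contra hne
    exact hγ' ((h i j (by omega) hγ).2.1 j' (fun h' => hne (by rw [h'])))
  · rintro ⟨i, j⟩ hγ ⟨i', j'⟩ hγ' (rfl : j = j')
    simp only [Finset.mem_filter, Finset.mem_univ, true_and] at hγ hγ'
    by_contra hne
    exact hγ' ((h i j (by omega) hγ).2.2 i' (fun h' => hne (by rw [h'])))
  · ext i j
    simp only [rookMatrix, Matrix.of_apply, Finset.mem_filter, Finset.mem_univ, true_and]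
    split_ifs with h0
    · exact (h i j (by omega) h0).1
    · exact not_not.mp h0

/-- Two injective families with the same images under `f` are conjugate under a permutation that
preserves `f`. -/
theorem exists_perm_of_comp_eq {α β ι : Type*} [DecidableEq α] (f : α → β) (u v : ι → α)
    (hu : Function.Injective u) (hv : Function.Injective v) (h : ∀ i, f (u i) = f (v i))
    (s : Finset ι) : ∃ σ : Equiv.Perm α, (∀ x, f (σ x) = f x) ∧ ∀ i ∈ s, σ (u i) = v i := by
  classical
  induction s using Finset.induction_on with
  | empty => exact ⟨1, by simp, by simp⟩
  | insert i s hi ih =>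
    obtain ⟨σ, h1, h2⟩ := ih
    -- The transposition joins two points with the same value of `f`, and by injectivity it avoids
    -- the images already placed.
    refine ⟨Equiv.swap (σ (u i)) (v i) * σ, fun x => ?_, fun j hj => ?_⟩
    · rw [Equiv.Perm.mul_apply, Equiv.swap_apply_def]
      split_ifs with e1 e2
      · rw [← h, ← h1 x, e1, h1]
      · rw [h1, h, ← e2, h1]
      · exact h1 x
    · rw [Equiv.Perm.mul_apply]
      rcases Finset.mem_insert.mp hj with rfl | hj'
      · simp
      · have hne : j ≠ i := by rintro rfl; exact hi hj'
        rw [Equiv.swap_apply_of_ne_of_ne, h2 j hj']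
        · exact fun h' => hne (hu (σ.injective h'))
        · rw [h2 j hj']; exact fun h' => hne (hv h')

theorem exists_mat_eq_perm (σ : Equiv.Perm (Fin n)) (hσ : ∀ i, c.index (σ i) = c.index i) :
    ∃ g : Par c F, ∀ M : Matrix (Fin n) (Fin n) F, mat g * M = M.submatrix σ id ∧
      M * mat g = M.submatrix id σ.symm := by
  let A : Matrix (Fin n) (Fin n) F := Matrix.of fun i j => if σ i = j then 1 else 0
  let B : Matrix (Fin n) (Fin n) F := Matrix.of fun i j => if i = σ j then 1 else 0
  have hA : ∀ M : Matrix (Fin n) (Fin n) F, A * M = M.submatrix σ id := fun M => by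
    ext i j
    simp [A, Matrix.mul_apply]
  have hAB : A * B = 1 := by
    rw [hA]
    ext i j
    simp [B, Matrix.one_apply]
  refine ⟨⟨⟨A, B, hAB, mul_eq_one_comm.mp hAB⟩, fun i j hij => ?_⟩, fun M => ⟨hA M, ?_⟩⟩
  · have : σ i ≠ j := by
      rintro rfl
      rw [hσ] at hij
      exact lt_irrefl _ hij
    simp [A, this]
  · ext i j
    change (M * A) i j = _
    simp [A, Matrix.mul_apply, ← Equiv.eq_symm_apply]

/-- Equal block counts give a bijection of the rooks that preserves blocks. It extends to
permutations of the rows and of the columns inside the segments, and these belong to the Levi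
subgroup. -/
theorem exists_rookMatrix_eq_mul {D D' : Finset (Fin n × Fin n)}
    (hD : IsRookPlacement Set.univ D) (hD' : IsRookPlacement Set.univ D')
    (h : ∀ k m, blockCount c D k m = blockCount c D' k m) :
    ∃ a b : Par c F, mat a * rookMatrix F D * mat b = rookMatrix F D' := by
  classical
  have hcard : ∀ p : Fin c.length × Fin c.length,
      Nonempty ({γ : D // (c.index γ.1.1, c.index γ.1.2) = p} ≃
        {γ : D' // (c.index γ.1.1, c.index γ.1.2) = p}) := fun p => by
    have key : ∀ E : Finset (Fin n × Fin n),
        Fintype.card {γ : E // (c.index γ.1.1, c.index γ.1.2) = p} = blockCount c E p.1 p.2 := by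
      intro E
      rw [Fintype.card_subtype, blockCount, ← Finset.card_map (Function.Embedding.subtype _)]
      congr 1
      ext γ
      simp [Prod.ext_iff, and_comm, and_assoc]
    exact ⟨Fintype.equivOfCardEq (by rw [key, key, h])⟩
  let e : D ≃ D' := (Equiv.sigmaFiberEquiv fun γ : D => (c.index γ.1.1, c.index γ.1.2)).symm.trans
    ((Equiv.sigmaCongrRight fun p => (hcard p).some).trans
      (Equiv.sigmaFiberEquiv fun γ : D' => (c.index γ.1.1, c.index γ.1.2)))
  have he : ∀ γ, (c.index (e γ).1.1, c.index (e γ).1.2) = (c.index γ.1.1, c.index γ.1.2) :=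
    fun γ => ((hcard (c.index γ.1.1, c.index γ.1.2)).some ⟨γ, rfl⟩).2
  obtain ⟨σ, hσ, hσ'⟩ := exists_perm_of_comp_eq c.index (fun γ : D => (e γ).1.1)
    (fun γ : D => γ.1.1)
    (fun γ γ' h => e.injective (Subtype.ext (hD'.row _ (e γ).2 _ (e γ').2 h)))
    (fun γ γ' h => Subtype.ext (hD.row _ γ.2 _ γ'.2 h))
    (fun γ => (Prod.ext_iff.mp (he γ)).1) Finset.univ
  obtain ⟨τ, hτ, hτ'⟩ := exists_perm_of_comp_eq c.index (fun γ : D => γ.1.2)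
    (fun γ : D => (e γ).1.2)
    (fun γ γ' h => Subtype.ext (hD.col _ γ.2 _ γ'.2 h))
    (fun γ γ' h => e.injective (Subtype.ext (hD'.col _ (e γ).2 _ (e γ').2 h)))
    (fun γ => (Prod.ext_iff.mp (he γ)).2.symm) Finset.univ
  obtain ⟨a, ha⟩ := exists_mat_eq_perm (F := F) σ hσ
  obtain ⟨b, hb⟩ := exists_mat_eq_perm (F := F) τ hτ
  refine ⟨a, b, ?_⟩
  rw [(ha _).1, (hb _).2]
  ext i j
  simp only [rookMatrix, Matrix.submatrix_apply, Matrix.of_apply, id]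
  congr 1
  refine propext ⟨fun hij => ?_, fun hij => ?_⟩
  · have e1 := hσ' ⟨_, hij⟩ (Finset.mem_univ _)
    have e2 := hτ' ⟨_, hij⟩ (Finset.mem_univ _)
    simp only at e1 e2
    have e3 := σ.injective e1
    rw [Equiv.apply_symm_apply] at e2
    have := (e ⟨_, hij⟩).2
    rwa [← Prod.mk.eta (p := (e ⟨_, hij⟩).1), e3, ← e2] at this
  · have e1 := hσ' (e.symm ⟨_, hij⟩) (Finset.mem_univ _)
    have e2 := hτ' (e.symm ⟨_, hij⟩) (Finset.mem_univ _)
    simp only [Equiv.apply_symm_apply] at e1 e2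
    rw [e1, ← τ.eq_symm_apply.mpr e2]
    exact (e.symm ⟨_, hij⟩).2

/-! ### Rank invariants -/

open Classical in
/-- The part of a matrix in the rows of the segments `≥ k` and the columns of the segments
`≤ m`. -/
def corner (c : Composition n) (k m : Fin c.length) (M : Matrix (Fin n) (Fin n) F) :
    Matrix (Fin n) (Fin n) F :=
  Matrix.of fun i j => if k ≤ c.index i ∧ c.index j ≤ m then M i j else 0

/-- Block-triangular factors carry nothing into a lower-left corner from outside: the corner of `a M
b` is a product with the corner of `M` as a factor. Only the corner of `N` is constrained, so that
`N` may be known merely modulo entries elsewhere. -/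
theorem rank_corner_le {k m : Fin c.length} {M N : Matrix (Fin n) (Fin n) F} (a b : Par c F)
    (h : ∀ i j, k ≤ c.index i → c.index j ≤ m → N i j = (mat a * M * mat b) i j) :
    (corner c k m N).rank ≤ (corner c k m M).rank := by
  classical
  let P : Matrix (Fin n) (Fin n) F := Matrix.diagonal fun i => if k ≤ c.index i then 1 else 0
  let Q : Matrix (Fin n) (Fin n) F := Matrix.diagonal fun i => if c.index i ≤ m then 1 else 0
  have hPQ : ∀ X : Matrix (Fin n) (Fin n) F, corner c k m X = P * X * Q := fun X => by
    ext i j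
    simp only [corner, Matrix.of_apply, P, Q, Matrix.mul_diagonal, Matrix.diagonal_mul]
    split_ifs <;> simp_all
  have hN : corner c k m N = corner c k m (mat a * M * mat b) := by
    ext i j
    simp only [corner, Matrix.of_apply]
    split_ifs with hij
    · exact h i j hij.1 hij.2
    · rfl
  have hPa : P * mat a = P * mat a * P := by
    ext i j
    simp only [P, Matrix.mul_diagonal, Matrix.diagonal_mul]
    split_ifs with h1 h2 <;> simp
    exact mat_block a i j (lt_of_lt_of_le (not_le.mp h2) h1)
  have hbQ : mat b * Q = Q * (mat b * Q) := by
    ext i j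
    simp only [Q, Matrix.mul_diagonal, Matrix.diagonal_mul]
    split_ifs with h1 h2 <;> simp
    exact mat_block b i j (lt_of_le_of_lt h1 (not_le.mp h2))
  have : corner c k m N = P * mat a * (corner c k m M) * (mat b * Q) := by
    rw [hN, hPQ, hPQ]
    calc P * (mat a * M * mat b) * Q = (P * mat a) * M * (mat b * Q) := by
          simp only [Matrix.mul_assoc]
      _ = (P * mat a * P) * M * (Q * (mat b * Q)) := by rw [← hPa, ← hbQ]
      _ = _ := by simp only [Matrix.mul_assoc]
  rw [this]
  exact (Matrix.rank_mul_le_left _ _).trans (Matrix.rank_mul_le_right _ _)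

/-- The product with the transpose is the diagonal projection to the occupied rows, and this
projection fixes the rook matrix; so both have the same rank. -/
theorem rank_rookMatrix {D : Finset (Fin n × Fin n)} (hD : IsRookPlacement Set.univ D) :
    (rookMatrix F D).rank = D.card := by
  classical
  let w : Fin n → F := fun i => if i ∈ D.image Prod.fst then 1 else 0
  have h1 : rookMatrix F D * (rookMatrix F D)ᵀ = Matrix.diagonal w := by
    ext i j
    simp only [Matrix.mul_apply, Matrix.transpose_apply, rookMatrix, Matrix.of_apply,
      Matrix.diagonal_apply]
    split_ifs with hij
    · subst hij
      simp only [w]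
      split_ifs with hi
      · obtain ⟨⟨i', t⟩, hγ, rfl⟩ := Finset.mem_image.mp hi
        rw [Finset.sum_eq_single t]
        · simp [hγ]
        · intro t' _ ht'
          rw [if_neg, zero_mul]
          intro hmem
          exact ht' (Prod.ext_iff.mp (hD.row _ hmem _ hγ rfl)).2
        · simp
      · refine Finset.sum_eq_zero fun t _ => ?_
        rw [if_neg, zero_mul]
        exact fun hmem => hi (Finset.mem_image.mpr ⟨_, hmem, rfl⟩)
    · refine Finset.sum_eq_zero fun t _ => ?_
      by_cases hit : (i, t) ∈ D
      · rw [if_neg (fun hjt => hij (Prod.ext_iff.mp (hD.col (i, t) hit (j, t) hjt rfl)).1), mul_zero]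
      · rw [if_neg hit, zero_mul]
  have h2 : rookMatrix F D = Matrix.diagonal w * rookMatrix F D := by
    ext i j
    rw [Matrix.diagonal_mul]
    simp only [rookMatrix, Matrix.of_apply, w]
    split_ifs with h h'
    · simp
    · exact absurd (Finset.mem_image.mpr ⟨_, h, rfl⟩) h'
    · simp
    · simp
  have h3 : (Matrix.diagonal w).rank = D.card := by
    rw [Matrix.rank_diagonal, Fintype.card_subtype]
    rw [← Finset.card_image_of_injOn (s := D) (f := Prod.fst)
      (fun γ hγ γ' hγ' h => hD.row γ hγ γ' hγ' h)]
    congr 1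
    ext i
    simp [w]
  apply le_antisymm
  · rw [← h3]
    conv_lhs => rw [h2]
    exact Matrix.rank_mul_le_left _ _
  · rw [← h3, ← h1]
    exact Matrix.rank_mul_le_left _ _

theorem IsRookPlacement.mono {Δ Δ' : Set (Fin n × Fin n)} {D D' : Finset (Fin n × Fin n)}
    (hD : IsRookPlacement Δ D) (h : D' ⊆ D) (h' : ∀ γ ∈ D', γ ∈ Δ') : IsRookPlacement Δ' D' :=
  ⟨h', fun γ hγ γ' hγ' => hD.row γ (h hγ) γ' (h hγ'), fun γ hγ γ' hγ' =>
    hD.col γ (h hγ) γ' (h hγ')⟩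

theorem rank_corner_rookMatrix {D : Finset (Fin n × Fin n)} (hD : IsRookPlacement Set.univ D)
    (k m : Fin c.length) : (corner c k m (rookMatrix F D)).rank =
      (D.filter fun γ => k ≤ c.index γ.1 ∧ c.index γ.2 ≤ m).card := by
  classical
  rw [← rank_rookMatrix (F := F) (hD.mono (Finset.filter_subset _ _) (by simp))]
  congr 1
  ext i j
  simp only [corner, rookMatrix, Matrix.of_apply, Finset.mem_filter]
  split_ifs <;> simp_all

/-- The numbers of elements below the points of a lower set determine the fibres over it. -/
theorem card_fiber_eq_of_card_le_eq {α P : Type*} [PartialOrder P] [Fintype P]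
    (D D' : Finset α) (φ : α → P) (S : Set P) (hS : IsLowerSet S) [DecidableEq P] [DecidableLE P]
    (h : ∀ p ∈ S, (D.filter fun x => φ x ≤ p).card = (D'.filter fun x => φ x ≤ p).card)
    (p : P) (hp : p ∈ S) :
    (D.filter fun x => φ x = p).card = (D'.filter fun x => φ x = p).card := by
  classical
  have hfin : WellFounded ((· < ·) : P → P → Prop) := Finite.wellFounded_of_trans_of_irrefl _
  induction p using hfin.induction with
  | _ p ih =>
  have key : ∀ E : Finset α, (E.filter fun x => φ x ≤ p).card =
      (E.filter fun x => φ x = p).card +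
        ∑ q ∈ Finset.univ.filter (· < p), (E.filter fun x => φ x = q).card := fun E => by
    have h1 : ∀ x ∈ E.filter fun x => φ x ≤ p, φ x ∈ insert p (Finset.univ.filter (· < p)) :=
      fun x hx => by
        have := (Finset.mem_filter.mp hx).2
        rcases this.eq_or_lt with h | h <;> simp [h]
    rw [Finset.card_eq_sum_card_fiberwise h1, Finset.sum_insert (by simp)]
    congr 1
    · congr 1
      ext x
      simp only [Finset.mem_filter]
      constructor
      · rintro ⟨⟨a, b⟩, d⟩; exact ⟨a, d⟩
      · rintro ⟨a, d⟩; exact ⟨⟨a, d.le⟩, d⟩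
    · refine Finset.sum_congr rfl fun q hq => ?_
      have hq' := (Finset.mem_filter.mp hq).2
      congr 1
      ext x
      simp only [Finset.mem_filter]
      constructor
      · rintro ⟨⟨a, b⟩, d⟩; exact ⟨a, d⟩
      · rintro ⟨a, d⟩; exact ⟨⟨a, d ▸ hq'.le⟩, d⟩
  have h2 := h p hp
  rw [key, key, Finset.sum_congr rfl fun q hq => ih q (Finset.mem_filter.mp hq).2
    (hS (Finset.mem_filter.mp hq).2.le hp)] at h2
  omega

end Orbits

/-! ### Linear forms: orbits and stabilizers. -/

section Forms

variable {n : ℕ} {c : Composition n} {F : Type*} [Field F]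

@[simp] theorem coe_lmul (g : Par c F) (x : radical c F) :
    (lmul g x : Matrix (Fin n) (Fin n) F) = mat g * x := rfl

@[simp] theorem coe_rmul (g : Par c F) (x : radical c F) :
    (rmul g x : Matrix (Fin n) (Fin n) F) = x * mat g := rfl

theorem formAct_apply (a b : Par c F) (lam : Forms c F) (x : radical c F) :
    formAct a lam b x = lam (lmul b (rmul a x)) := rfl

theorem formAct_formAct (a b a' b' : Par c F) (lam : Forms c F) :
    formAct a (formAct a' lam b') b = formAct (a * a') lam (b' * b) := by
  ext x
  simp only [formAct_apply, lmul_mul, rmul_mul, lmul_rmul]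

theorem formAct_one (lam : Forms c F) : formAct 1 lam 1 = lam := by
  ext x
  simp only [formAct_apply, lmul_one, rmul_one]

theorem formOrbit_formAct (a b : Par c F) (lam : Forms c F) :
    formOrbit (formAct a lam b) = formOrbit lam := by
  ext μ
  constructor
  · rintro ⟨a', b', rfl⟩
    exact ⟨_, _, formAct_formAct _ _ _ _ _⟩
  · rintro ⟨a', b', rfl⟩
    refine ⟨a' * a⁻¹, b⁻¹ * b', ?_⟩
    rw [formAct_formAct]
    simp

theorem orbitStabilizer_formAct (a b : Par c F) (lam : Forms c F) :
    orbitStabilizer (formAct a lam b) = orbitStabilizer lam := by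
  ext h
  change _ ∧ _ ↔ _ ∧ _
  rw [formOrbit_formAct]

/-- The linear form `x ↦ tr (M x)` on `J`. -/
def formOf (M : Matrix (Fin n) (Fin n) F) : Forms c F :=
  Matrix.traceLinearMap (Fin n) F F ∘ₗ LinearMap.mulLeft F M ∘ₗ (radical c F).subtype

theorem formOf_apply (M : Matrix (Fin n) (Fin n) F) (x : radical c F) :
    formOf M x = (M * x).trace := rfl

theorem formAct_formOf (a b : Par c F) (M : Matrix (Fin n) (Fin n) F) :
    formAct a (formOf M) b = formOf (mat a * M * mat b) := by
  ext x
  rw [formAct_apply, formOf_apply, formOf_apply, coe_lmul, coe_rmul, Matrix.mul_assoc (mat a),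
    Matrix.mul_assoc (mat a), Matrix.trace_mul_comm (mat a)]
  simp only [Matrix.mul_assoc]

theorem coe_rootUnit {γ : Fin n × Fin n} (h : γ ∈ jRoots c) :
    (rootUnit γ : radical c F) = Matrix.single γ.1 γ.2 (1 : F) := by
  rw [rootUnit, dif_pos h]

theorem formOf_rootUnit (M : Matrix (Fin n) (Fin n) F) {γ : Fin n × Fin n} (h : γ ∈ jRoots c) :
    (formOf M : Forms c F) (rootUnit γ) = M γ.2 γ.1 := by
  rw [formOf_apply, coe_rootUnit h, Matrix.trace_mul_single]
  simp

/-- The trace pairing with `J` sees only strictly block-lower entries. Together with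
`formAct_formOf` this reduces orbits of forms to elimination on matrices, with the other entries
free. -/
theorem formOf_eq_iff (M N : Matrix (Fin n) (Fin n) F) :
    (formOf M : Forms c F) = formOf N ↔ ∀ i j, c.index i < c.index j → M j i = N j i := by
  constructor
  · intro h i j hij
    have := LinearMap.congr_fun h (rootUnit (i, j))
    rwa [formOf_rootUnit _ hij, formOf_rootUnit _ hij] at this
  · intro h
    ext x
    simp only [formOf_apply, Matrix.trace, Matrix.diag_apply, Matrix.mul_apply]
    refine Finset.sum_congr rfl fun j _ => Finset.sum_congr rfl fun i _ => ?_
    rcases lt_or_ge (c.index i) (c.index j) with hij | hij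
    · rw [h i j hij]
    · rw [x.2 i j hij, mul_zero, mul_zero]

theorem eq_sum_rootUnit (x : radical c F) :
    x = ∑ i, ∑ j, (x : Matrix (Fin n) (Fin n) F) i j • (rootUnit (i, j) : radical c F) := by
  apply Subtype.ext
  simp only [AddSubmonoidClass.coe_finsetSum, SetLike.val_smul]
  conv_lhs => rw [Matrix.matrix_eq_sum_single (x : Matrix (Fin n) (Fin n) F)]
  refine Finset.sum_congr rfl fun i _ => Finset.sum_congr rfl fun j _ => ?_
  rcases lt_or_ge (c.index i) (c.index j) with hij | hij
  · rw [coe_rootUnit (γ := (i, j)) hij]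
    simp
  · rw [x.2 i j hij]
    simp

theorem exists_eq_formOf (lam : Forms c F) : ∃ M, lam = formOf M := by
  refine ⟨Matrix.of fun j i => lam (rootUnit (i, j)), ?_⟩
  ext x
  rw [eq_sum_rootUnit x]
  simp only [map_sum, map_smul]
  refine Finset.sum_congr rfl fun i _ => Finset.sum_congr rfl fun j _ => ?_
  rcases lt_or_ge (c.index i) (c.index j) with hij | hij
  · rw [formOf_rootUnit _ hij]
    simp
  · rw [x.2 i j hij, zero_smul, zero_smul]

theorem rookForm_apply (D : Finset (Fin n × Fin n)) (x : radical c F) :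
    rookForm D x = ∑ γ ∈ D, (x : Matrix (Fin n) (Fin n) F) γ.1 γ.2 := by
  simp [rookForm, rootForm]

theorem rookForm_eq_formOf (D : Finset (Fin n × Fin n)) :
    (rookForm D : Forms c F) = formOf (rookMatrix F (D.image Prod.swap)) := by
  classical
  ext x
  rw [rookForm_apply, formOf_apply]
  simp only [Matrix.trace, Matrix.diag_apply, Matrix.mul_apply, rookMatrix, Matrix.of_apply]
  rw [Finset.sum_comm, ← Finset.sum_product']
  simp only [Finset.univ_product_univ]
  rw [← Finset.sum_filter_add_sum_filter_not Finset.univ (fun γ => γ ∈ D)]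
  rw [Finset.sum_eq_zero (s := Finset.univ.filter fun γ => γ ∉ D), add_zero]
  · rw [show Finset.univ.filter (fun γ => γ ∈ D) = D by ext; simp]
    refine Finset.sum_congr rfl fun γ hγ => ?_
    have : (γ.2, γ.1) ∈ D.image Prod.swap := Finset.mem_image.mpr ⟨γ, hγ, rfl⟩
    rw [if_pos this, one_mul]
  · rintro ⟨i, j⟩ hγ
    rw [if_neg, zero_mul]
    intro hmem
    obtain ⟨γ, h1, h2⟩ := Finset.mem_image.mp hmem
    have : γ = (i, j) := by rw [← Prod.swap_swap γ, h2]; rfl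
    exact (Finset.mem_filter.mp hγ).2 (this ▸ h1)

theorem coe_rookElement {D : Finset (Fin n × Fin n)} (h : ∀ γ ∈ D, γ ∈ jRoots c) :
    (rookElement D : radical c F) = rookMatrix F D := by
  classical
  rw [rookElement, AddSubmonoidClass.coe_finsetSum, Finset.sum_congr rfl fun γ hγ =>
    coe_rootUnit (h γ hγ)]
  ext i j
  rw [Matrix.sum_apply]
  simp only [Matrix.single_apply, rookMatrix, Matrix.of_apply]
  split_ifs with hij
  · rw [Finset.sum_eq_single (i, j)]
    · simp
    · rintro ⟨s, t⟩ _ hne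
      rw [if_neg]
      rintro ⟨rfl, rfl⟩
      exact hne rfl
    · exact fun h => absurd hij h
  · refine Finset.sum_eq_zero ?_
    rintro ⟨s, t⟩ hγ
    rw [if_neg]
    rintro ⟨rfl, rfl⟩
    exact hij hγ

theorem IsRookPlacement.swap {Δ Δ' : Set (Fin n × Fin n)} {D : Finset (Fin n × Fin n)}
    (hD : IsRookPlacement Δ D) (h : ∀ γ ∈ D, γ.swap ∈ Δ') :
    IsRookPlacement Δ' (D.image Prod.swap) := by
  classical
  refine ⟨fun γ hγ => ?_, fun γ hγ γ' hγ' heq => ?_, fun γ hγ γ' hγ' heq => ?_⟩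
  · obtain ⟨δ, hδ, rfl⟩ := Finset.mem_image.mp hγ
    exact h δ hδ
  · obtain ⟨δ, hδ, rfl⟩ := Finset.mem_image.mp hγ
    obtain ⟨δ', hδ', rfl⟩ := Finset.mem_image.mp hγ'
    rw [hD.col δ hδ δ' hδ' heq]
  · obtain ⟨δ, hδ, rfl⟩ := Finset.mem_image.mp hγ
    obtain ⟨δ', hδ', rfl⟩ := Finset.mem_image.mp hγ'
    rw [hD.row δ hδ δ' hδ' heq]

theorem card_filter_image_swap (D : Finset (Fin n × Fin n)) (p : Fin n → Fin n → Prop)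
    [DecidableRel p] : ((D.image Prod.swap).filter fun γ => p γ.1 γ.2).card =
      (D.filter fun γ => p γ.2 γ.1).card := by
  classical
  rw [Finset.filter_image, Finset.card_image_of_injective _ Prod.swap_injective]
  rfl

/-- Every `G × G` orbit of linear forms contains the form of a rook placement. -/
theorem exists_formAct_eq_rookForm (lam : Forms c F) :
    ∃ D, IsRookPlacement (jRoots c) D ∧ ∃ a b : Par c F, formAct a lam b = rookForm D := by
  classical
  obtain ⟨M, rfl⟩ := exists_eq_formOf lam
  obtain ⟨a, b, E, hE, h⟩ := exists_rookMatrix c M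
  -- The rook matrix of a form is transposed, and its rooks outside the strictly block-lower part
  -- are invisible to the form.
  refine ⟨(E.image Prod.swap).filter (· ∈ jRoots c), ?_, a, b, ?_⟩
  · exact (hE.swap (Δ' := Set.univ) (by simp)).mono (Finset.filter_subset _ _)
      fun γ hγ => (Finset.mem_filter.mp hγ).2
  · rw [formAct_formOf, h, rookForm_eq_formOf, formOf_eq_iff]
    intro i j hij
    have hij' : (i, j) ∈ jRoots c := hij
    simp only [rookMatrix, Matrix.of_apply]
    congr 1
    simp only [Finset.mem_image, Finset.mem_filter, eq_iff_iff]
    constructor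
    · intro hmem
      exact ⟨(i, j), ⟨⟨_, hmem, rfl⟩, hij'⟩, rfl⟩
    · rintro ⟨_, ⟨⟨γ, hγ, rfl⟩, -⟩, h2⟩
      rw [Prod.swap_swap] at h2
      exact h2 ▸ hγ

theorem RookEquiv.blockCount_eq {D D' : Finset (Fin n × Fin n)} (h : RookEquiv c D D')
    (hD : ∀ γ ∈ D, γ ∈ jRoots c) (hD' : ∀ γ ∈ D', γ ∈ jRoots c) (k m : Fin c.length) :
    blockCount c D k m = blockCount c D' k m := by
  rcases lt_or_ge k m with hkm | hkm
  · exact h k m hkm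
  · have key : ∀ E : Finset (Fin n × Fin n), (∀ γ ∈ E, γ ∈ jRoots c) →
        blockCount c E k m = 0 := fun E hE => by
      rw [blockCount, Finset.card_eq_zero, Finset.filter_eq_empty_iff]
      rintro γ hγ ⟨rfl, rfl⟩
      exact absurd (hE γ hγ) (not_lt.mpr hkm)
    rw [key D hD, key D' hD']

theorem RookEquiv.exists_formAct {D D' : Finset (Fin n × Fin n)} (h : RookEquiv c D D')
    (hD : IsRookPlacement (jRoots c) D) (hD' : IsRookPlacement (jRoots c) D') :
    ∃ a b : Par c F, formAct a (rookForm D) b = rookForm D' := by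
  classical
  have key : ∀ k m, blockCount c (D.image Prod.swap) k m = blockCount c (D'.image Prod.swap) k m := by
    intro k m
    have := h.blockCount_eq hD.subset hD'.subset m k
    rw [blockCount, blockCount] at this
    rw [blockCount, blockCount, card_filter_image_swap D fun i j => c.index i = k ∧ c.index j = m,
      card_filter_image_swap D' fun i j => c.index i = k ∧ c.index j = m]
    simpa only [and_comm] using this
  obtain ⟨a, b, hab⟩ := exists_rookMatrix_eq_mul (F := F) (hD.swap (by simp)) (hD'.swap (by simp))
    key
  exact ⟨a, b, by rw [rookForm_eq_formOf, rookForm_eq_formOf, formAct_formOf, hab]⟩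

/-- Rook placements whose linear forms are in the same orbit are equivalent. -/
theorem rookEquiv_of_formAct {D D' : Finset (Fin n × Fin n)}
    (hD : IsRookPlacement (jRoots c) D) (hD' : IsRookPlacement (jRoots c) D') (a b : Par c F)
    (h : formAct a (rookForm D) b = rookForm D') : RookEquiv c D D' := by
  classical
  -- For `k < m` the corner with rows in segments `≥ m` and columns in segments `≤ k` is strictly
  -- block-lower, hence determined by the form.
  have hle : ∀ {D D' : Finset (Fin n × Fin n)}, IsRookPlacement (jRoots c) D →
      IsRookPlacement (jRoots c) D' → ∀ a b : Par c F, formAct a (rookForm D) b = rookForm D' →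
      ∀ k m : Fin c.length, k < m →
      (D'.filter fun γ => c.index γ.1 ≤ k ∧ m ≤ c.index γ.2).card ≤
        (D.filter fun γ => c.index γ.1 ≤ k ∧ m ≤ c.index γ.2).card := by
    intro D D' hD hD' a b h k m hkm
    rw [rookForm_eq_formOf, rookForm_eq_formOf, formAct_formOf, formOf_eq_iff] at h
    have := rank_corner_le (k := m) (m := k) (M := rookMatrix F (D.image Prod.swap))
      (N := rookMatrix F (D'.image Prod.swap)) a b
      (fun i j hi hj => (h j i (lt_of_le_of_lt hj (lt_of_lt_of_le hkm hi))).symm)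
    rw [rank_corner_rookMatrix (hD.swap (by simp)), rank_corner_rookMatrix (hD'.swap (by simp)),
      card_filter_image_swap D fun i j => m ≤ c.index i ∧ c.index j ≤ k,
      card_filter_image_swap D' fun i j => m ≤ c.index i ∧ c.index j ≤ k] at this
    simpa only [and_comm] using this
  have h' : formAct a⁻¹ (rookForm D') b⁻¹ = rookForm D := by
    rw [← h, formAct_formAct]
    simp [formAct_one]
  intro k m hkm
  -- With the second coordinate reversed, the roots below `(k, m)` are those counted by the corner,
  -- and the pairs `k < m` form a lower set.
  have := card_fiber_eq_of_card_le_eq D D'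
    (fun γ => ((c.index γ.1, OrderDual.toDual (c.index γ.2)) : Fin c.length × (Fin c.length)ᵒᵈ))
    {p | p.1 < OrderDual.ofDual p.2}
    (fun p q (hqp : q.1 ≤ p.1 ∧ q.2 ≤ p.2) hp =>
      lt_of_le_of_lt hqp.1 (lt_of_lt_of_le hp (OrderDual.ofDual_le_ofDual.mpr hqp.2)))
    (fun p hp => le_antisymm (hle hD' hD _ _ h' p.1 (OrderDual.ofDual p.2) hp)
      (hle hD hD' _ _ h p.1 (OrderDual.ofDual p.2) hp)) (k, OrderDual.toDual m) hkm
  simpa [blockCount, Prod.ext_iff] using this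

/-- Replacing `x` by `x h` turns the invariance under conjugation into the statement that `h x` and
`x h` are indistinguishable for `lam` between any two factors from `G`; in this form it is linear in
`h`. -/
theorem mem_orbitStabilizer_iff (lam : Forms c F) (h : Par c F) :
    h ∈ orbitStabilizer lam ↔ h ∈ levi c F ∧ ∀ (a b : Par c F) (x : radical c F),
      lam (lmul b (rmul a (lmul h x))) = lam (lmul b (rmul a (rmul h x))) := by
  refine and_congr_right fun _ => ⟨fun H a b x => ?_, ?_⟩
  · have := H _ ⟨a, b, rfl⟩ (rmul h x)
    rw [formAct_apply, formAct_apply, ← rmul_mul, mul_inv_cancel, rmul_one] at this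
    exact this
  · rintro H _ ⟨a, b, rfl⟩ x
    rw [formAct_apply, formAct_apply, H, ← rmul_mul h⁻¹, inv_mul_cancel, rmul_one]

/-- Block-triangularity confines the summation to segments between those of `i` and `j`. Thus a root
only tests the part of `y` in the segments that it spans. -/
theorem mul_mul_apply_congr (a b : Par c F) (y y' : radical c F) (i j : Fin n)
    (h : ∀ s t, c.index i ≤ c.index s → c.index s < c.index t → c.index t ≤ c.index j →
      (y : Matrix (Fin n) (Fin n) F) s t = (y' : Matrix (Fin n) (Fin n) F) s t) :
    (mat b * (y * mat a)) i j = (mat b * (y' * mat a)) i j := by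
  simp only [Matrix.mul_apply, Finset.mul_sum]
  refine Finset.sum_congr rfl fun s _ => Finset.sum_congr rfl fun t _ => ?_
  rcases lt_or_ge (c.index s) (c.index i) with hs | hs
  · rw [mat_block b i s hs, zero_mul, zero_mul]
  rcases lt_or_ge (c.index j) (c.index t) with ht | ht
  · rw [mat_block a t j ht, mul_zero, mul_zero, mul_zero, mul_zero]
  rcases lt_or_ge (c.index s) (c.index t) with hst | hst
  · rw [h s t hs hst ht]
  · rw [y.2 s t hst, y'.2 s t hst]

theorem exists_mat_eq_one_add_single {u v : Fin n} (huv : u ≠ v) (h : c.index u ≤ c.index v) :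
    ∃ g : Par c F, mat g = 1 + Matrix.single u v 1 := by
  have key : ∀ s t : F, s + t = 0 → (1 + Matrix.single u v s) * (1 + Matrix.single u v t) = 1 := by
    intro s t hst
    rw [mul_add, add_mul, add_mul, Matrix.single_mul_single_of_ne _ _ _ _ huv.symm]
    rw [mul_one, mul_one, one_mul, add_zero, add_assoc, ← Matrix.single_add, hst,
      Matrix.single_zero, add_zero]
  refine ⟨⟨⟨1 + Matrix.single u v 1, 1 + Matrix.single u v (-1), key _ _ (by simp),
    key _ _ (by simp)⟩, fun i j hij => ?_⟩, rfl⟩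
  have h1 : i ≠ j := by rintro rfl; exact lt_irrefl _ hij
  simp only [Matrix.add_apply, Matrix.one_apply_ne h1, zero_add, Matrix.single_apply]
  rw [if_neg]
  rintro ⟨rfl, rfl⟩
  exact absurd h (not_le.mpr hij)

theorem mul_single_one_apply (w : Matrix (Fin n) (Fin n) F) (u j s t : Fin n) :
    (w * Matrix.single u j (1 : F)) s t = if t = j then w s u else 0 := by
  by_cases h : t = j
  · rw [if_pos h, h]; simp
  · rw [if_neg h]; simp [Matrix.mul_single_apply_of_ne, h]

theorem single_one_mul_apply (w : Matrix (Fin n) (Fin n) F) (i u s t : Fin n) :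
    (Matrix.single i u (1 : F) * w) s t = if s = i then w u t else 0 := by
  by_cases h : s = i
  · rw [if_pos h, h]; simp
  · rw [if_neg h]; simp [Matrix.single_mul_apply_of_ne, h]

theorem mem_rookSubgroup {D : Finset (Fin n × Fin n)} {h : Par c F} :
    h ∈ rookSubgroup F c D ↔
      h ∈ levi c F ∧ ∀ γ ∈ D, IsScalarOn h (c.index γ.1) (c.index γ.2) := by
  rw [rookSubgroup, Subgroup.mem_inf]
  refine and_congr_right fun hh => ?_
  simp only [Subgroup.mem_iInf]
  exact forall₂_congr fun γ _ => ⟨fun h => h.2, fun h => ⟨hh, h⟩⟩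

theorem IsScalarOn.col {h : Par c F} (hh : h ∈ levi c F) {k m : Fin c.length} {a : F}
    (ha : ∀ s t : Fin n, c.index s ∈ Set.Icc k m → c.index t ∈ Set.Icc k m →
      mat h s t = if s = t then a else 0) (s t : Fin n) (ht : c.index t ∈ Set.Icc k m) :
    mat h s t = if s = t then a else 0 := by
  by_cases hst : c.index s = c.index t
  · exact ha s t (hst ▸ ht) ht
  · rw [hh s t hst, if_neg (fun h' : s = t => hst (congrArg c.index h'))]

/-- On the segments spanned by a root of `D` the element `h` is scalar, so `h x` and `x h` agree in
all entries that the root can test. -/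
theorem rookSubgroup_le_orbitStabilizer (D : Finset (Fin n × Fin n)) :
    rookSubgroup F c D ≤ orbitStabilizer (rookForm D) := by
  intro h hh
  obtain ⟨hL, hs⟩ := mem_rookSubgroup.mp hh
  refine (mem_orbitStabilizer_iff _ _).mpr ⟨hL, fun a b x => ?_⟩
  rw [rookForm_apply, rookForm_apply]
  refine Finset.sum_congr rfl fun γ hγ => mul_mul_apply_congr a b _ _ _ _ fun s t h1 h2 h3 => ?_
  obtain ⟨z, hz⟩ := hs γ hγ
  rw [coe_lmul, coe_rmul, Matrix.mul_apply, Matrix.mul_apply]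
  simp only [IsScalarOn.row hL hz s _ ⟨h1, h2.le.trans h3⟩,
    IsScalarOn.col hL hz _ t ⟨h1.trans h2.le, h3⟩]
  simp [mul_comm]

/-- Replacing a factor 1 by an elementary matrix and subtracting the identity for the factor 1
isolates the single rook `(i, j)` in its row or column, and so gives single entries of `h`. Only row
`i` and column `j` of the two outer blocks escape this; they come from the identities with trivial
factors. -/
theorem orbitStabilizer_le_rookSubgroup {D : Finset (Fin n × Fin n)}
    (hD : IsRookPlacement (jRoots c) D) :
    orbitStabilizer (rookForm D) ≤ rookSubgroup F c D := by
  classical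
  intro h hh
  obtain ⟨hL, H⟩ := (mem_orbitStabilizer_iff _ _).mp hh
  refine mem_rookSubgroup.mpr ⟨hL, ?_⟩
  rintro ⟨i, j⟩ hγ
  have hij : c.index i < c.index j := hD.subset _ hγ
  change IsScalarOn h (c.index i) (c.index j)
  simp only [rookForm_apply, coe_lmul, coe_rmul] at H
  have hcol : ∀ f : Fin n → F, (∑ γ ∈ D, if γ.2 = j then f γ.1 else 0) = f i := fun f => by
    rw [Finset.sum_eq_single (i, j) (fun γ hγ' hne => if_neg fun h' => hne
      (hD.col γ hγ' (i, j) hγ h')) (fun h' => absurd hγ h')]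
    simp
  have hrow : ∀ f : Fin n → F, (∑ γ ∈ D, if γ.1 = i then f γ.2 else 0) = f j := fun f => by
    rw [Finset.sum_eq_single (i, j) (fun γ hγ' hne => if_neg fun h' => hne
      (hD.row γ hγ' (i, j) hγ h')) (fun h' => absurd hγ h')]
    simp
  -- right multiplication with `1 + E_{uj}`, applied to `x = E_{iv}`
  have star1 : ∀ u v, u ≠ j → c.index u ≤ c.index j → c.index i < c.index v →
      mat h v u = if v = u then mat h i i else 0 := by
    intro u v huj hu hv
    obtain ⟨a, ha⟩ := exists_mat_eq_one_add_single (F := F) (c := c) huj hu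
    have e1 := H a 1 (rootUnit (i, v))
    have e0 := H 1 1 (rootUnit (i, v))
    rw [coe_rootUnit (γ := (i, v)) hv] at e0 e1
    simp only [mat_one, Matrix.one_mul, Matrix.mul_one] at e0 e1
    simp only [ha, Matrix.mul_add, Matrix.mul_one, Matrix.add_apply, Finset.sum_add_distrib, e0,
      add_right_inj] at e1
    simp only [mul_single_one_apply _ u j] at e1
    rw [hcol fun s => (mat h * Matrix.single i v (1 : F)) s u,
      hcol fun s => (Matrix.single i v (1 : F) * mat h) s u] at e1
    rw [Matrix.single_mul_apply_same, one_mul] at e1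
    rw [← e1, mul_single_one_apply]
    congr 1
    exact propext eq_comm
  -- The mirror image: left multiplication with `1 + E_{iu}`, applied to `x = E_{vj}`.
  have star2 : ∀ u v, u ≠ i → c.index i ≤ c.index u → c.index v < c.index j →
      mat h u v = if u = v then mat h j j else 0 := by
    intro u v hui hu hv
    obtain ⟨b, hb⟩ := exists_mat_eq_one_add_single (F := F) (c := c) hui.symm hu
    have e1 := H 1 b (rootUnit (v, j))
    have e0 := H 1 1 (rootUnit (v, j))
    rw [coe_rootUnit (γ := (v, j)) hv] at e0 e1
    simp only [mat_one, Matrix.one_mul, Matrix.mul_one] at e0 e1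
    simp only [hb, Matrix.add_mul, Matrix.one_mul, Matrix.add_apply, Finset.sum_add_distrib, e0,
      add_right_inj] at e1
    simp only [single_one_mul_apply _ i u] at e1
    rw [hrow fun s => (mat h * Matrix.single v j (1 : F)) u s,
      hrow fun s => (Matrix.single v j (1 : F) * mat h) u s] at e1
    rw [Matrix.mul_single_apply_same, mul_one] at e1
    rw [e1, single_one_mul_apply]
  -- The identity with trivial factors, evaluated at the matrix unit `E_{pq}`.
  have hbase : ∀ p q, c.index p < c.index q →
      ∑ γ ∈ D, (if γ.2 = q then mat h γ.1 p else 0) =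
        ∑ γ ∈ D, if γ.1 = p then mat h q γ.2 else 0 := by
    intro p q hpq
    have e0 := H 1 1 (rootUnit (p, q))
    rw [coe_rootUnit (γ := (p, q)) hpq] at e0
    simp only [mat_one, Matrix.one_mul, Matrix.mul_one] at e0
    simpa only [mul_single_one_apply, single_one_mul_apply] using e0
  have hdiag : mat h i i = mat h j j := by
    have := hbase i j hij
    rwa [hcol fun s => mat h s i, hrow fun s => mat h j s] at this
  -- The sum over the rooks in column `v` consists of entries of `h` in column `i`. As `v ≠ j`, none
  -- of these rooks lies in row `i`, so these entries are off-diagonal and vanish by `star2` or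
  -- because `h ∈ L`.
  have hcolj : ∀ v, v ≠ j → c.index v = c.index j → mat h v j = 0 := by
    intro v hv hvj
    have := hbase i v (hvj ▸ hij)
    rw [hrow fun s => mat h v s] at this
    rw [← this]
    refine Finset.sum_eq_zero fun γ hγ' => ?_
    split_ifs with hg
    · have hne : γ.1 ≠ i := fun h' => hv (by rw [← hg, hD.row γ hγ' (i, j) hγ h'])
      by_cases hidx : c.index γ.1 = c.index i
      · rw [star2 γ.1 i hne hidx.ge hij, if_neg hne]
      · exact hL _ _ hidx
    · rfl
  have hrowi : ∀ v, v ≠ i → c.index v = c.index i → mat h i v = 0 := by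
    intro v hv hvi
    have := hbase v j (hvi ▸ hij)
    rw [hcol fun s => mat h s v] at this
    rw [this]
    refine Finset.sum_eq_zero fun γ hγ' => ?_
    split_ifs with hg
    · have hne : γ.2 ≠ j := fun h' => hv (by rw [← hg, hD.col γ hγ' (i, j) hγ h'])
      by_cases hidx : c.index γ.2 = c.index j
      · rw [star1 γ.2 j hne hidx.le hij, if_neg hne.symm]
      · exact hL _ _ (Ne.symm hidx)
    · rfl
  refine ⟨mat h i i, fun s t hs ht => ?_⟩
  by_cases hst : c.index s = c.index t
  swap
  · rw [hL s t hst, if_neg (fun h' => hst (congrArg c.index h'))]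
  rcases hs.1.lt_or_eq with hsi | hsi
  · by_cases htj : t = j
    · subst htj
      by_cases hsj : s = t
      · rw [if_pos hsj, hsj, hdiag]
      · rw [if_neg hsj, hcolj s hsj hst]
    · exact star1 t s htj ht.2 hsi
  · by_cases hs' : s = i
    · subst hs'
      by_cases hti : t = s
      · rw [if_pos hti.symm, hti]
      · rw [if_neg (Ne.symm hti), hrowi t hti hst.symm]
    · rw [hdiag]
      exact star2 s t hs' hs.1 (hst ▸ hsi ▸ hij)

/-- `H(D) = H_{G lam_D G}`. -/
theorem rookSubgroup_eq_orbitStabilizer {D : Finset (Fin n × Fin n)}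
    (hD : IsRookPlacement (jRoots c) D) : rookSubgroup F c D = orbitStabilizer (rookForm D) :=
  le_antisymm (rookSubgroup_le_orbitStabilizer D) (orbitStabilizer_le_rookSubgroup hD)

end Forms

/-! ### The ideals `J_h` and the classification of superclasses. -/

section Superclasses

variable {n : ℕ} {c : Composition n} {F : Type*} [Field F]

/-- The conjugating factors are absorbed into the arbitrary factors `a`, `b` of the orbit. -/
theorem conj_mem_orbitStabilizer {lam : Forms c F} {p h : Par c F} (hp : p ∈ levi c F)
    (hh : h ∈ orbitStabilizer lam) : p * h * p⁻¹ ∈ orbitStabilizer lam := by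
  obtain ⟨hL, H⟩ := (mem_orbitStabilizer_iff _ _).mp hh
  refine (mem_orbitStabilizer_iff _ _).mpr ⟨mul_mem (mul_mem hp hL) (inv_mem hp), fun a b x => ?_⟩
  have := H (p⁻¹ * a) (b * p) (lmul p⁻¹ (rmul p x))
  simp only [← lmul_rmul, ← lmul_mul, ← rmul_mul] at this ⊢
  convert this using 4 <;> group

theorem mem_idealOf {h : levi c F} {x : radical c F} :
    x ∈ idealOf h ↔ ∀ lam : Forms c F, (h : Par c F) ∈ orbitStabilizer lam →
      ∀ a b : Par c F, lam (lmul a (rmul b x)) = 0 := by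
  rw [idealOf, Submodule.mem_dualCoannihilator]
  constructor
  · intro H lam hlam a b
    refine H (formAct b lam a) ?_
    exact Submodule.mem_iSup_of_mem lam (Submodule.mem_iSup_of_mem hlam
      (Submodule.subset_span ⟨b, a, rfl⟩))
  · intro H φ hφ
    have hle : fixedForms h ≤ LinearMap.ker (Module.Dual.eval F (radical c F) x) := by
      refine iSup₂_le fun lam hlam => Submodule.span_le.mpr ?_
      rintro _ ⟨a, b, rfl⟩
      exact H lam hlam b a
    exact hle hφ

theorem lmul_rmul_mem_idealOf {h : levi c F} {x : radical c F} (hx : x ∈ idealOf h)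
    (a b : Par c F) : lmul a (rmul b x) ∈ idealOf h := by
  rw [mem_idealOf] at hx ⊢
  intro lam hlam a' b'
  have := hx lam hlam (a' * a) (b * b')
  rwa [lmul_mul, rmul_mul, lmul_rmul a b'] at this

theorem idealOf_le_of_isConj {h h' : levi c F} (hc : IsConj h h') :
    idealOf h ≤ idealOf h' := by
  obtain ⟨p, hp⟩ := isConj_iff.mp hc.symm
  intro x hx
  rw [mem_idealOf] at hx ⊢
  intro lam hlam
  refine hx lam ?_
  have := conj_mem_orbitStabilizer p.2 hlam
  rwa [← Subgroup.coe_inv, ← Subgroup.coe_mul, ← Subgroup.coe_mul, hp] at this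

theorem idealOf_eq_of_isConj {h h' : levi c F} (hc : IsConj h h') : idealOf h = idealOf h' :=
  le_antisymm (idealOf_le_of_isConj hc) (idealOf_le_of_isConj hc.symm)

/-! ### The decomposition into scalar segments -/

theorem IsScalarOn.mono {h : Par c F} {k m k' m' : Fin c.length} (H : IsScalarOn h k m)
    (hk : k ≤ k') (hm : m' ≤ m) : IsScalarOn h k' m' := by
  obtain ⟨a, ha⟩ := H
  exact ⟨a, fun s t hs ht => ha s t ⟨hk.trans hs.1, hs.2.trans hm⟩ ⟨hk.trans ht.1, ht.2.trans hm⟩⟩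

theorem IsScalarOn.union {h : Par c F} (hL : h ∈ levi c F) {k m k' m' t : Fin c.length}
    (H : IsScalarOn h k m) (H' : IsScalarOn h k' m') (ht : t ∈ Set.Icc k m)
    (ht' : t ∈ Set.Icc k' m') : IsScalarOn h (min k k') (max m m') := by
  obtain ⟨a, ha⟩ := H
  obtain ⟨a', ha'⟩ := H'
  -- Segments of `c` are nonempty, so the two scalars are compared at a diagonal entry in a common
  -- segment.
  obtain ⟨s, rfl⟩ := index_surjective t
  have haa : a = a' := by
    have h1 := ha s s ht ht
    have h2 := ha' s s ht' ht'
    rw [if_pos rfl] at h1 h2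
    rw [← h1, ← h2]
  subst haa
  refine ⟨a, fun u v hu _ => ?_⟩
  have : c.index u ∈ Set.Icc k m ∨ c.index u ∈ Set.Icc k' m' := by
    simp only [Set.mem_Icc] at *
    rcases le_total (c.index u) (c.index s) with h1 | h1
    · rcases min_le_iff.mp hu.1 with h2 | h2
      · exact Or.inl ⟨h2, h1.trans ht.2⟩
      · exact Or.inr ⟨h2, h1.trans ht'.2⟩
    · rcases le_max_iff.mp hu.2 with h2 | h2
      · exact Or.inl ⟨ht.1.trans h1, h2⟩
      · exact Or.inr ⟨ht'.1.trans h1, h2⟩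
  rcases this with h1 | h1
  · exact IsScalarOn.row hL ha u v h1
  · exact IsScalarOn.row hL ha' u v h1

/-- The coarsest decomposition of the set of segments such that `h` is scalar on the unions of
more than one segment. -/
def scalarSetoid (h : levi c F) : Setoid (Fin c.length) where
  r k m := k = m ∨ IsScalarOn (h : Par c F) (min k m) (max k m)
  iseqv :=
    { refl := fun _ => Or.inl rfl
      symm := fun {k m} H => by
        rcases H with rfl | H
        · exact Or.inl rfl
        · exact Or.inr (by rwa [min_comm, max_comm])
      trans := fun {k m l} H H' => by
        rcases H with rfl | H
        · exact H'
        rcases H' with rfl | H'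
        · exact Or.inr H
        · refine Or.inr ((H.union h.2 H' (t := m) ⟨min_le_right _ _, le_max_right _ _⟩
            ⟨min_le_left _ _, le_max_left _ _⟩).mono ?_ ?_)
          · exact le_min (inf_le_left.trans inf_le_left) (inf_le_right.trans inf_le_right)
          · exact max_le (le_sup_left.trans le_sup_left) (le_sup_right.trans le_sup_right) }

theorem scalarSetoid_iff {h : levi c F} {k m : Fin c.length} (hkm : k < m) :
    scalarSetoid h k m ↔ IsScalarOn (h : Par c F) k m := by
  change k = m ∨ IsScalarOn (h : Par c F) (min k m) (max k m) ↔ _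
  rw [min_eq_left hkm.le, max_eq_right hkm.le]
  exact or_iff_right hkm.ne

theorem scalarSetoid_of_mem_Icc {h : levi c F} {k m s t : Fin c.length} (hkm : scalarSetoid h k m)
    (hs : s ∈ Set.Icc k m) (ht : t ∈ Set.Icc k m) : scalarSetoid h s t := by
  rcases hkm with rfl | H
  · obtain rfl : s = k := le_antisymm hs.2 hs.1
    obtain rfl : t = s := le_antisymm ht.2 ht.1
    exact Or.inl rfl
  · have hkm := hs.1.trans hs.2
    rw [min_eq_left hkm, max_eq_right hkm] at H
    exact Or.inr (H.mono (le_min hs.1 ht.1) (max_le hs.2 ht.2))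

theorem isGreatest_scalarSetoid (h : levi c F) :
    IsGreatest {r | IsScalarDecomposition h r} (scalarSetoid h) := by
  constructor
  · intro k m hkm H
    refine ⟨fun t ht => scalarSetoid_of_mem_Icc H (Set.left_mem_Icc.mpr hkm) ht, ?_⟩
    rcases hkm.eq_or_lt with h' | h'
    · exact Or.inl h'
    · exact Or.inr ((scalarSetoid_iff h').mp H)
  · intro r hr
    have key : ∀ {k m : Fin c.length}, k ≤ m → r k m → scalarSetoid h k m := fun {k m} hkm H => by
      rcases (hr k m hkm H).2 with h' | h'
      · exact Or.inl h'
      · rcases hkm.eq_or_lt with h'' | h''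
        · exact Or.inl h''
        · exact (scalarSetoid_iff h'').mpr h'
    intro k m H
    rcases le_total k m with hkm | hkm
    · exact key hkm H
    · exact (scalarSetoid h).symm (key hkm (r.symm H))

theorem rookSubgroup_singleton_iff {h : levi c F} {i j : Fin n} :
    (h : Par c F) ∈ rookSubgroup F c {(i, j)} ↔ IsScalarOn (h : Par c F) (c.index i) (c.index j) := by
  simp [mem_rookSubgroup]

/-- If `h` is scalar from the segment of `i` to that of `j`, the form `E_{ij}*` is admissible and
forces the entry to vanish. Conversely, an admissible orbit contains some `lam_D` with `h ∈ H(D)`;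
each root of `D` then spans segments in one class, and tests only entries there. -/
theorem coe_idealOf (h : levi c F) :
    (idealOf h : Set (radical c F)) = coarseRadical (scalarSetoid h) := by
  ext x
  rw [SetLike.mem_coe]
  constructor
  · intro hx i j hr
    rcases lt_or_ge (c.index i) (c.index j) with hij | hij
    · have h1 := rookSubgroup_singleton_iff.mpr ((scalarSetoid_iff hij).mp hr)
      have h2 := mem_idealOf.mp hx _ (rookSubgroup_le_orbitStabilizer _ h1) 1 1
      rw [lmul_one, rmul_one, rookForm_apply, Finset.sum_singleton] at h2
      exact h2
    · exact x.2 i j hij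
  · intro hx
    rw [mem_idealOf]
    intro lam hlam a b
    obtain ⟨D, hD, a', b', hab⟩ := exists_formAct_eq_rookForm lam
    have hh : (h : Par c F) ∈ rookSubgroup F c D := by
      rw [rookSubgroup_eq_orbitStabilizer hD, ← hab, orbitStabilizer_formAct]
      exact hlam
    have hlam' : lam = formAct a'⁻¹ (rookForm D) b'⁻¹ := by
      rw [← hab, formAct_formAct]
      simp [formAct_one]
    rw [hlam', formAct_apply, lmul_rmul a, ← rmul_mul, ← lmul_rmul, ← lmul_mul, rookForm_apply]
    refine Finset.sum_eq_zero fun γ hγ => ?_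
    rw [coe_lmul, coe_rmul, mul_mul_apply_congr _ _ x 0]
    · simp
    · intro s t h1 h2 h3
      refine hx s t ?_
      have hlt : c.index γ.1 < c.index γ.2 := hD.subset γ hγ
      exact scalarSetoid_of_mem_Icc
        ((scalarSetoid_iff hlt).mpr ((mem_rookSubgroup.mp hh).2 γ hγ))
        ⟨h1, h2.le.trans h3⟩ ⟨h1.trans h2.le, h3⟩

theorem mem_idealOf_iff {h : levi c F} {x : radical c F} :
    x ∈ idealOf h ↔ ∀ i j, scalarSetoid h (c.index i) (c.index j) →
      (x : Matrix (Fin n) (Fin n) F) i j = 0 := by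
  rw [← SetLike.mem_coe, coe_idealOf]
  rfl

theorem mem_rootsOf_iff {h : levi c F} {γ : Fin n × Fin n} :
    γ ∈ rootsOf h ↔ γ ∈ jRoots c ∧ IsScalarOn (h : Par c F) (c.index γ.1) (c.index γ.2) := by
  refine and_congr_right fun hγ => ?_
  rw [mem_idealOf_iff, coe_rootUnit hγ, ← scalarSetoid_iff hγ]
  constructor
  · intro H
    by_contra hcon
    refine H fun i j hij => ?_
    rw [Matrix.single_apply, if_neg]
    rintro ⟨rfl, rfl⟩
    exact hcon hij
  · intro H H'
    simpa using H' _ _ H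

/-- The duality between characters and classes: the same pairs `(h, D)` are admissible from both
sides, which drives the counting. -/
theorem mem_rookSubgroup_iff_subset {h : levi c F} {D : Finset (Fin n × Fin n)}
    (hD : ∀ γ ∈ D, γ ∈ jRoots c) :
    (h : Par c F) ∈ rookSubgroup F c D ↔ ∀ γ ∈ D, γ ∈ rootsOf h := by
  rw [mem_rookSubgroup]
  constructor
  · exact fun H γ hγ => mem_rootsOf_iff.mpr ⟨hD γ hγ, H.2 γ hγ⟩
  · exact fun H => ⟨h.2, fun γ hγ => (mem_rootsOf_iff.mp (H γ hγ)).2⟩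

theorem idealOf_one : idealOf (1 : levi c F) = ⊥ := by
  rw [eq_bot_iff]
  intro x hx
  rw [Submodule.mem_bot]
  apply Subtype.ext
  ext i j
  refine mem_idealOf_iff.mp hx i j (Or.inr ⟨1, fun s t _ _ => ?_⟩)
  rw [Subgroup.coe_one, mat_one, Matrix.one_apply]

/-! ### The decomposition `g = h (1 + x)` -/

theorem leviPart_mem (g : Par c F) : leviPart g ∈ levi c F := fun i j hij => by
  simp [mat_leviPart, diagPart, hij]

/-- The Levi component as an element of the Levi subgroup. -/
def leviL (g : Par c F) : levi c F := ⟨leviPart g, leviPart_mem g⟩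

theorem coe_radPart (g : Par c F) :
    (radPart g : Matrix (Fin n) (Fin n) F) = mat (leviPart g)⁻¹ * mat g - 1 := rfl

theorem mat_eq (g : Par c F) :
    mat g = mat (leviPart g) * (1 + (radPart g : Matrix (Fin n) (Fin n) F)) := by
  rw [coe_radPart, add_sub_cancel, ← Matrix.mul_assoc, mat_mul_inv, Matrix.one_mul]

theorem leviPart_eq_of_mat_sub {g p : Par c F} (hp : p ∈ levi c F)
    (h : mat g - mat p ∈ radical c F) : leviPart g = p := by
  apply mat_injective
  ext i j
  rw [mat_leviPart]
  simp only [diagPart, Matrix.of_apply]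
  split_ifs with hij
  · have := h i j hij.ge
    rwa [Matrix.sub_apply, sub_eq_zero] at this
  · rw [hp i j hij]

theorem leviPart_of_mem {p : Par c F} (hp : p ∈ levi c F) : leviPart p = p :=
  leviPart_eq_of_mat_sub hp (by simp)

theorem mat_sub_leviPart_mem (g : Par c F) : mat g - mat (leviPart g) ∈ radical c F := by
  rw [mat_eq g, Matrix.mul_add, Matrix.mul_one, add_sub_cancel_left]
  exact mul_mem_radical _ (radPart g).2

theorem leviPart_radPart_eq {g p : Par c F} {x : radical c F} (hp : p ∈ levi c F)
    (h : mat g = mat p * (1 + (x : Matrix (Fin n) (Fin n) F))) :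
    leviPart g = p ∧ radPart g = x := by
  have h1 : leviPart g = p := by
    refine leviPart_eq_of_mat_sub hp ?_
    rw [h, Matrix.mul_add, Matrix.mul_one, add_sub_cancel_left]
    exact mul_mem_radical _ x.2
  refine ⟨h1, Subtype.ext ?_⟩
  rw [coe_radPart, h1, h, ← Matrix.mul_assoc, mat_inv_mul, Matrix.one_mul, add_sub_cancel_left]

theorem leviPart_mul (g g' : Par c F) : leviPart (g * g') = leviPart g * leviPart g' :=
  mat_injective (by rw [mat_mul, mat_leviPart, mat_leviPart, mat_leviPart, diagPart_mul])

theorem leviPart_one : leviPart (1 : Par c F) = 1 := leviPart_of_mem (one_mem _)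

theorem leviPart_inv (g : Par c F) : leviPart g⁻¹ = (leviPart g)⁻¹ := by
  rw [eq_inv_iff_mul_eq_one, ← leviPart_mul, inv_mul_cancel, leviPart_one]

theorem radPart_one : radPart (1 : Par c F) = 0 := by
  apply Subtype.ext
  rw [coe_radPart, leviPart_one]
  simp

theorem mem_superclass {h : levi c F} {x : radical c F} {g : Par c F} :
    g ∈ superclass h x ↔ IsConj h (leviL g) ∧
      ∃ a b : Par c F, radPart g - lmul a (rmul b x) ∈ idealOf h := by
  constructor
  · rintro ⟨h', y, hc, ⟨_, ⟨a, b, rfl⟩, hy⟩, hg⟩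
    obtain ⟨h1, h2⟩ := leviPart_radPart_eq h'.2 hg
    refine ⟨?_, a, b, ?_⟩
    · have : leviL g = h' := Subtype.ext h1
      rwa [this]
    · rw [h2]
      exact (Submodule.Quotient.eq _).mp hy.symm
  · rintro ⟨hc, a, b, hab⟩
    exact ⟨leviL g, radPart g, hc, ⟨_, ⟨a, b, rfl⟩, ((Submodule.Quotient.eq _).mpr hab).symm⟩,
      mat_eq g⟩

theorem sub_mem_idealOf_trans {h : levi c F} {x y z : radical c F} {a b a' b' : Par c F}
    (hyx : y - lmul a (rmul b x) ∈ idealOf h) (hzy : z - lmul a' (rmul b' y) ∈ idealOf h) :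
    z - lmul (a' * a) (rmul (b * b') x) ∈ idealOf h := by
  have := add_mem hzy (lmul_rmul_mem_idealOf hyx a' b')
  rw [map_sub, map_sub, sub_add_sub_cancel] at this
  rwa [lmul_mul, rmul_mul, lmul_rmul a b']

theorem sub_mem_idealOf_symm {h : levi c F} {x y : radical c F} {a b : Par c F}
    (hyx : y - lmul a (rmul b x) ∈ idealOf h) : x - lmul a⁻¹ (rmul b⁻¹ y) ∈ idealOf h := by
  have := neg_mem (lmul_rmul_mem_idealOf hyx a⁻¹ b⁻¹)
  rw [map_sub, map_sub, neg_sub] at this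
  rwa [← lmul_rmul a, ← lmul_mul, ← rmul_mul, inv_mul_cancel, mul_inv_cancel, lmul_one,
    rmul_one] at this

theorem superclass_eq {h h' : levi c F} {x x' : radical c F} (hc : IsConj h h') {a b : Par c F}
    (hx : x' - lmul a (rmul b x) ∈ idealOf h) : superclass h x = superclass h' x' := by
  ext g
  rw [mem_superclass, mem_superclass, ← idealOf_eq_of_isConj hc]
  refine and_congr ⟨fun h1 => hc.symm.trans h1, fun h1 => hc.trans h1⟩ ⟨?_, ?_⟩
  · rintro ⟨a', b', h1⟩
    exact ⟨_, _, sub_mem_idealOf_trans (sub_mem_idealOf_symm hx) h1⟩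
  · rintro ⟨a', b', h1⟩
    exact ⟨_, _, sub_mem_idealOf_trans hx h1⟩

/-- Modulo `J_h`, every orbit contains the element of a rook placement in `Δ_h`. -/
theorem exists_rookElement (h : levi c F) (x : radical c F) :
    ∃ D, IsRookPlacement (rootsOf h) D ∧
      ∃ a b : Par c F, rookElement D - lmul a (rmul b x) ∈ idealOf h := by
  classical
  obtain ⟨a, b, E, hE, hab⟩ := exists_rookMatrix c (x : Matrix (Fin n) (Fin n) F)
  have hab' : (lmul a (rmul b x) : Matrix (Fin n) (Fin n) F) = rookMatrix F E := by
    rw [coe_lmul, coe_rmul, ← Matrix.mul_assoc, hab]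
  -- The reduced matrix is still in `J`, so its rooks are `J`-roots; those outside `Δ_h` can be
  -- dropped modulo `J_h`.
  have hEJ : ∀ γ ∈ E, γ ∈ jRoots c := by
    rintro ⟨i, j⟩ hγ
    by_contra hlt
    have := (lmul a (rmul b x)).2 i j (not_lt.mp hlt)
    rw [hab'] at this
    simp [rookMatrix, hγ] at this
  refine ⟨E.filter (· ∈ rootsOf h), hE.mono (Finset.filter_subset _ _)
    (fun γ hγ => (Finset.mem_filter.mp hγ).2), a, b, ?_⟩
  rw [mem_idealOf_iff]
  intro i j hr
  rw [Submodule.coe_sub, Matrix.sub_apply, hab',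
    coe_rookElement fun γ hγ => hEJ γ (Finset.mem_filter.mp hγ).1, sub_eq_zero]
  simp only [rookMatrix, Matrix.of_apply]
  congr 1
  simp only [Finset.mem_filter, eq_iff_iff, and_iff_left_iff_imp]
  intro hij
  exact mem_rootsOf_iff.mpr ⟨hEJ _ hij, (scalarSetoid_iff (hEJ _ hij)).mp hr⟩

theorem RookEquiv.exists_rookElement_eq {D D' : Finset (Fin n × Fin n)} (h : RookEquiv c D D')
    (hD : IsRookPlacement (jRoots c) D) (hD' : IsRookPlacement (jRoots c) D') :
    ∃ a b : Par c F, rookElement D' = lmul a (rmul b (rookElement D)) := by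
  obtain ⟨a, b, hab⟩ := exists_rookMatrix_eq_mul (F := F) (hD.mono (Δ' := Set.univ) subset_rfl
    (by simp)) (hD'.mono (Δ' := Set.univ) subset_rfl (by simp))
    (h.blockCount_eq hD.subset hD'.subset)
  refine ⟨a, b, Subtype.ext ?_⟩
  rw [coe_rookElement hD'.subset, coe_lmul, coe_rmul, coe_rookElement hD.subset,
    ← Matrix.mul_assoc, hab]

theorem isRookPlacement_jRoots {h : levi c F} {D : Finset (Fin n × Fin n)}
    (hD : IsRookPlacement (rootsOf h) D) : IsRookPlacement (jRoots c) D :=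
  hD.mono subset_rfl fun γ hγ => (hD.subset γ hγ).1

/-- Rook placements in `Δ_h` whose elements are in the same orbit modulo `J_h` are equivalent. -/
theorem rookEquiv_of_sub_mem_idealOf {h : levi c F} {D D' : Finset (Fin n × Fin n)}
    (hD : IsRookPlacement (rootsOf h) D) (hD' : IsRookPlacement (rootsOf h) D') {a b : Par c F}
    (hab : rookElement D' - lmul a (rmul b (rookElement D)) ∈ idealOf h) : RookEquiv c D D' := by
  classical
  -- When `k` and `m` lie in one scalar segment, every entry of the corner is either seen modulo
  -- `J_h` or zero for all of `J`; for `k > m` only the second case occurs.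
  have hle : ∀ {D D' : Finset (Fin n × Fin n)}, IsRookPlacement (rootsOf h) D →
      IsRookPlacement (rootsOf h) D' → ∀ a b : Par c F,
      rookElement D' - lmul a (rmul b (rookElement D)) ∈ idealOf h →
      ∀ k m : Fin c.length, (k ≤ m → scalarSetoid h k m) →
      (D'.filter fun γ => k ≤ c.index γ.1 ∧ c.index γ.2 ≤ m).card ≤
        (D.filter fun γ => k ≤ c.index γ.1 ∧ c.index γ.2 ≤ m).card := by
    intro D D' hD hD' a b hab k m hkm
    rw [← rank_corner_rookMatrix (F := F) (hD.mono subset_rfl (by simp)),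
      ← rank_corner_rookMatrix (F := F) (hD'.mono subset_rfl (by simp))]
    refine rank_corner_le a b fun i j hi hj => ?_
    rw [← coe_rookElement (isRookPlacement_jRoots hD).subset,
      ← coe_rookElement (isRookPlacement_jRoots hD').subset, Matrix.mul_assoc,
      ← coe_rmul, ← coe_lmul]
    rcases lt_or_ge (c.index i) (c.index j) with hij | hij
    · have hr := scalarSetoid_of_mem_Icc (hkm (hi.trans (hij.le.trans hj)))
        ⟨hi, hij.le.trans hj⟩ ⟨hi.trans hij.le, hj⟩
      have := mem_idealOf_iff.mp hab i j hr
      rwa [Submodule.coe_sub, Matrix.sub_apply, sub_eq_zero] at this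
    · rw [(rookElement D').2 i j hij, (lmul a (rmul b (rookElement D))).2 i j hij]
  have hab' := sub_mem_idealOf_symm hab
  intro k m hkm
  by_cases hr : scalarSetoid h k m
  -- Now the first coordinate is reversed. The condition is an implication so that the pairs with `k
  -- > m`, where there are no roots, belong to the lower set.
  · have := card_fiber_eq_of_card_le_eq D D'
      (fun γ => ((OrderDual.toDual (c.index γ.1), c.index γ.2) : (Fin c.length)ᵒᵈ × Fin c.length))
      {p | OrderDual.ofDual p.1 ≤ p.2 → scalarSetoid h (OrderDual.ofDual p.1) p.2}
      (fun p q (hqp : q.1 ≤ p.1 ∧ q.2 ≤ p.2) hp hq => by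
        have h1 : OrderDual.ofDual p.1 ≤ OrderDual.ofDual q.1 :=
          OrderDual.ofDual_le_ofDual.mpr hqp.1
        exact scalarSetoid_of_mem_Icc (hp (h1.trans (hq.trans hqp.2))) ⟨h1, hq.trans hqp.2⟩
          ⟨h1.trans hq, hqp.2⟩)
      (fun p hp => le_antisymm (hle hD' hD _ _ hab' (OrderDual.ofDual p.1) p.2 hp)
        (hle hD hD' _ _ hab (OrderDual.ofDual p.1) p.2 hp)) (OrderDual.toDual k, m) (fun _ => hr)
    simpa [blockCount, Prod.ext_iff] using this
  -- Blocks outside the scalar segments contain no root of `Δ_h`.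
  · have key : ∀ E : Finset (Fin n × Fin n), (∀ γ ∈ E, γ ∈ rootsOf h) →
        blockCount c E k m = 0 := fun E hE => by
      rw [blockCount, Finset.card_eq_zero, Finset.filter_eq_empty_iff]
      rintro γ hγ ⟨rfl, rfl⟩
      exact hr ((scalarSetoid_iff hkm).mpr (mem_rootsOf_iff.mp (hE γ hγ)).2)
    rw [key D hD.subset, key D' hD'.subset]

end Superclasses

/-! ### The supercharacter formula. -/

section Formula

variable {n : ℕ} {c : Composition n} {F : Type*} [Field F]

/-- Multiplication in `J`, linear in the second factor. -/
def jmul (x : radical c F) : radical c F →ₗ[F] radical c F where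
  toFun z := ⟨x * z, by
    intro i j hij
    rw [Matrix.mul_apply]
    refine Finset.sum_eq_zero fun k _ => ?_
    rcases le_or_gt (c.index k) (c.index i) with hk | hk
    · rw [x.2 i k hk, zero_mul]
    · rw [z.2 k j (hij.trans hk.le), mul_zero]⟩
  map_add' y z := Subtype.ext (by simp [Matrix.mul_add])
  map_smul' t y := Subtype.ext (by simp)

@[simp] theorem coe_jmul (x z : radical c F) :
    (jmul x z : Matrix (Fin n) (Fin n) F) = x * z := rfl

theorem jmul_rmul (x z : radical c F) (a : Par c F) : jmul x (rmul a z) = rmul a (jmul x z) :=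
  Subtype.ext (by simp [Matrix.mul_assoc])

theorem exists_mat_eq_add {p : Par c F} (hp : p ∈ levi c F) (z : radical c F) :
    ∃ g : Par c F, mat g = mat p + z ∧ leviPart g = p := by
  obtain ⟨u, hu⟩ := exists_mat_eq_of_upper (c := c) (F := F) (1 + (lmul p⁻¹ z : radical c F))
    (fun i j hij => by
      rw [Matrix.add_apply, Matrix.one_apply_ne hij.ne', (lmul p⁻¹ z).2 i j (index_mono hij.le),
        add_zero])
    (fun i => by
      rw [Matrix.add_apply, Matrix.one_apply_eq, (lmul p⁻¹ z).2 i i le_rfl, add_zero]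
      exact one_ne_zero)
  have h : mat (p * u) = mat p + z := by
    rw [mat_mul, hu, Matrix.mul_add, Matrix.mul_one, coe_lmul, ← Matrix.mul_assoc, mat_mul_inv,
      Matrix.one_mul]
  refine ⟨p * u, h, leviPart_eq_of_mat_sub hp ?_⟩
  rw [h, add_sub_cancel_left]
  exact z.2

/-- The bijection `p + z ↦ (p, z)` of `G` with `L × J`. -/
def sumEquiv : Par c F ≃ levi c F × radical c F :=
  Equiv.ofBijective (fun g => (leviL g, ⟨mat g - mat (leviPart g), mat_sub_leviPart_mem g⟩)) (by
    constructor
    · intro g g' h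
      have h1 : leviPart g = leviPart g' := congrArg (fun w => (w.1 : Par c F)) h
      have h2 : mat g - mat (leviPart g) = mat g' - mat (leviPart g') :=
        congrArg (fun w => (w.2 : Matrix (Fin n) (Fin n) F)) h
      rw [h1] at h2
      exact mat_injective (sub_left_injective h2)
    · rintro ⟨p, z⟩
      obtain ⟨g, h1, h2⟩ := exists_mat_eq_add p.2 z
      exact ⟨g, Prod.ext (Subtype.ext h2) (Subtype.ext (by simp [h1, h2]))⟩)

theorem mat_sumEquiv_symm (w : levi c F × radical c F) :
    mat (sumEquiv.symm w) = mat (w.1 : Par c F) + w.2 := by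
  obtain ⟨g, rfl⟩ := sumEquiv.surjective w
  rw [Equiv.symm_apply_apply]
  change mat g = mat (leviPart g) + (mat g - mat (leviPart g))
  abel

/-- The bijection `h (1 + x) ↦ (h, x)` of `G` with `L × J`. -/
def leviRadEquiv : Par c F ≃ levi c F × radical c F :=
  Equiv.ofBijective (fun g => (leviL g, radPart g)) (by
    constructor
    · intro g g' h
      have h1 : leviPart g = leviPart g' := congrArg (fun w => (w.1 : Par c F)) h
      have h2 : radPart g = radPart g' := congrArg Prod.snd h
      apply mat_injective
      rw [mat_eq g, mat_eq g', h1, h2]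
    · rintro ⟨p, x⟩
      obtain ⟨g, h1, h2⟩ := exists_mat_eq_add p.2 (lmul p x)
      rw [coe_lmul, ← mul_one_add] at h1
      obtain ⟨h3, h4⟩ := leviPart_radPart_eq p.2 h1
      exact ⟨g, Prod.ext (Subtype.ext h3) h4⟩)

theorem lam_comm {lam : Forms c F} {h : Par c F} (hh : h ∈ orbitStabilizer lam) (a b : Par c F)
    (x : radical c F) : lam (lmul b (rmul a (lmul h x))) = lam (lmul b (rmul a (rmul h x))) :=
  ((mem_orbitStabilizer_iff _ _).mp hh).2 a b x

theorem lam_lmul {lam : Forms c F} {h : Par c F} (hh : h ∈ orbitStabilizer lam)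
    (x : radical c F) : lam (lmul h x) = lam (rmul h x) := by
  simpa only [lmul_one, rmul_one] using lam_comm hh 1 1 x

theorem radPart_mul (g g' : Par c F) :
    radPart (g * g') = lmul (leviPart g')⁻¹ (rmul g' (radPart g)) + radPart g' := by
  apply Subtype.ext
  rw [Submodule.coe_add, coe_lmul, coe_rmul, coe_radPart, coe_radPart, coe_radPart, leviPart_mul,
    _root_.mul_inv_rev, mat_mul, mat_mul]
  noncomm_ring

theorem radPart_inv (g : Par c F) :
    radPart g⁻¹ = -lmul (leviPart g) (rmul g⁻¹ (radPart g)) := by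
  have := radPart_mul g g⁻¹
  rw [mul_inv_cancel, radPart_one, leviPart_inv, inv_inv] at this
  exact (neg_eq_of_add_eq_zero_right this.symm).symm

theorem lam_lmul_jmul_eq_zero {lam : Forms c F} {h : Par c F} (hh : h ∈ orbitStabilizer lam)
    {r : radical c F} (hr : ∀ z, lam (jmul r z) = 0) (z : radical c F) :
    lam (lmul h (jmul r z)) = 0 := by
  rw [lam_lmul hh, ← jmul_rmul, hr]

/-- An explicit description of the join. The conditions define a subgroup because an `h` in the
stabilizer can be moved from the left of a product `x z` to its right, where `z` absorbs it. -/
theorem mem_semidirect {lam : Forms c F} {g : Par c F} :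
    g ∈ semidirect (orbitStabilizer lam) lam ↔
      leviPart g ∈ orbitStabilizer lam ∧ ∀ z, lam (jmul (radPart g) z) = 0 := by
  let S : Subgroup (Par c F) :=
    { carrier := {g | leviPart g ∈ orbitStabilizer lam ∧ ∀ z, lam (jmul (radPart g) z) = 0}
      one_mem' := by
        refine ⟨by rw [leviPart_one]; exact one_mem _, fun z => ?_⟩
        have : jmul (radPart (1 : Par c F)) z = 0 := Subtype.ext (by simp [radPart_one])
        rw [this, map_zero]
      mul_mem' := by
        rintro a b ⟨ha, ha'⟩ ⟨hb, hb'⟩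
        refine ⟨by rw [leviPart_mul]; exact mul_mem ha hb, fun z => ?_⟩
        have : jmul (radPart (a * b)) z =
            lmul (leviPart b)⁻¹ (jmul (radPart a) (lmul b z)) + jmul (radPart b) z :=
          Subtype.ext (by simp [radPart_mul, Matrix.add_mul, Matrix.mul_assoc])
        rw [this, map_add, hb', add_zero, lam_lmul_jmul_eq_zero (inv_mem hb) ha']
      inv_mem' := by
        rintro a ⟨ha, ha'⟩
        refine ⟨by rw [leviPart_inv]; exact inv_mem ha, fun z => ?_⟩
        have : jmul (radPart a⁻¹) z = -lmul (leviPart a) (jmul (radPart a) (lmul a⁻¹ z)) :=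
          Subtype.ext (by simp [radPart_inv, Matrix.mul_assoc])
        rw [this, map_neg, lam_lmul_jmul_eq_zero ha ha', neg_zero] }
  have hS : semidirect (orbitStabilizer lam) lam = S := by
    apply le_antisymm
    · refine sup_le (fun h hh => ?_) fun u hu => ?_
      · have h1 : leviPart h = h := leviPart_of_mem hh.1
        refine ⟨by rw [h1]; exact hh, fun z => ?_⟩
        have : jmul (radPart h) z = 0 := Subtype.ext (by simp [coe_radPart, h1, mat_inv_mul])
        rw [this, map_zero]
      · have h1 : leviPart u = 1 := leviPart_eq_of_mat_sub (one_mem _) hu.1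
        refine ⟨by rw [h1]; exact one_mem _, fun z => ?_⟩
        have : jmul (radPart u) z = lmul u z - z :=
          Subtype.ext (by simp [coe_radPart, h1, Matrix.sub_mul])
        rw [this, map_sub, hu.2, sub_self]
    · rintro g ⟨h1, h2⟩
      rw [← mul_inv_cancel_left (leviPart g) g]
      refine Subgroup.mul_mem_sup h1 ⟨sub_one_mem_radical g, fun z => ?_⟩
      have : lmul ((leviPart g)⁻¹ * g) z = jmul (radPart g) z + z :=
        Subtype.ext (by simp [coe_radPart, Matrix.sub_mul])
      rw [this, map_add, h2, zero_add]
  rw [hS]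
  rfl

/-- This makes `g ↦ ε^{lam(x p)}` a linear character of the subgroup. For `g = h (1 + x)` and `g' =
h' (1 + x')` the cross term is killed by the right-stabilizer condition on `x`, and the conjugation
of `x` by `h'` is invisible to `lam`. -/
theorem lam_rmul_radPart_mul {lam : Forms c F} {g g' : Par c F}
    (hg : g ∈ semidirect (orbitStabilizer lam) lam)
    (hg' : g' ∈ semidirect (orbitStabilizer lam) lam) (p : Par c F) :
    lam (rmul p (radPart (g * g'))) = lam (rmul p (radPart g)) + lam (rmul p (radPart g')) := by
  rw [mem_semidirect] at hg hg'
  have h1 : rmul p (radPart (g * g')) =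
      lmul (leviPart g')⁻¹ (rmul p (rmul (leviPart g') (radPart g))) +
      lmul (leviPart g')⁻¹ (jmul (radPart g) (lmul (leviPart g') (rmul p (radPart g')))) +
      rmul p (radPart g') := by
    rw [radPart_mul, map_add, ← lmul_rmul, ← map_add]
    congr 2
    apply Subtype.ext
    simp only [coe_rmul, Submodule.coe_add, coe_jmul, coe_lmul]
    conv_lhs => rw [mat_eq g']
    noncomm_ring
  rw [h1, map_add, map_add, lam_lmul_jmul_eq_zero (inv_mem hg'.1) hg.2, add_zero,
    ← lam_comm hg'.1, ← lmul_rmul, ← lmul_mul, inv_mul_cancel, lmul_one]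

theorem isCharacter_chi [Finite F] (ε : AddChar F ℂ) {lam : Forms c F}
    {H₀ : Subgroup (Par c F)} (hH : H₀ = orbitStabilizer lam) {θ : H₀ → ℂ}
    (hθ : IsCharacter θ) : IsCharacter (chi ε H₀ θ lam) := by
  subst hH
  have := Fintype.ofFinite (levi c F)
  refine IsCharacter.induced _ ?_
  let φ : semidirect (orbitStabilizer lam) lam →* orbitStabilizer lam :=
    { toFun := fun g => ⟨leviPart g, (mem_semidirect.mp g.2).1⟩
      map_one' := Subtype.ext leviPart_one
      map_mul' := fun a b => Subtype.ext (leviPart_mul _ _) }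
  let ψ : levi c F → semidirect (orbitStabilizer lam) lam →* ℂ := fun p =>
    { toFun := fun g => ε (lam (rmul (p : Par c F) (radPart g)))
      map_one' := by
        rw [Subgroup.coe_one, radPart_one, map_zero, map_zero, AddChar.map_zero_eq_one]
      map_mul' := fun a b => by
        rw [Subgroup.coe_mul, lam_rmul_radPart_mul a.2 b.2, AddChar.map_add_eq_mul] }
  have key : (fun g : semidirect (orbitStabilizer lam) lam =>
      ∑ᶠ p : levi c F, xi ε (orbitStabilizer lam) θ (formAct (p : Par c F) lam 1) (g : Par c F)) =
      ∑ p : levi c F, fun g => (θ ∘ φ) g * ψ p g := by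
    ext g
    rw [finsum_eq_sum_of_fintype, Finset.sum_apply]
    refine Finset.sum_congr rfl fun p _ => ?_
    have hg := (mem_semidirect.mp g.2).1
    simp only [xi, extendByZero, dif_pos hg, formAct_apply, lmul_one]
    rfl
  rw [key]
  exact IsCharacter.sum _ fun p _ => (hθ.comp φ).twist (ψ p)

theorem sum_addChar_form {ε : AddChar F ℂ} (hε : ε ≠ 1) [Fintype (radical c F)]
    (ν : Forms c F) [Decidable (ν = 0)] :
    ∑ z, ε (ν z) = if ν = 0 then (Nat.card (radical c F) : ℂ) else 0 := by
  split_ifs with h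
  · simp [h]
  · let ψ : AddChar (radical c F) ℂ := ε.compAddMonoidHom ν.toAddMonoidHom
    refine AddChar.sum_eq_zero_of_ne_one (ψ := ψ) fun h1 => hε ?_
    obtain ⟨z, hz⟩ : ∃ z, ν z ≠ 0 := by
      by_contra! hcon
      exact h (LinearMap.ext hcon)
    ext t
    -- Scaling `z` makes `ν` take the arbitrary value `t`.
    have := congrArg (fun f : AddChar (radical c F) ℂ => f ((t / ν z) • z)) h1
    simpa [ψ, hz] using this

/-- Writing the elements of `G` as `p + z` with `p ∈ L`, `z ∈ J` factors the sum over `G`. The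
factor `∑_z ε^{lam(x z)}` is `|J|` or 0 according to whether the right-stabilizer condition holds,
so the full sum over `G` absorbs the extension by zero. -/
theorem extendByZero_of_sum [Finite F] {ε : AddChar F ℂ} (hε : ε ≠ 1) {lam : Forms c F}
    (θ : orbitStabilizer lam → ℂ) [Fintype (Par c F)] (g : Par c F) :
    extendByZero (semidirect (orbitStabilizer lam) lam) (fun g => ∑ᶠ p : levi c F,
      xi ε (orbitStabilizer lam) θ (formAct (p : Par c F) lam 1) (g : Par c F)) g =
    extendByZero (orbitStabilizer lam) θ (leviPart g) *
      ((Nat.card (radical c F) : ℂ)⁻¹ * ∑ b : Par c F, ε (lam (rmul b (radPart g)))) := by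
  classical
  have := Fintype.ofFinite (levi c F)
  have := Fintype.ofFinite (radical c F)
  have hJ : (Nat.card (radical c F) : ℂ) ≠ 0 := Nat.cast_ne_zero.mpr Nat.card_pos.ne'
  by_cases hl : leviPart g ∈ orbitStabilizer lam
  swap
  · have hg : g ∉ semidirect (orbitStabilizer lam) lam := fun h => hl (mem_semidirect.mp h).1
    simp [extendByZero, hl, hg]
  have hsum : ∑ b : Par c F, ε (lam (rmul b (radPart g))) =
      (∑ p : levi c F, ε (lam (rmul (p : Par c F) (radPart g)))) *
        ∑ z : radical c F, ε ((lam ∘ₗ jmul (radPart g)) z) := by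
    rw [Finset.sum_mul_sum, ← Fintype.sum_prod_type']
    refine (Fintype.sum_equiv sumEquiv.symm _ _ fun w => ?_).symm
    have : rmul (sumEquiv.symm w) (radPart g) =
        rmul (w.1 : Par c F) (radPart g) + jmul (radPart g) w.2 :=
      Subtype.ext (by simp [mat_sumEquiv_symm, Matrix.mul_add])
    rw [this, map_add, AddChar.map_add_eq_mul]
    rfl
  rw [hsum, sum_addChar_form hε]
  by_cases hg : g ∈ semidirect (orbitStabilizer lam) lam
  · have h0 : lam ∘ₗ jmul (radPart g) = 0 := LinearMap.ext (mem_semidirect.mp hg).2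
    rw [if_pos h0]
    simp only [extendByZero, dif_pos hg, dif_pos hl, finsum_eq_sum_of_fintype, xi, formAct_apply,
      lmul_one]
    rw [← Finset.mul_sum]
    field_simp
  · have h0 : lam ∘ₗ jmul (radPart g) ≠ 0 := fun h0 =>
      hg (mem_semidirect.mpr ⟨hl, LinearMap.congr_fun h0⟩)
    rw [if_neg h0]
    simp [extendByZero, hg]

theorem leviPart_conj (s g : Par c F) :
    leviPart (s * g * s⁻¹) = leviPart s * leviPart g * (leviPart s)⁻¹ := by
  rw [leviPart_mul, leviPart_mul, leviPart_inv]

theorem conj_mem_orbitStabilizer_iff {lam : Forms c F} {p h : Par c F} (hp : p ∈ levi c F) :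
    p * h * p⁻¹ ∈ orbitStabilizer lam ↔ h ∈ orbitStabilizer lam := by
  refine ⟨fun H => ?_, conj_mem_orbitStabilizer hp⟩
  have := conj_mem_orbitStabilizer (inv_mem hp) H
  convert this using 1
  group

/-- With `h` the Levi component of `g` and `y` the radical component of `s`, the correction term is
`h⁻¹ y h - y` between two factors from `G`. Every form whose orbit is fixed by `h` kills it. -/
theorem rmul_radPart_conj (s g d : Par c F) :
    rmul (s * d) (radPart (s * g * s⁻¹)) =
      lmul (leviPart s) (rmul ((leviPart g)⁻¹ * g * d)
        (lmul (leviPart g)⁻¹ (rmul (leviPart g) (radPart s)) - radPart s)) +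
      lmul s (rmul d (radPart g)) := by
  apply Subtype.ext
  simp only [coe_rmul, coe_lmul, Submodule.coe_add, Submodule.coe_sub, coe_radPart, leviPart_conj,
    _root_.mul_inv_rev, inv_inv, mat_mul]
  have e1 := mat_mul_inv (leviPart s)
  have e2 := mat_mul_inv (leviPart g)
  have e3 := mat_inv_mul s
  generalize mat (leviPart s) = P at *
  generalize mat (leviPart s)⁻¹ = P' at *
  generalize mat (leviPart g) = H at *
  generalize mat (leviPart g)⁻¹ = H' at *
  generalize mat s⁻¹ = S' at *
  generalize mat s = S at *
  generalize mat g = X at *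
  generalize mat d = Y at *
  have f1 : ∀ Z, P * (P' * Z) = Z := fun Z => by rw [← Matrix.mul_assoc, e1, Matrix.one_mul]
  have f2 : ∀ Z, H * (H' * Z) = Z := fun Z => by rw [← Matrix.mul_assoc, e2, Matrix.one_mul]
  have f3 : ∀ Z, S' * (S * Z) = Z := fun Z => by rw [← Matrix.mul_assoc, e3, Matrix.one_mul]
  simp only [Matrix.sub_mul, Matrix.mul_sub, Matrix.mul_assoc, Matrix.one_mul, f1, f2, f3]
  abel

theorem lam_rmul_radPart_conj {lam : Forms c F} {g : Par c F}
    (hg : leviPart g ∈ orbitStabilizer lam) (s d : Par c F) :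
    lam (rmul (s * d) (radPart (s * g * s⁻¹))) = lam (lmul s (rmul d (radPart g))) := by
  rw [rmul_radPart_conj, map_add, map_sub, map_sub, map_sub, lam_comm (inv_mem hg),
    ← rmul_mul _ _ (radPart s), mul_inv_cancel, rmul_one, sub_self, zero_add]

theorem extendByZero_conj {lam : Forms c F} {θ : orbitStabilizer lam → ℂ}
    (hθ : ConjInvariant (levi c F) θ) {p : Par c F} (hp : p ∈ levi c F) (h : Par c F) :
    extendByZero (orbitStabilizer lam) θ (p * h * p⁻¹) = extendByZero (orbitStabilizer lam) θ h := by
  by_cases hh : h ∈ orbitStabilizer lam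
  · have := conj_mem_orbitStabilizer hp hh
    simp only [extendByZero, dif_pos hh, dif_pos this]
    exact hθ p hp _ _ rfl
  · have := mt (conj_mem_orbitStabilizer_iff hp).mp hh
    simp only [extendByZero, dif_neg hh, dif_neg this]

/-- The sum of `ε^{lam(a x b)}` over `a, b ∈ G`. -/
def orbitSum (ε : AddChar F ℂ) (lam : Forms c F) (x : radical c F) : ℂ :=
  ∑ᶠ a : Par c F, ∑ᶠ b : Par c F, ε (lam (lmul a (rmul b x)))

/-- The normalizing factor of the supercharacters. -/
def chiFactor (lam : Forms c F) : ℂ :=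
  (Nat.card (semidirect (orbitStabilizer lam) lam) : ℂ)⁻¹ * (Nat.card (radical c F) : ℂ)⁻¹

/-- The supercharacter formula. -/
theorem chi_apply [Finite F] {ε : AddChar F ℂ} (hε : ε ≠ 1) {lam : Forms c F}
    {H₀ : Subgroup (Par c F)} (hH : H₀ = orbitStabilizer lam) {θ : H₀ → ℂ}
    (hθ : ConjInvariant (levi c F) θ) (g : Par c F) :
    chi ε H₀ θ lam g =
      extendByZero H₀ θ (leviPart g) * (chiFactor lam * orbitSum ε lam (radPart g)) := by
  subst hH
  have := Fintype.ofFinite (Par c F)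
  have h1 : ∀ s : Par c F, extendByZero (semidirect (orbitStabilizer lam) lam) (fun g =>
      ∑ᶠ p : levi c F, xi ε (orbitStabilizer lam) θ (formAct (p : Par c F) lam 1) (g : Par c F))
      (s * g * s⁻¹) = extendByZero (orbitStabilizer lam) θ (leviPart g) *
      ((Nat.card (radical c F) : ℂ)⁻¹ * ∑ d : Par c F, ε (lam (lmul s (rmul d (radPart g))))) := by
    intro s
    rw [extendByZero_of_sum hε, leviPart_conj, extendByZero_conj hθ (leviPart_mem s)]
    by_cases hg : leviPart g ∈ orbitStabilizer lam
    · congr 2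
      -- The substitution `d ↦ s d` turns the value at the conjugate into a two-sided expression in
      -- the radical component of `g`.
      refine (Fintype.sum_equiv (Equiv.mulLeft s) _ _ fun d => ?_).symm
      rw [Equiv.coe_mulLeft, lam_rmul_radPart_conj hg]
    · simp [extendByZero, hg]
  rw [chi, induced, finsum_eq_sum_of_fintype, Finset.sum_congr rfl fun s _ => h1 s, chiFactor,
    orbitSum]
  simp only [finsum_eq_sum_of_fintype, ← Finset.mul_sum]
  ring

theorem orbitSum_formAct [Finite F] (ε : AddChar F ℂ) (lam : Forms c F) (a b : Par c F)
    (x : radical c F) : orbitSum ε (formAct a lam b) x = orbitSum ε lam x := by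
  have := Fintype.ofFinite (Par c F)
  simp only [orbitSum, finsum_eq_sum_of_fintype]
  refine Fintype.sum_equiv (Equiv.mulLeft b) _ _ fun s => ?_
  refine Fintype.sum_equiv (Equiv.mulRight a) _ _ fun d => ?_
  simp only [formAct_apply, Equiv.coe_mulLeft, Equiv.coe_mulRight, ← lmul_rmul, ← lmul_mul,
    ← rmul_mul]

/-- The difference of `lam_rmul_radPart_conj` for the factors `1 + w` and 1. -/
theorem lam_jmul_radPart_conj {lam : Forms c F} {g : Par c F}
    (hg : leviPart g ∈ orbitStabilizer lam) (s : Par c F) (w : radical c F) :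
    lam (jmul (radPart (s * g * s⁻¹)) (lmul s w)) = lam (lmul s (jmul (radPart g) w)) := by
  obtain ⟨u, hu, -⟩ := exists_mat_eq_add (one_mem (levi c F)) w
  have h1 := lam_rmul_radPart_conj hg s u
  have h2 := lam_rmul_radPart_conj hg s 1
  have e1 : jmul (radPart (s * g * s⁻¹)) (lmul s w) =
      rmul (s * u) (radPart (s * g * s⁻¹)) - rmul (s * 1) (radPart (s * g * s⁻¹)) :=
    Subtype.ext (by simp [hu, Matrix.mul_add])
  have e2 : lmul s (jmul (radPart g) w) =
      lmul s (rmul u (radPart g)) - lmul s (rmul 1 (radPart g)) :=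
    Subtype.ext (by simp [hu, Matrix.mul_add])
  rw [e1, e2, map_sub, map_sub, h1, h2]

/-- Conjugation by `b` carries the subgroup of `a lam b` to that of `lam`, so their orders agree. -/
theorem chiFactor_formAct (lam : Forms c F) (a b : Par c F) :
    chiFactor (formAct a lam b) = chiFactor lam := by
  rw [chiFactor, chiFactor]
  congr 3
  refine Nat.card_congr ((MulAut.conj b).toEquiv.subtypeEquiv fun g => ?_)
  rw [mem_semidirect]
  change _ ↔ b * g * b⁻¹ ∈ semidirect (orbitStabilizer lam) lam
  rw [mem_semidirect, orbitStabilizer_formAct, leviPart_conj,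
    conj_mem_orbitStabilizer_iff (leviPart_mem b)]
  refine and_congr_right fun hg => ⟨fun H z => ?_, fun H z => ?_⟩
  · have := H (rmul a⁻¹ (lmul b⁻¹ z))
    rw [formAct_apply, ← jmul_rmul, ← rmul_mul, inv_mul_cancel, rmul_one,
      ← lam_jmul_radPart_conj hg, ← lmul_mul, mul_inv_cancel, lmul_one] at this
    exact this
  · rw [formAct_apply, ← jmul_rmul, ← lam_jmul_radPart_conj hg]
    exact H _

theorem chi_formAct [Finite F] {ε : AddChar F ℂ} (hε : ε ≠ 1) {lam : Forms c F} (a b : Par c F)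
    {H₀ : Subgroup (Par c F)} (hH : H₀ = orbitStabilizer lam) {θ : H₀ → ℂ}
    (hθ : ConjInvariant (levi c F) θ) : chi ε H₀ θ (formAct a lam b) = chi ε H₀ θ lam := by
  ext g
  rw [chi_apply hε hH hθ, chi_apply hε (hH.trans (orbitStabilizer_formAct a b lam).symm) hθ,
    chiFactor_formAct, orbitSum_formAct]

theorem chiFactor_ne_zero [Finite F] (lam : Forms c F) : chiFactor lam ≠ 0 :=
  mul_ne_zero (inv_ne_zero (Nat.cast_ne_zero.mpr Nat.card_pos.ne'))
    (inv_ne_zero (Nat.cast_ne_zero.mpr Nat.card_pos.ne'))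

theorem orbitSum_zero [Finite F] (ε : AddChar F ℂ) (lam : Forms c F) : orbitSum ε lam 0 ≠ 0 := by
  have := Fintype.ofFinite (Par c F)
  simp [orbitSum, finsum_eq_sum_of_fintype]

theorem chi_ne_zero [Finite F] {ε : AddChar F ℂ} (hε : ε ≠ 1) {lam : Forms c F}
    {H₀ : Subgroup (Par c F)} (hH : H₀ = orbitStabilizer lam) {θ : H₀ → ℂ}
    (hθ : ConjInvariant (levi c F) θ) (h0 : θ ≠ 0) : chi ε H₀ θ lam ≠ 0 := by
  obtain ⟨h, hh⟩ := Function.ne_iff.mp h0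
  refine fun hchi => hh ?_
  have h1 := congrFun hchi h
  have hL : (h : Par c F) ∈ levi c F := (hH.le h.2).1
  have hl : leviPart (h : Par c F) = h := leviPart_of_mem hL
  have hr : radPart (h : Par c F) = 0 := Subtype.ext (by simp [coe_radPart, hl, mat_inv_mul])
  rw [chi_apply hε hH hθ, hl, hr] at h1
  have := (mul_eq_zero.mp h1).resolve_right
    (mul_ne_zero (chiFactor_ne_zero lam) (orbitSum_zero ε lam))
  simpa [extendByZero] using this

/-- After expansion each summand is a sum over `J` of an additive character given by the difference
of forms in two distinct orbits, which is not zero. -/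
theorem sum_orbitSum_mul_conj [Finite F] {ε : AddChar F ℂ} (hε : ε ≠ 1) {lam lam' : Forms c F}
    [Fintype (radical c F)] (h : ∀ a b : Par c F, formAct a lam b ≠ lam') :
    ∑ x, orbitSum ε lam x * starRingEnd ℂ (orbitSum ε lam' x) = 0 := by
  classical
  have := Fintype.ofFinite (Par c F)
  simp only [orbitSum, finsum_eq_sum_of_fintype, map_sum, Finset.sum_mul_sum]
  rw [Finset.sum_comm]
  refine Finset.sum_eq_zero fun s _ => ?_
  rw [Finset.sum_comm]
  refine Finset.sum_eq_zero fun s' _ => ?_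
  rw [Finset.sum_comm]
  refine Finset.sum_eq_zero fun d _ => ?_
  rw [Finset.sum_comm]
  refine Finset.sum_eq_zero fun d' _ => ?_
  have h1 : formAct d lam s - formAct d' lam' s' ≠ 0 := fun h0 => by
    refine h (d'⁻¹ * d) (s * s'⁻¹) ?_
    rw [← formAct_formAct, sub_eq_zero.mp h0, formAct_formAct]
    simp [formAct_one]
  have h2 := sum_addChar_form hε (formAct d lam s - formAct d' lam' s')
  rw [if_neg h1] at h2
  rw [← h2]
  refine Finset.sum_congr rfl fun x _ => ?_
  rw [← AddChar.map_neg_eq_conj, ← AddChar.map_add_eq_mul, LinearMap.sub_apply, sub_eq_add_neg]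
  rfl

end Formula

/-! ### The action of `L` on `H(D)` and the equality of the numbers. -/

section Counting

variable {n : ℕ} {c : Composition n} {F : Type*} [Field F]

open Classical in
/-- The matrix with the rows of `M` in the segments satisfying `P`, and the rows of the identity
matrix in the other segments. -/
def mixMatrix (c : Composition n) (P : Fin c.length → Prop) (M : Matrix (Fin n) (Fin n) F) :
    Matrix (Fin n) (Fin n) F :=
  Matrix.of fun s t => if P (c.index s) then M s t else (1 : Matrix (Fin n) (Fin n) F) s t

theorem mixMatrix_of {P : Fin c.length → Prop} (M : Matrix (Fin n) (Fin n) F) {s : Fin n}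
    (hs : P (c.index s)) (t : Fin n) : mixMatrix c P M s t = M s t := by
  simp [mixMatrix, hs]

theorem mixMatrix_of_not {P : Fin c.length → Prop} (M : Matrix (Fin n) (Fin n) F) {s : Fin n}
    (hs : ¬ P (c.index s)) (t : Fin n) :
    mixMatrix c P M s t = (1 : Matrix (Fin n) (Fin n) F) s t := by
  simp [mixMatrix, hs]

/-- Rows of a product with an element of the Levi subgroup only involve rows of the same
segment. -/
theorem levi_mul_congr {p : Par c F} (hp : p ∈ levi c F) {M N : Matrix (Fin n) (Fin n) F}
    {s : Fin n} (h : ∀ u, c.index u = c.index s → ∀ t, M u t = N u t) (t : Fin n) :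
    (mat p * M) s t = (mat p * N) s t := by
  rw [Matrix.mul_apply, Matrix.mul_apply]
  refine Finset.sum_congr rfl fun u _ => ?_
  by_cases hu : c.index u = c.index s
  · rw [h u hu t]
  · rw [hp s u (Ne.symm hu), zero_mul, zero_mul]

theorem mixMatrix_mul (P : Fin c.length → Prop) {p q : Par c F} (hp : p ∈ levi c F) :
    mixMatrix c P (mat p) * mixMatrix c P (mat q) = mixMatrix c P (mat (p * q)) := by
  ext s t
  by_cases hs : P (c.index s)
  · rw [mixMatrix_of _ hs, mat_mul, ← levi_mul_congr hp (M := mixMatrix c P (mat q))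
      (fun u hu t => mixMatrix_of _ (hu ▸ hs) t), Matrix.mul_apply, Matrix.mul_apply]
    simp only [mixMatrix_of _ hs]
  · rw [Matrix.mul_apply]
    simp only [mixMatrix_of_not _ hs]
    rw [← Matrix.mul_apply, Matrix.one_mul, mixMatrix_of_not _ hs]

theorem mixMatrix_one (P : Fin c.length → Prop) :
    mixMatrix c P (1 : Matrix (Fin n) (Fin n) F) = 1 := by
  ext s t
  simp [mixMatrix]

theorem exists_mat_eq_mixMatrix (P : Fin c.length → Prop) {p : Par c F} (hp : p ∈ levi c F) :
    ∃ q ∈ levi c F, mat q = mixMatrix c P (mat p) := by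
  have hL : ∀ s t, c.index s ≠ c.index t → mixMatrix c P (mat p) s t = 0 := fun s t hst => by
    by_cases hs : P (c.index s)
    · rw [mixMatrix_of _ hs, hp s t hst]
    · rw [mixMatrix_of_not _ hs, Matrix.one_apply_ne (fun h => hst (congrArg c.index h))]
  refine ⟨⟨⟨mixMatrix c P (mat p), mixMatrix c P (mat p⁻¹), ?_, ?_⟩, fun i j hij => ?_⟩, hL, rfl⟩
  · rw [mixMatrix_mul P hp, mul_inv_cancel, mat_one, mixMatrix_one]
  · rw [mixMatrix_mul P (inv_mem hp), inv_mul_cancel, mat_one, mixMatrix_one]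
  · exact hL i j hij.ne'

theorem rookSubgroup_le_levi (D : Finset (Fin n × Fin n)) : rookSubgroup F c D ≤ levi c F :=
  fun _ h => (mem_rookSubgroup.mp h).1

/-- The Levi subgroup acts on `H(D)` by inner automorphisms of `H(D)`. -/
theorem exists_conj_eq (D : Finset (Fin n × Fin n)) {p : Par c F} (hp : p ∈ levi c F) :
    ∃ q ∈ rookSubgroup F c D, ∀ h ∈ rookSubgroup F c D, p * h * p⁻¹ = q * h * q⁻¹ := by
  -- The segments covered by roots of `D`. Split `p = r q`, where `r` is the part of `p` on these
  -- segments and `q` the part on the others. Then `q ∈ H(D)`, since it is the identity on the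
  -- covered segments.
  let P : Fin c.length → Prop := fun k => ∃ γ ∈ D, k ∈ Set.Icc (c.index γ.1) (c.index γ.2)
  obtain ⟨r, hrL, hr⟩ := exists_mat_eq_mixMatrix P hp
  obtain ⟨q, hqL, hq⟩ := exists_mat_eq_mixMatrix (fun k => ¬ P k) hp
  have hpq : p = r * q := by
    apply mat_injective
    ext s t
    rw [mat_mul]
    by_cases hs : P (c.index s)
    · rw [levi_mul_congr hrL (N := 1) (fun u hu t => by
        rw [hq, mixMatrix_of_not (P := fun k => ¬ P k) _ (by rw [hu]; exact not_not.mpr hs)]),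
        Matrix.mul_one, hr, mixMatrix_of _ hs]
    · rw [Matrix.mul_apply]
      simp only [hr, mixMatrix_of_not _ hs]
      rw [← Matrix.mul_apply, Matrix.one_mul, hq, mixMatrix_of (P := fun k => ¬ P k) _ hs]
  have hqD : q ∈ rookSubgroup F c D := by
    refine mem_rookSubgroup.mpr ⟨hqL, fun γ hγ => ⟨1, fun s t hs _ => ?_⟩⟩
    have hs' : P (c.index s) := ⟨γ, hγ, hs⟩
    rw [hq, mixMatrix_of_not (P := fun k => ¬ P k) _ (not_not.mpr hs'), Matrix.one_apply]
  -- On the segments where `r` can differ from the identity, `h` is scalar.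
  have hcomm : ∀ h ∈ rookSubgroup F c D, r * h = h * r := by
    intro h hh
    obtain ⟨hL, hs⟩ := mem_rookSubgroup.mp hh
    apply mat_injective
    ext s t
    rw [mat_mul, mat_mul]
    by_cases hs' : P (c.index s)
    · obtain ⟨γ, hγ, hsγ⟩ := hs'
      obtain ⟨a, ha⟩ := hs γ hγ
      rw [levi_mul_congr hrL (N := a • (1 : Matrix (Fin n) (Fin n) F)) (fun u hu t => by
        rw [IsScalarOn.row hL ha u t (hu ▸ hsγ), Matrix.smul_apply, Matrix.one_apply]
        simp), Matrix.mul_smul, Matrix.mul_one, Matrix.mul_apply]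
      simp [IsScalarOn.row hL ha s _ hsγ]
    · rw [levi_mul_congr hL (N := 1) (fun u hu t => by
        rw [hr, mixMatrix_of_not _ (by rw [hu]; exact hs')]), Matrix.mul_one, Matrix.mul_apply]
      simp only [hr, mixMatrix_of_not _ hs']
      rw [← Matrix.mul_apply, Matrix.one_mul]
  refine ⟨q, hqD, fun h hh => ?_⟩
  have := hcomm _ (mul_mem (mul_mem hqD hh) (inv_mem hqD))
  calc p * h * p⁻¹ = r * (q * h * q⁻¹) * r⁻¹ := by rw [hpq]; group
    _ = q * h * q⁻¹ := by rw [this]; group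

theorem conj_mem_rookSubgroup {D : Finset (Fin n × Fin n)} {p h : Par c F} (hp : p ∈ levi c F)
    (hh : h ∈ rookSubgroup F c D) : p * h * p⁻¹ ∈ rookSubgroup F c D := by
  obtain ⟨q, hq, H⟩ := exists_conj_eq D hp
  rw [H h hh]
  exact mul_mem (mul_mem hq hh) (inv_mem hq)

/-- Conjugation by `L` is inner on `H(D)`, so every character is invariant. -/
theorem IsCharacter.conjInvariant {D : Finset (Fin n × Fin n)} {θ : rookSubgroup F c D → ℂ}
    (hθ : IsCharacter θ) : ConjInvariant (levi c F) θ := by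
  intro p hp x y hxy
  obtain ⟨q, hq, H⟩ := exists_conj_eq D hp
  have : y = ⟨q, hq⟩ * x * ⟨q, hq⟩⁻¹ := Subtype.ext (by rw [hxy, H x x.2]; rfl)
  rw [this, hθ.conj]

theorem isRelIrreducible_iff [Finite F] {D : Finset (Fin n × Fin n)}
    {θ : rookSubgroup F c D → ℂ} :
    IsRelIrreducible (levi c F) θ ↔ IsIrreducibleCharacter θ := by
  constructor
  · intro h
    rcases h.isCharacter.trichotomy with h0 | h1 | ⟨θ₁, θ₂, h1, h2, h3, h4, h5⟩
    · exact absurd h0 h.ne_zero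
    · exact h1
    · rcases h.indecomposable θ₁ θ₂ h1 h2 h1.conjInvariant h2.conjInvariant h5 with h | h
      · exact absurd h h3
      · exact absurd h h4
  · intro h
    exact ⟨h.isCharacter, h.isCharacter.conjInvariant, h.ne_zero,
      fun θ₁ θ₂ h1 h2 _ _ h3 => h.eq_zero_or_eq_zero h1 h2 h3⟩

theorem IsConjTransversal.eq {G : Type*} [Group G] {T : Set G} (hT : IsConjTransversal T)
    {t t' : G} (ht : t ∈ T) (ht' : t' ∈ T) (h : IsConj t t') : t = t' :=
  (hT t).unique ⟨ht, IsConj.refl t⟩ ⟨ht', h⟩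

theorem RookEquiv.symm {D D' : Finset (Fin n × Fin n)} (h : RookEquiv c D D') :
    RookEquiv c D' D := fun k m hkm => (h k m hkm).symm

theorem RookEquiv.trans {D D' D'' : Finset (Fin n × Fin n)} (h : RookEquiv c D D')
    (h' : RookEquiv c D' D'') : RookEquiv c D D'' := fun k m hkm => (h k m hkm).trans (h' k m hkm)

theorem IsRookTransversal.eq {Δ : Set (Fin n × Fin n)} {R : Set (Finset (Fin n × Fin n))}
    (hR : IsRookTransversal c Δ R) {D D' : Finset (Fin n × Fin n)} (hD : D ∈ R) (hD' : D' ∈ R)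
    (h : RookEquiv c D D') : D = D' :=
  (hR.2 D (hR.1 D hD)).unique ⟨hD, fun _ _ _ => rfl⟩ ⟨hD', h⟩

/-- The conjugacy classes of `H(D)` are represented by the elements of `T` in `H(D)`. -/
theorem card_conjClasses_rookSubgroup {T : Set (levi c F)} (hT : IsConjTransversal T)
    (D : Finset (Fin n × Fin n)) : Nat.card (ConjClasses (rookSubgroup F c D)) =
      Nat.card {t : T // ((t : levi c F) : Par c F) ∈ rookSubgroup F c D} := by
  symm
  refine Nat.card_congr (Equiv.ofBijective
    (fun t => ConjClasses.mk (⟨_, t.2⟩ : rookSubgroup F c D)) ⟨fun t t' h => ?_, fun C => ?_⟩)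
  · rw [ConjClasses.mk_eq_mk_iff_isConj, isConj_iff] at h
    obtain ⟨q, hq⟩ := h
    refine Subtype.ext (Subtype.ext (hT.eq t.1.2 t'.1.2 (isConj_iff.mpr
      ⟨⟨q, rookSubgroup_le_levi D q.2⟩, Subtype.ext ?_⟩)))
    exact congrArg (fun x : rookSubgroup F c D => (x : Par c F)) hq
  · obtain ⟨h, rfl⟩ := ConjClasses.exists_rep C
    obtain ⟨t, ⟨htT, hc⟩, -⟩ := hT ⟨h, rookSubgroup_le_levi D h.2⟩
    obtain ⟨p, hp⟩ := isConj_iff.mp hc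
    have hp' : (p : Par c F) * h * (p : Par c F)⁻¹ = t :=
      congrArg (fun x : levi c F => (x : Par c F)) hp
    refine ⟨⟨⟨t, htT⟩, hp' ▸ conj_mem_rookSubgroup p.2 h.2⟩, ?_⟩
    rw [ConjClasses.mk_eq_mk_iff_isConj]
    refine IsConj.symm ?_
    obtain ⟨q, hq, H⟩ := exists_conj_eq D p.2
    refine isConj_iff.mpr ⟨⟨q, hq⟩, Subtype.ext ?_⟩
    rw [← hp', H h h.2]
    rfl

/-- Membership of a `J`-root in `Δ_h` depends only on its block, and equivalent placements occupy
the same blocks. -/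
theorem RookEquiv.subset_rootsOf {h : levi c F} {D D' : Finset (Fin n × Fin n)}
    (hDD' : RookEquiv c D D') (hD : ∀ γ ∈ D, γ ∈ rootsOf h) (hD' : ∀ γ ∈ D', γ ∈ jRoots c) :
    ∀ γ ∈ D', γ ∈ rootsOf h := by
  intro γ hγ
  have h1 := hDD' (c.index γ.1) (c.index γ.2) (hD' γ hγ)
  have h2 : 0 < blockCount c D' (c.index γ.1) (c.index γ.2) :=
    Finset.card_pos.mpr ⟨γ, Finset.mem_filter.mpr ⟨hγ, rfl, rfl⟩⟩
  rw [← h1] at h2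
  obtain ⟨δ, hδ⟩ := Finset.card_pos.mp h2
  obtain ⟨hδD, e1, e2⟩ := Finset.mem_filter.mp hδ
  have := (mem_rootsOf_iff.mp (hD δ hδD)).2
  rw [e1, e2] at this
  exact mem_rootsOf_iff.mpr ⟨hD' γ hγ, this⟩

/-- The placements in `R` with `h ∈ H(D)` are those inside `Δ_h`, and they represent the same
equivalence classes as `Q`. -/
theorem card_rookTransversal {R : Set (Finset (Fin n × Fin n))}
    (hR : IsRookTransversal c (jRoots c) R) (h : levi c F) {Q : Set (Finset (Fin n × Fin n))}
    (hQ : IsRookTransversal c (rootsOf h) Q) :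
    Nat.card {D : R // (h : Par c F) ∈ rookSubgroup F c D} = Nat.card Q := by
  have hmem : ∀ D : {D : R // (h : Par c F) ∈ rookSubgroup F c D},
      IsRookPlacement (rootsOf h) D.1.1 := fun D =>
    (hR.1 _ D.1.2).mono subset_rfl
      ((mem_rookSubgroup_iff_subset (hR.1 _ D.1.2).subset).mp D.2)
  choose f hf using fun D => (hQ.2 _ (hmem D)).exists
  refine Nat.card_congr (Equiv.ofBijective (fun D => ⟨f D, (hf D).1⟩) ⟨fun D D' h => ?_, ?_⟩)
  · have h' : f D = f D' := congrArg Subtype.val h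
    refine Subtype.ext (Subtype.ext (hR.eq D.1.2 D'.1.2 ((hf D).2.trans ?_)))
    rw [h']
    exact (hf D').2.symm
  · rintro ⟨E, hE⟩
    have hE' := isRookPlacement_jRoots (hQ.1 E hE)
    obtain ⟨D, ⟨hD, hED⟩, -⟩ := hR.2 E hE'
    have hDh := hED.subset_rootsOf (hQ.1 E hE).subset (hR.1 D hD).subset
    let D' : {D : R // (h : Par c F) ∈ rookSubgroup F c D} :=
      ⟨⟨D, hD⟩, (mem_rookSubgroup_iff_subset (hR.1 D hD).subset).mpr hDh⟩
    exact ⟨D', Subtype.ext (hQ.eq (hf D').1 hE ((hf D').2.symm.trans hED.symm))⟩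

/-- The two ways of listing the pairs in a relation. -/
def sigmaSubtypeSwap {α β : Type*} (r : α → β → Prop) :
    (Σ a, {b // r a b}) ≃ Σ b, {a // r a b} where
  toFun w := ⟨w.2.1, w.1, w.2.2⟩
  invFun w := ⟨w.2.1, w.1, w.2.2⟩
  left_inv _ := rfl
  right_inv _ := rfl

/-- Double counting of the relation `r`, applied to `h ∈ H(D)`. -/
theorem card_sigma_eq_of_card_subtype {α β : Type*} {A : α → Type*} {B : β → Type*}
    [∀ a, Finite (A a)] [∀ b, Finite (B b)] [Finite α] [Finite β] (r : α → β → Prop)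
    (hA : ∀ a, Nat.card (A a) = Nat.card {b // r a b})
    (hB : ∀ b, Nat.card {a // r a b} = Nat.card (B b)) :
    Nat.card (Σ a, A a) = Nat.card (Σ b, B b) := by
  rw [Nat.card_congr (Equiv.sigmaCongrRight fun a => (Finite.card_eq.mp (hA a)).some),
    Nat.card_congr (sigmaSubtypeSwap r),
    Nat.card_congr (Equiv.sigmaCongrRight fun b => (Finite.card_eq.mp (hB b)).some)]

/-- The numbers of supercharacters and of superclasses are equal. -/
theorem card_parameters [Finite F] {R : Set (Finset (Fin n × Fin n))}
    (hR : IsRookTransversal c (jRoots c) R) {T : Set (levi c F)} (hT : IsConjTransversal T)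
    {Q : levi c F → Set (Finset (Fin n × Fin n))}
    (hQ : ∀ h ∈ T, IsRookTransversal c (rootsOf h) (Q h)) :
    Nat.card (Σ D : R, Irr (rookSubgroup F c D)) = Nat.card (Σ h : T, Q h) := by
  have h1 : ∀ D : R, Finite (Irr (rookSubgroup F c D)) := fun D => finite_irr
  have h2 : ∀ t : T, Finite (Q t) := fun t => Subtype.finite
  have h3 : Finite R := Subtype.finite
  have h4 : Finite T := Subtype.finite
  have hA : ∀ D : R, Nat.card (Irr (rookSubgroup F c D)) =
      Nat.card {t : T // ((t : levi c F) : Par c F) ∈ rookSubgroup F c D} := by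
    intro D
    rw [card_irr]
    exact card_conjClasses_rookSubgroup hT D
  have hB : ∀ t : T, Nat.card {D : R // ((t : levi c F) : Par c F) ∈ rookSubgroup F c D} =
      Nat.card (Q t) := fun t => card_rookTransversal hR t.1 (hQ t.1 t.2)
  exact card_sigma_eq_of_card_subtype (A := fun D : R => Irr (rookSubgroup F c D))
    (B := fun t : T => Q t)
    (fun (D : R) (t : T) => ((t : levi c F) : Par c F) ∈ rookSubgroup F c D) hA hB

theorem superclass_one_zero : superclass (1 : levi c F) (0 : radical c F) = {1} := by
  ext g
  rw [mem_superclass, idealOf_one, Set.mem_singleton_iff]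
  constructor
  · rintro ⟨hc, a, b, h⟩
    have h1 : leviPart g = 1 := congrArg Subtype.val (isConj_one_right.mp hc)
    have h2 : radPart g = 0 := by simpa using h
    apply mat_injective
    rw [mat_eq g, h1, h2]
    simp
  · rintro rfl
    refine ⟨?_, 1, 1, ?_⟩
    · have : leviL (1 : Par c F) = 1 := Subtype.ext leviPart_one
      rw [this]
    · simp [radPart_one]

end Counting

/-! ### Values on superclasses and scalar products. -/

section Values

variable {n : ℕ} {c : Composition n} {F : Type*} [Field F] [Finite F]

/-- The orbit of `lam` kills `J_h` because `h` is in the stabilizer, and the factors `a`, `b` are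
absorbed by the summation over `G × G`. -/
theorem orbitSum_eq (ε : AddChar F ℂ) {lam : Forms c F} {h : levi c F}
    (hh : (h : Par c F) ∈ orbitStabilizer lam) {x y : radical c F} {a b : Par c F}
    (hy : y - lmul a (rmul b x) ∈ idealOf h) : orbitSum ε lam y = orbitSum ε lam x := by
  have := Fintype.ofFinite (Par c F)
  simp only [orbitSum, finsum_eq_sum_of_fintype]
  refine Fintype.sum_equiv (Equiv.mulRight a) _ _ fun s => ?_
  refine Fintype.sum_equiv (Equiv.mulLeft b) _ _ fun d => ?_
  have h1 := mem_idealOf.mp hy lam hh s d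
  rw [map_sub, map_sub, map_sub, sub_eq_zero] at h1
  rw [h1, Equiv.coe_mulLeft, Equiv.coe_mulRight, lmul_mul, rmul_mul, lmul_rmul a d]

theorem chi_eq_of_mem_superclass {ε : AddChar F ℂ} (hε : ε ≠ 1) {lam : Forms c F}
    {H₀ : Subgroup (Par c F)} (hH : H₀ = orbitStabilizer lam) {θ : H₀ → ℂ}
    (hθ : ConjInvariant (levi c F) θ) {h : levi c F} {x : radical c F} {g : Par c F}
    (hg : g ∈ superclass h x) :
    chi ε H₀ θ lam g = extendByZero H₀ θ h * (chiFactor lam * orbitSum ε lam x) := by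
  obtain ⟨hc, a, b, hab⟩ := mem_superclass.mp hg
  obtain ⟨p, hp⟩ := isConj_iff.mp hc
  have hp' : (p : Par c F) * h * (p : Par c F)⁻¹ = leviPart g :=
    congrArg (fun x : levi c F => (x : Par c F)) hp
  rw [chi_apply hε hH hθ]
  subst hH
  rw [← hp', extendByZero_conj hθ p.2]
  by_cases hh : (h : Par c F) ∈ orbitStabilizer lam
  · rw [orbitSum_eq ε hh hab]
  · simp [extendByZero, hh]

/-- Each value is a function of the Levi component times a function of the radical component, so the
sum over `G` splits along `h (1 + x) ↦ (h, x)`. -/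
theorem scalarProduct_chi {ε : AddChar F ℂ} (hε : ε ≠ 1) {lam lam' : Forms c F}
    {H₀ H₀' : Subgroup (Par c F)} (hH : H₀ = orbitStabilizer lam)
    (hH' : H₀' = orbitStabilizer lam') {θ : H₀ → ℂ} {θ' : H₀' → ℂ}
    (hθ : ConjInvariant (levi c F) θ) (hθ' : ConjInvariant (levi c F) θ')
    [Fintype (levi c F)] [Fintype (radical c F)] :
    scalarProduct (chi ε H₀ θ lam) (chi ε H₀' θ' lam') =
      (Nat.card (Par c F) : ℂ)⁻¹ * (chiFactor lam * starRingEnd ℂ (chiFactor lam')) *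
      ((∑ h : levi c F, extendByZero H₀ θ h * starRingEnd ℂ (extendByZero H₀' θ' h)) *
        ∑ x, orbitSum ε lam x * starRingEnd ℂ (orbitSum ε lam' x)) := by
  have := Fintype.ofFinite (Par c F)
  rw [scalarProduct, finsum_eq_sum_of_fintype, Finset.sum_mul_sum, ← Fintype.sum_prod_type',
    Finset.mul_sum, Finset.mul_sum]
  refine Fintype.sum_equiv leviRadEquiv _ _ fun g => ?_
  rw [chi_apply hε hH hθ, chi_apply hε hH' hθ']
  simp only [map_mul]
  change _ = _ * (extendByZero H₀ θ (leviPart g) * starRingEnd ℂ (extendByZero H₀' θ' (leviPart g))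
    * (orbitSum ε lam (radPart g) * starRingEnd ℂ (orbitSum ε lam' (radPart g))))
  ring

theorem sum_levi_extendByZero {H₀ : Subgroup (Par c F)} (hle : H₀ ≤ levi c F) (θ θ' : H₀ → ℂ)
    [Fintype (levi c F)] :
    ∑ h : levi c F, extendByZero H₀ θ h * starRingEnd ℂ (extendByZero H₀ θ' h) =
      Nat.card H₀ * scalarProduct θ θ' := by
  have := Fintype.ofFinite H₀
  have hc : (Nat.card H₀ : ℂ) ≠ 0 := Nat.cast_ne_zero.mpr Nat.card_pos.ne'
  rw [scalarProduct, finsum_eq_sum_of_fintype, mul_inv_cancel_left₀ hc]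
  refine (Fintype.sum_of_injective (Subgroup.inclusion hle) (Subgroup.inclusion_injective hle) _ _
    (fun h hh => ?_) fun h => ?_).symm
  · have : (h : Par c F) ∉ H₀ := fun h' => hh ⟨⟨h, h'⟩, rfl⟩
    simp [extendByZero, this]
  · simp [extendByZero]

end Values

end GGParabolic

end

/-! ### Assembly of the supercharacter theory. -/

theorem mainTheorem4 {F : Type*} [Field F] [Finite F] (ε : AddChar F ℂ) (hε : ε ≠ 1)
    {n : ℕ} (c : Composition n)
    (R : Set (Finset (Fin n × Fin n))) (hR : IsRookTransversal c (jRoots c) R)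
    (T : Set (levi c F)) (hT : IsConjTransversal T)
    (Q : levi c F → Set (Finset (Fin n × Fin n)))
    (hQ : ∀ h ∈ T, IsRookTransversal c (rootsOf h) (Q h)) :
    let χ : (Σ D : R, Irr (rookSubgroup F c D)) → Par c F → ℂ :=
      fun α => chi ε (rookSubgroup F c α.1) α.2.1 (rookForm α.1)
    let K : (Σ h : T, Q h) → Set (Par c F) :=
      fun β => superclass β.1.1 (rookElement β.2.1)
    -- these characters and subsets form a supercharacter theory
    IsSupercharacterTheory χ K ∧
    -- it is the `GG`-supercharacter theory of the parabolic subgroup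
    Set.range χ = ggSupercharacters c ε ∧
    Set.range K = ggSuperclasses c F ∧
    -- `H(D) = H_{G lam_D G}`
    (∀ D, IsRookPlacement (jRoots c) D → rookSubgroup F c D = orbitStabilizer (rookForm D)) ∧
    -- `J_h` is the radical given by the maximal decomposition into scalar segments
    (∀ h : levi c F, ∃ r : Setoid (Fin c.length),
      IsGreatest {r | IsScalarDecomposition h r} r ∧ (idealOf h : Set (radical c F)) =
        coarseRadical r) := by
  intro χ K
  have hH : ∀ D ∈ R, rookSubgroup F c D = orbitStabilizer (rookForm D) := fun D hD =>
    rookSubgroup_eq_orbitStabilizer (hR.1 D hD)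
  -- every superclass is one of the `K β`
  have hK : ∀ (h : levi c F) (x : radical c F), ∃ β, superclass h x = K β := by
    intro h x
    obtain ⟨t, ⟨ht, hc⟩, -⟩ := hT h
    obtain ⟨D, hD, a, b, hab⟩ := exists_rookElement t x
    obtain ⟨D', ⟨hD', hDD'⟩, -⟩ := (hQ t ht).2 D hD
    obtain ⟨a', b', h'⟩ := hDD'.exists_rookElement_eq (F := F) (isRookPlacement_jRoots hD)
      (isRookPlacement_jRoots ((hQ t ht).1 D' hD'))
    refine ⟨⟨⟨t, ht⟩, ⟨D', hD'⟩⟩, ?_⟩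
    have h1 : rookElement D' - lmul a' (rmul b' (rookElement D)) ∈ idealOf t := by
      rw [h', sub_self]
      exact zero_mem _
    have h2 := sub_mem_idealOf_trans hab h1
    rw [← idealOf_eq_of_isConj hc] at h2
    exact superclass_eq hc h2
  refine ⟨⟨?_, ?_, ?_, ?_, ?_, ?_, ?_, ?_, ?_, ?_, card_parameters hR hT hQ⟩, ?_, ?_,
    fun D hD => rookSubgroup_eq_orbitStabilizer hD,
    fun h => ⟨scalarSetoid h, isGreatest_scalarSetoid h, coe_idealOf h⟩⟩
  · exact fun α => isCharacter_chi ε (hH _ α.1.2) α.2.2.isCharacter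
  · exact fun α => chi_ne_zero hε (hH _ α.1.2) α.2.2.isCharacter.conjInvariant α.2.2.ne_zero
  · rintro ⟨D, θ⟩ ⟨D', θ'⟩ hne
    have := Fintype.ofFinite (levi c F)
    have := Fintype.ofFinite (radical c F)
    by_cases hD : D = D'
    · subst hD
      have hθ : θ.1 ≠ θ'.1 := fun h => hne (by rw [Subtype.ext h])
      simp only [χ]
      rw [scalarProduct_chi hε (hH _ D.2) (hH _ D.2) θ.2.isCharacter.conjInvariant
        θ'.2.isCharacter.conjInvariant, sum_levi_extendByZero (rookSubgroup_le_levi _),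
        θ.2.scalarProduct_eq_zero θ'.2 hθ]
      simp
    -- Inequivalent placements give forms in different orbits, so the factor over `J` vanishes; for
    -- a common `D` it was the factor over `L`.
    · simp only [χ]
      rw [scalarProduct_chi hε (hH _ D.2) (hH _ D'.2) θ.2.isCharacter.conjInvariant
        θ'.2.isCharacter.conjInvariant, sum_orbitSum_mul_conj hε, mul_zero, mul_zero]
      intro a b hab
      exact hD (Subtype.ext (hR.eq D.2 D'.2
        (rookEquiv_of_formAct (hR.1 _ D.2) (hR.1 _ D'.2) a b hab)))
  · intro β
    obtain ⟨g, hg⟩ := leviRadEquiv.surjective (β.1.1, (rookElement β.2.1 : radical c F))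
    have h1 : leviL g = β.1.1 := congrArg Prod.fst hg
    have h2 : radPart g = rookElement β.2.1 := congrArg Prod.snd hg
    refine ⟨g, mem_superclass.mpr ⟨by rw [h1], 1, 1, ?_⟩⟩
    rw [h2, lmul_one, rmul_one, sub_self]
    exact zero_mem _
  · rintro ⟨t, D⟩ ⟨t', D'⟩ hne
    rw [Set.disjoint_left]
    intro g hg hg'
    obtain ⟨hc, a, b, hab⟩ := mem_superclass.mp hg
    obtain ⟨hc', a', b', hab'⟩ := mem_superclass.mp hg'
    obtain rfl : t = t' := Subtype.ext (hT.eq t.2 t'.2 (hc.trans hc'.symm))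
    refine hne ?_
    have hQt := hQ t t.2
    have := rookEquiv_of_sub_mem_idealOf (hQt.1 _ D.2) (hQt.1 _ D'.2)
      (sub_mem_idealOf_trans hab (sub_mem_idealOf_symm hab'))
    rw [Subtype.ext (hQt.eq D.2 D'.2 this)]
  · rw [Set.eq_univ_iff_forall]
    intro g
    obtain ⟨β, hβ⟩ := hK (leviL g) (radPart g)
    refine Set.mem_iUnion.mpr ⟨β, hβ ▸ mem_superclass.mpr ⟨IsConj.refl _, 1, 1, ?_⟩⟩
    rw [lmul_one, rmul_one, sub_self]
    exact zero_mem _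
  · obtain ⟨β, hβ⟩ := hK 1 0
    exact ⟨β, by rw [← hβ, superclass_one_zero]⟩
  · intro α β g hg g' hg'
    have hθ := α.2.2.isCharacter.conjInvariant
    simp only [χ]
    rw [chi_eq_of_mem_superclass hε (hH _ α.1.2) hθ hg,
      chi_eq_of_mem_superclass hε (hH _ α.1.2) hθ hg']
  · infer_instance
  · infer_instance
  · ext f
    constructor
    · rintro ⟨⟨D, θ, hθ⟩, rfl⟩
      have h1 := isRelIrreducible_iff.mpr hθ
      simp only [χ]
      -- The type of `θ` depends on the subgroup, so `θ` is generalized before `H(D)` is replaced by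
      -- the stabilizer.
      clear hθ
      revert θ
      rw [hH _ D.2]
      exact fun θ h1 => ⟨_, θ, h1, rfl⟩
    · rintro ⟨lam, θ, hθ, rfl⟩
      obtain ⟨D, hD, a, b, hab⟩ := exists_formAct_eq_rookForm lam
      obtain ⟨D', ⟨hD', hDD'⟩, -⟩ := hR.2 D hD
      obtain ⟨a', b', hab'⟩ := hDD'.exists_formAct (F := F) hD (hR.1 D' hD')
      rw [← hab, formAct_formAct] at hab'
      have hlam : orbitStabilizer lam = rookSubgroup F c D' := by
        rw [hH D' hD', ← hab', orbitStabilizer_formAct]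
      -- Moving `lam` to the representative of its orbit changes neither the stabilizer nor the
      -- supercharacter.
      have hchi := chi_formAct hε (a' * a) (b * b') rfl hθ.invariant
      rw [hab'] at hchi
      rw [← hchi]
      clear hchi
      revert θ
      rw [hlam]
      exact fun θ hθ => ⟨⟨⟨D', hD'⟩, θ, isRelIrreducible_iff.mp hθ⟩, rfl⟩
  · ext X
    constructor
    · rintro ⟨β, rfl⟩
      exact ⟨_, _, rfl⟩
    · rintro ⟨h, x, rfl⟩
      obtain ⟨β, hβ⟩ := hK h x
      exact ⟨β, hβ.symm⟩
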